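/- **Setting.** Let $X$ be a deterministic $n\times p$ matrix with columns $X_{\cdot,i}$ and $\|X\|=\max_i\|X_{\cdot,i}\|_2$. Observe $Y=X\beta^0+\varepsilon$ with $\varepsilon$ standard normal in $\mathbb R^n$; $\mathbb E_{\beta^0}$ is the expectation under $Y\sim N(X\beta^0,I)$. For $\beta\in\mathbb R^p$ put $S_\beta=\{i:\beta_i\ne0\}$, and $S_0=S_{\beta^0}$. The prior $\Pi$ on $\beta$ draws a dimension $s\in\{0,\dots,p\}$ from a probability vector $\pi_p$, then a uniformly random set $S\subset\{1,\dots,p\}$ with $|S|=s$, then $\beta_i$, $i\in S$, i.i.d. from the Laplace density $\tfrac\lambda2e^{-\lambda|x|}$ ($\lambda>0$), and puts $\beta_i=0$ for $i\notin S$. The posterior is $\Pi(B\mid Y)=\int_B e^{-\|Y-X\beta\|_2^2/2}\,d\Pi(\beta)\big/\int e^{-\|Y-X\beta\|_2^2/2}\,d\Pi(\beta)$. With $\overline\lambda=2\|X\|\sqrt{\log p}$, assume $$\frac{\|X\|}{p}\le\lambda\le2\overline\lambda,\qquad A_1p^{-A_3}\pi_p(s-1)\le\pi_p(s)\le A_2p^{-A_4}\pi_p(s-1)\quad(s=1,\dots,p)$$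 for fixed constants $A_1,A_2,A_3,A_4>0$. Limits are along arbitrary sequences $(n,p,X,\lambda,\pi_p)$ of this kind with $p\to\infty$. **Design numbers** (with $\inf\emptyset=\infty$). $$\phi(S)=\inf\Big\{\tfrac{\|X\beta\|_2|S|^{1/2}}{\|X\|\,\|\beta_S\|_1}:\|\beta_{S^c}\|_1\le7\|\beta_S\|_1,\ \beta_S\ne0\Big\},$$ $$\overline\phi(s)=\inf\Big\{\tfrac{\|X\beta\|_2|S_\beta|^{1/2}}{\|X\|\,\|\beta\|_1}:0\ne|S_\beta|\le s\Big\},\qquad \widetilde\phi(s)=\inf\Big\{\tfrac{\|X\beta\|_2}{\|X\|\,\|\beta\|_2}:0\ne|S_\beta|\le s\Big\},$$ $$\mathrm{mc}(X)=\max_{i\ne j}\frac{|\langle X_{\cdot,i},X_{\cdot,j}\rangle|}{\|X_{\cdot,i}\|_2\|X_{\cdot,j}\|_2},$$ and $\overline\psi(S)=\overline\phi(D(S))$, $\widetilde\psi(S)=\widetilde\phi(D(S))$ with $D(S)=\Big(2+\frac3{A_4}+\frac{33}{A_4\,\phi(S)^2}\frac{\lambda}{\overline\lambda}\Big)|S|$.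 **Theorem (Selection).** For all $M$ larger than a constant that depends only on $A_1,\dots,A_4$ (thresholds with a zero in the denominator being $+\infty$), $$\inf_{\beta^0}\mathbb E_{\beta^0}\Pi\Big(\beta:S_\beta\supset\Big\{i\in S_0:|\beta^0_i|\ge\frac{M}{\overline\psi(S_0)^2}\frac{|S_0|\sqrt{\log p}}{\|X\|\phi(S_0)^2}\Big\}\,\Big|\,Y\Big)\to1,$$ $$\inf_{\beta^0}\mathbb E_{\beta^0}\Pi\Big(\beta:S_\beta\supset\Big\{i\in S_0:|\beta^0_i|\ge\frac{M}{\widetilde\psi(S_0)^2}\frac{\sqrt{|S_0|\log p}}{\|X\|\phi(S_0)}\Big\}\,\Big|\,Y\Big)\to1.$$ Furthermore, for every $c_0>0$ and all $M$ larger than a constant that depends only on $c_0,A_1,\dots,A_4$, for any $0<d_0\le c_0^2(1+2/A_4)^{-1}/8$ and any $s_n\ge0$ with $\lambda s_n\sqrt{\log p}/\|X\|\to0$, $$\inf_{\substack{\beta^0:\ \phi(S_0)\ge c_0,\ \widetilde\psi(S_0)\ge c_0,\\ |S_0|\le s_n,\ |S_0|\le d_0\,\mathrm{mc}(X)^{-1}}}\mathbb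 E_{\beta^0}\Pi\Big(\beta:S_\beta\supset\Big\{i:|\beta^0_i|\ge\frac{M\sqrt{\log p}}{\|X\|}\Big\}\,\Big|\,Y\Big)\to1.$$ -/

import Mathlib

open MeasureTheory ProbabilityTheory Filter Topology
open scoped ENNReal Matrix

noncomputable section

namespace SparseRegression

/-! ### Vectors and the design matrix -/

/-- The Euclidean norm of a finite real vector. -/
def l2norm {m : ℕ} (v : Fin m → ℝ) : ℝ := ‖WithLp.toLp 2 v‖

/-- The `ℓ¹`-norm of the restriction of `v` to the coordinates in `S`. -/
def l1normOn {m : ℕ} (S : Finset (Fin m)) (v : Fin m → ℝ) : ℝ := ∑ i ∈ S, |v i|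

/-- The support `S_β = {i : β_i ≠ 0}`. -/
def supp {p : ℕ} (β : Fin p → ℝ) : Finset (Fin p) := Finset.univ.filter (fun i => β i ≠ 0)

/-- `‖X‖`, the maximal Euclidean length of a column of `X`. -/
def colNorm {n p : ℕ} (X : Matrix (Fin n) (Fin p) ℝ) : ℝ := ⨆ i : Fin p, l2norm (X.col i)

/-- `2 ‖X‖ √(log p)`, the upper reference value for the scale parameter. -/
def lamBar {n p : ℕ} (X : Matrix (Fin n) (Fin p) ℝ) : ℝ := 2 * colNorm X * √(Real.log p)

/-- The compatibility number `φ(S)` of a model `S`, as an extended nonnegative number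
(an infimum over the empty set is `∞`, which happens only for `S = ∅`). -/
def compat {n p : ℕ} (X : Matrix (Fin n) (Fin p) ℝ) (S : Finset (Fin p)) : ℝ≥0∞ :=
  ⨅ β ∈ {β : Fin p → ℝ | l1normOn Sᶜ β ≤ 7 * l1normOn S β ∧ ∃ i ∈ S, β i ≠ 0},
    ENNReal.ofReal (l2norm (X *ᵥ β) * √(S.card : ℝ) / (colNorm X * l1normOn S β))

/-- The uniform compatibility number in vectors of dimension at most `s`. -/
def unifCompat {n p : ℕ} (X : Matrix (Fin n) (Fin p) ℝ) (s : ℝ≥0∞) : ℝ≥0∞ :=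
  ⨅ β ∈ {β : Fin p → ℝ | (supp β).card ≠ 0 ∧ ((supp β).card : ℝ≥0∞) ≤ s},
    ENNReal.ofReal (l2norm (X *ᵥ β) * √((supp β).card : ℝ) /
      (colNorm X * l1normOn Finset.univ β))

/-- The smallest scaled sparse singular value of dimension `s`. -/
def sparseSing {n p : ℕ} (X : Matrix (Fin n) (Fin p) ℝ) (s : ℝ≥0∞) : ℝ≥0∞ :=
  ⨅ β ∈ {β : Fin p → ℝ | (supp β).card ≠ 0 ∧ ((supp β).card : ℝ≥0∞) ≤ s},
    ENNReal.ofReal (l2norm (X *ᵥ β) / (colNorm X * l2norm β))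

/-- The mutual coherence number: the maximal absolute correlation of two distinct columns. -/
def mutualCoherence {n p : ℕ} (X : Matrix (Fin n) (Fin p) ℝ) : ℝ :=
  ⨆ q : {q : Fin p × Fin p // q.1 ≠ q.2},
    |X.col q.1.1 ⬝ᵥ X.col q.1.2| / (l2norm (X.col q.1.1) * l2norm (X.col q.1.2))

/-- The dimension `(2 + 3/A₄ + 33/(A₄ φ(S)²) · λ/λ̄) |S|`
at which the sparse invertibility numbers are evaluated. -/
def effDim {n p : ℕ} (X : Matrix (Fin n) (Fin p) ℝ) (A₄ lam : ℝ) (S : Finset (Fin p)) : ℝ≥0∞ :=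
  (ENNReal.ofReal (2 + 3 / A₄)
    + ENNReal.ofReal (33 / A₄) / compat X S ^ 2 * ENNReal.ofReal (lam / lamBar X)) * S.card

/-- `ψ̄(S)`. -/
def psiBar {n p : ℕ} (X : Matrix (Fin n) (Fin p) ℝ) (A₄ lam : ℝ) (S : Finset (Fin p)) : ℝ≥0∞ :=
  unifCompat X (effDim X A₄ lam S)

/-- `ψ̃(S)`. -/
def psiTilde {n p : ℕ} (X : Matrix (Fin n) (Fin p) ℝ) (A₄ lam : ℝ) (S : Finset (Fin p)) :
    ℝ≥0∞ :=
  sparseSing X (effDim X A₄ lam S)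

/-! ### Prior, data and posterior -/

/-- `π` is a probability vector on `{0, …, p}`. -/
structure IsDimPrior (p : ℕ) (π : ℕ → ℝ) : Prop where
  nonneg : ∀ s ≤ p, 0 ≤ π s
  sum_eq_one : ∑ s ∈ Finset.range (p + 1), π s = 1

/-- The decrease condition on the prior on the dimension, with constants `A₁, A₂, A₃, A₄`. -/
def DimDecrease (A₁ A₂ A₃ A₄ : ℝ) (p : ℕ) (π : ℕ → ℝ) : Prop :=
  ∀ s ∈ Finset.Icc 1 p,
    A₁ * (p : ℝ) ^ (-A₃) * π (s - 1) ≤ π s ∧ π s ≤ A₂ * (p : ℝ) ^ (-A₄) * π (s - 1)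

/-- The Laplace distribution with density `x ↦ (lam / 2) exp (- lam |x|)`. -/
def laplace (lam : ℝ) : Measure ℝ :=
  volume.withDensity (fun x => ENNReal.ofReal (lam / 2 * Real.exp (-lam * |x|)))

/-- Given the model `S`, the coordinates in `S` are i.i.d. Laplace and the others are zero. -/
def slab (p : ℕ) (lam : ℝ) (S : Finset (Fin p)) : Measure (Fin p → ℝ) :=
  Measure.pi (fun i => if i ∈ S then laplace lam else Measure.dirac 0)

/-- The prior on `β`: the dimension is drawn from `π`, then a uniformly random model `S` of this
dimension, and then `β` from `slab p lam S`. -/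
def prior (p : ℕ) (lam : ℝ) (π : ℕ → ℝ) : Measure (Fin p → ℝ) :=
  ∑ S : Finset (Fin p),
    ENNReal.ofReal (π S.card * (1 / (p.choose S.card : ℝ))) • slab p lam S

/-- The Gaussian likelihood `exp (-‖y - X β‖₂² / 2)`. -/
def likelihood {n p : ℕ} (X : Matrix (Fin n) (Fin p) ℝ) (y : Fin n → ℝ) (β : Fin p → ℝ) : ℝ≥0∞ :=
  ENNReal.ofReal (Real.exp (-(l2norm (y - X *ᵥ β)) ^ 2 / 2))

/-- The posterior probability `Π[B | Y = y]`, by Bayes's formula. -/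
def posterior {n p : ℕ} (X : Matrix (Fin n) (Fin p) ℝ) (lam : ℝ) (π : ℕ → ℝ) (y : Fin n → ℝ)
    (B : Set (Fin p → ℝ)) : ℝ≥0∞ :=
  (∫⁻ β in B, likelihood X y β ∂(prior p lam π)) / ∫⁻ β, likelihood X y β ∂(prior p lam π)

/-- The law `N(X β⁰, I)` of the data. -/
def dataLaw {n p : ℕ} (X : Matrix (Fin n) (Fin p) ℝ) (β₀ : Fin p → ℝ) : Measure (Fin n → ℝ) :=
  Measure.pi (fun j => gaussianReal ((X *ᵥ β₀) j) 1)

/-- The expected posterior probability `E_{β⁰} Π(B | Y)`. -/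
def expPosterior {n p : ℕ} (X : Matrix (Fin n) (Fin p) ℝ) (lam : ℝ) (π : ℕ → ℝ)
    (β₀ : Fin p → ℝ) (B : Set (Fin p → ℝ)) : ℝ≥0∞ :=
  ∫⁻ y, posterior X lam π y B ∂(dataLaw X β₀)

/-- A sequence of regression problems and priors, with the dimension of the parameter tending
to infinity, that satisfies the standing conditions on `lam` and `π`. -/
structure Regime (A₁ A₂ A₃ A₄ : ℝ) (n p : ℕ → ℕ)
    (X : ∀ k, Matrix (Fin (n k)) (Fin (p k)) ℝ) (lam : ℕ → ℝ) (π : ℕ → ℕ → ℝ) : Prop where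
  tendsto_p : Tendsto p atTop atTop
  lam_pos : ∀ k, 0 < lam k
  le_lam : ∀ k, colNorm (X k) / p k ≤ lam k
  lam_le : ∀ k, lam k ≤ 2 * lamBar (X k)
  isDimPrior : ∀ k, IsDimPrior (p k) (π k)
  dimDecrease : ∀ k, DimDecrease A₁ A₂ A₃ A₄ (p k) (π k)

/-! ### Detection thresholds -/

/-- The `ℓ¹`-type threshold `(M / ψ̄(S)²) · |S| √(log p) / (‖X‖ φ(S)²)`. -/
def thresholdL1 {n p : ℕ} (X : Matrix (Fin n) (Fin p) ℝ) (A₄ lam M : ℝ) (S : Finset (Fin p)) :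
    ℝ≥0∞ :=
  ENNReal.ofReal M / psiBar X A₄ lam S ^ 2 *
    (ENNReal.ofReal (S.card * √(Real.log p)) / (ENNReal.ofReal (colNorm X) * compat X S ^ 2))

/-- The `ℓ²`-type threshold `(M / ψ̃(S)²) · √(|S| log p) / (‖X‖ φ(S))`. -/
def thresholdL2 {n p : ℕ} (X : Matrix (Fin n) (Fin p) ℝ) (A₄ lam M : ℝ) (S : Finset (Fin p)) :
    ℝ≥0∞ :=
  ENNReal.ofReal M / psiTilde X A₄ lam S ^ 2 *
    (ENNReal.ofReal √(S.card * Real.log p) / (ENNReal.ofReal (colNorm X) * compat X S))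

end SparseRegression

end

noncomputable section

namespace SparseRegression

/-! ### Norms -/

/-! Write `s = |S₀|`, `φ` for the compatibility number of `S₀` and `D` for the effective dimension.
A posterior probability is a ratio. Its denominator is bounded below in `Admissible.le_evidence`:
keep only the model `S₀`, translate by `β⁰` (the Laplace density loses `exp(-λ‖β⁰‖₁)`), and average
over `β ↦ -β`, which removes the noise because `eᵘ + e⁻ᵘ ≥ 2`. Hence the posterior of `B` is at most
`p^(2s) e^(s+2) / π(s)` times the prior integral over `B` of `exp(logRatio)`. From this one splits
off `exp(λ‖β‖₁ - (λ/4)‖β-β⁰‖₁)`, whose integral under a model of dimension `t` is at most `4^t`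
(`lintegral_exp_slab_le`); the rest is bounded pointwise in `β`.

The argument takes place on `noiseEvent`, which fails with probability at most `2/p`. Two families
of `β` are negligible there. (a) Large dimension (`Admissible.lintegral_posterior_largeModels_le`).
A fraction `λ/(2λ̄)` of the noise term is bounded through the event, and the rest is integrated by
the Gaussian moment generating function. Compatibility leaves a factor `p^(16 s λ/(λ̄φ²))`, and the
decrease of `π` beats it, together with the evidence factor, as soon as `|S_β| + s > D`. (b)
Moderate dimension but large prediction error (`Admissible.posterior_farModels_le`). Now `β - β⁰`
has at most `D` nonzero coordinates, so `ψ̄` turns the `ℓ¹`-terms into prediction error, and the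
Gaussian quadratic dominates.

So the posterior concentrates on `goodModels`, where `ψ̄` and `ψ̃` convert prediction error into
`ℓ¹`- and `ℓ²`-error below the two thresholds. A missed coordinate satisfies `|β⁰_i| = |(β-β⁰)_i|`,
so a coordinate above the threshold cannot be missed: the first two claims are then deterministic.

For the third claim these norms are too crude by powers of `s`. Instead, take a good `β` that misses
a coordinate with `|β⁰_i| ≥ M√(log p)/‖X‖`. Small coherence and the `ℓ¹`-bound show that its
residual is still strongly correlated with column `i` (`le_abs_residual_dotProduct_col`). Adding `i`
to the model then multiplies the likelihood by a power of `p` that exceeds the prior cost of one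
more coordinate by `p²` (`Admissible.posterior_le_of_gain`). A union bound over `i` leaves `1/p`. -/

lemma l2norm_nonneg {m : ℕ} (v : Fin m → ℝ) : 0 ≤ l2norm v := norm_nonneg _

lemma l2norm_sq {m : ℕ} (v : Fin m → ℝ) : l2norm v ^ 2 = v ⬝ᵥ v := by
  rw [l2norm, EuclideanSpace.norm_sq_eq]
  simp [dotProduct, sq]

lemma l2norm_neg {m : ℕ} (v : Fin m → ℝ) : l2norm (-v) = l2norm v := by
  simp [l2norm]

lemma l2norm_smul {m : ℕ} (c : ℝ) (v : Fin m → ℝ) : l2norm (c • v) = |c| * l2norm v := by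
  simp [l2norm, norm_smul]

lemma l2norm_sum_le {m : ℕ} {ι : Type*} (s : Finset ι) (v : ι → Fin m → ℝ) :
    l2norm (∑ i ∈ s, v i) ≤ ∑ i ∈ s, l2norm (v i) := by
  simpa [l2norm, WithLp.toLp_sum] using norm_sum_le s (fun i => WithLp.toLp 2 (v i))

lemma abs_dotProduct_le {m : ℕ} (u v : Fin m → ℝ) : |u ⬝ᵥ v| ≤ l2norm u * l2norm v := by
  have h := abs_real_inner_le_norm (WithLp.toLp 2 v) (WithLp.toLp 2 u)
  rw [EuclideanSpace.inner_toLp_toLp] at h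
  simpa [l2norm, mul_comm] using h

lemma l2norm_pos {m : ℕ} {v : Fin m → ℝ} (hv : v ≠ 0) : 0 < l2norm v := by
  simpa [l2norm] using hv

lemma abs_le_l2norm {m : ℕ} (v : Fin m → ℝ) (i : Fin m) : |v i| ≤ l2norm v := by
  simpa [l2norm] using PiLp.norm_apply_le (WithLp.toLp 2 v) i

lemma l1normOn_nonneg {m : ℕ} (S : Finset (Fin m)) (v : Fin m → ℝ) : 0 ≤ l1normOn S v :=
  Finset.sum_nonneg fun _ _ => abs_nonneg _

lemma abs_le_l1norm {m : ℕ} (v : Fin m → ℝ) (i : Fin m) : |v i| ≤ l1normOn Finset.univ v :=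
  Finset.single_le_sum (f := fun i => |v i|) (fun _ _ => abs_nonneg _) (Finset.mem_univ i)

lemma l1norm_split {m : ℕ} (S : Finset (Fin m)) (v : Fin m → ℝ) :
    l1normOn Finset.univ v = l1normOn S v + l1normOn Sᶜ v :=
  (Finset.sum_add_sum_compl S _).symm

lemma mem_supp {p : ℕ} {β : Fin p → ℝ} {i : Fin p} : i ∈ supp β ↔ β i ≠ 0 := by simp [supp]

lemma l1norm_le_sqrt_card_mul_l2norm {m : ℕ} (v : Fin m → ℝ) :
    l1normOn Finset.univ v ≤ √((supp v).card : ℝ) * l2norm v := by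
  have h1 : l1normOn Finset.univ v = ∑ i ∈ supp v, 1 * |v i| := by
    simp only [one_mul]
    refine (Finset.sum_subset (Finset.subset_univ _) fun i _ hi => ?_).symm
    simpa [mem_supp] using hi
  have h2 := Finset.sum_mul_sq_le_sq_mul_sq (supp v) (fun _ => (1 : ℝ)) (fun i => |v i|)
  rw [h1]
  refine Real.le_sqrt_of_sq_le h2 |>.trans ?_
  rw [← Real.sqrt_sq (l2norm_nonneg v), ← Real.sqrt_mul (by positivity)]
  refine Real.sqrt_le_sqrt ?_
  simp only [one_pow, Finset.sum_const, nsmul_eq_mul, mul_one]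
  refine mul_le_mul_of_nonneg_left ?_ (by positivity)
  rw [l2norm_sq, dotProduct]
  refine (Finset.sum_le_sum_of_subset_of_nonneg (Finset.subset_univ _) ?_).trans
    (Finset.sum_le_sum fun i _ => ?_)
  · intros; positivity
  · rw [sq_abs, sq]

/-! ### The design matrix -/

lemma l2norm_col_le {n p : ℕ} (X : Matrix (Fin n) (Fin p) ℝ) (i : Fin p) :
    l2norm (X.col i) ≤ colNorm X :=
  le_ciSup (f := fun i => l2norm (X.col i)) (Set.finite_range _).bddAbove i

lemma mulVec_eq_sum_col {n p : ℕ} (X : Matrix (Fin n) (Fin p) ℝ) (β : Fin p → ℝ) :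
    X *ᵥ β = ∑ i, β i • X.col i := by
  ext j
  simp [Matrix.mulVec, dotProduct, mul_comm]

lemma l2norm_mulVec_le {n p : ℕ} (X : Matrix (Fin n) (Fin p) ℝ) (β : Fin p → ℝ) :
    l2norm (X *ᵥ β) ≤ colNorm X * l1normOn Finset.univ β := by
  rw [mulVec_eq_sum_col, l1normOn, Finset.mul_sum]
  refine (l2norm_sum_le _ _).trans (Finset.sum_le_sum fun i _ => ?_)
  rw [l2norm_smul, mul_comm]
  exact mul_le_mul_of_nonneg_right (l2norm_col_le X i) (abs_nonneg _)

lemma dotProduct_mulVec_eq_sum {n p : ℕ} (X : Matrix (Fin n) (Fin p) ℝ) (u : Fin n → ℝ)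
    (β : Fin p → ℝ) : u ⬝ᵥ X *ᵥ β = ∑ i, β i * (X.col i ⬝ᵥ u) := by
  rw [mulVec_eq_sum_col, dotProduct_sum]
  refine Finset.sum_congr rfl fun i _ => ?_
  rw [dotProduct_smul, dotProduct_comm, smul_eq_mul]

lemma abs_dotProduct_mulVec_le {n p : ℕ} (X : Matrix (Fin n) (Fin p) ℝ) (u : Fin n → ℝ)
    (β : Fin p → ℝ) {t : ℝ} (h : ∀ i, |X.col i ⬝ᵥ u| ≤ t) :
    |u ⬝ᵥ X *ᵥ β| ≤ t * l1normOn Finset.univ β := by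
  rw [dotProduct_mulVec_eq_sum, l1normOn, Finset.mul_sum]
  refine (Finset.abs_sum_le_sum_abs _ _).trans (Finset.sum_le_sum fun i _ => ?_)
  rw [abs_mul, mul_comm]
  exact mul_le_mul_of_nonneg_right (h i) (abs_nonneg _)

/-- Signs are chosen greedily: each new vector is given the sign that makes its inner product with
the partial sum nonpositive, so cross terms never increase the squared norm. -/
lemma exists_signs_l2norm_sum_sq_le {m : ℕ} {ι : Type*} [DecidableEq ι] (S : Finset ι)
    (v : ι → Fin m → ℝ) :
    ∃ e : ι → ℝ, (∀ i, |e i| = 1) ∧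
      l2norm (∑ i ∈ S, e i • v i) ^ 2 ≤ ∑ i ∈ S, l2norm (v i) ^ 2 := by
  induction S using Finset.induction_on with
  | empty => exact ⟨fun _ => 1, by simp, by simp [l2norm]⟩
  | insert a S ha ih =>
    obtain ⟨e, he, hS⟩ := ih
    set w := ∑ i ∈ S, e i • v i with hw
    obtain ⟨c, hc, hcw⟩ : ∃ c : ℝ, |c| = 1 ∧ c * (v a ⬝ᵥ w) ≤ 0 := by
      rcases le_total (v a ⬝ᵥ w) 0 with h | h
      · exact ⟨1, by simp, by simpa using h⟩
      · exact ⟨-1, by simp, by simpa using h⟩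
    refine ⟨Function.update e a c, fun i => ?_, ?_⟩
    · by_cases h : i = a
      · subst h; simpa using hc
      · simpa [h] using he i
    · rw [Finset.sum_insert ha, Finset.sum_insert ha]
      have h1 : ∑ i ∈ S, Function.update e a c i • v i = w := by
        refine Finset.sum_congr rfl fun i hi => ?_
        rw [Function.update_of_ne (by rintro rfl; exact ha hi)]
      rw [h1, Function.update_self]
      have h2 : l2norm (c • v a + w) ^ 2
          = c ^ 2 * l2norm (v a) ^ 2 + 2 * (c * (v a ⬝ᵥ w)) + l2norm w ^ 2 := by
        simp only [l2norm_sq, add_dotProduct, dotProduct_add, smul_dotProduct, dotProduct_smul,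
          smul_eq_mul, dotProduct_comm w (v a)]
        ring
      rw [h2, ← sq_abs c, hc]
      linarith

/-! ### Compatibility numbers -/

/-- The test vector has entries `±1` on `S`, with signs for which `‖Xβ‖² ≤ |S| ‖X‖²`. This gives
finiteness of `φ(S)` and, later, `1 ≤ 1/φ(S)²`. -/
lemma compat_le_one {n p : ℕ} {X : Matrix (Fin n) (Fin p) ℝ} (hX : 0 < colNorm X)
    {S : Finset (Fin p)} (hS : S.Nonempty) : compat X S ≤ 1 := by
  obtain ⟨e, he, hle⟩ := exists_signs_l2norm_sum_sq_le S X.col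
  set β : Fin p → ℝ := fun i => if i ∈ S then e i else 0 with hβ
  have hXβ : X *ᵥ β = ∑ i ∈ S, e i • X.col i := by
    rw [mulVec_eq_sum_col, ← Finset.sum_subset (Finset.subset_univ S)]
    · exact Finset.sum_congr rfl fun i hi => by simp [hβ, hi]
    · intro i _ hi; simp [hβ, hi]
  have h1 : l1normOn S β = S.card := by
    rw [l1normOn, Finset.sum_congr rfl (g := fun _ => (1 : ℝ))]
    · simp
    · intro i hi; simp [hβ, hi, he]
  have h2 : l1normOn Sᶜ β = 0 := by
    refine Finset.sum_eq_zero fun i hi => ?_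
    simp [hβ, Finset.mem_compl.1 hi]
  have hc : (0 : ℝ) < S.card := by exact_mod_cast hS.card_pos
  obtain ⟨i, hi⟩ := hS
  have hi0 : β i ≠ 0 := by
    intro h
    simp only [hβ, hi, if_true] at h
    simpa [h] using he i
  refine (iInf₂_le β ⟨by rw [h1, h2]; positivity, i, hi, hi0⟩).trans ?_
  · rw [← ENNReal.ofReal_one]
    refine ENNReal.ofReal_le_ofReal ?_
    rw [h1, hXβ, div_le_one (by positivity)]
    have h3 : l2norm (∑ i ∈ S, e i • X.col i) ≤ √S.card * colNorm X := by
      refine abs_le_of_sq_le_sq' ?_ (by positivity) |>.2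
      refine hle.trans ?_
      rw [mul_pow, Real.sq_sqrt hc.le]
      refine (Finset.sum_le_card_nsmul S _ (colNorm X ^ 2) fun i _ => ?_).trans (by simp)
      exact pow_le_pow_left₀ (l2norm_nonneg _) (l2norm_col_le X i) 2
    calc _ ≤ √S.card * colNorm X * √S.card := by gcongr
      _ = _ := by rw [mul_right_comm, Real.mul_self_sqrt hc.le, mul_comm]

/-- The multiplied form stays true when `β` vanishes on `S`, so applications need no case
distinction. -/
lemma compat_mul_le {n p : ℕ} {X : Matrix (Fin n) (Fin p) ℝ} (hX : 0 < colNorm X)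
    {S : Finset (Fin p)} {β : Fin p → ℝ} (hβ : l1normOn Sᶜ β ≤ 7 * l1normOn S β) :
    (compat X S).toReal * (colNorm X * l1normOn S β) ≤ l2norm (X *ᵥ β) * √S.card := by
  rcases (l1normOn_nonneg S β).eq_or_lt with h | h
  · rw [← h]; simpa using mul_nonneg (l2norm_nonneg _) (Real.sqrt_nonneg _)
  have hi : ∃ i ∈ S, β i ≠ 0 := by
    by_contra! hc
    exact h.ne' (Finset.sum_eq_zero fun i hi => by simp [hc i hi])
  have := ENNReal.toReal_mono ENNReal.ofReal_ne_top
    (iInf₂_le (f := fun (β : Fin p → ℝ) (_ : β ∈ {β : Fin p → ℝ |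
      l1normOn Sᶜ β ≤ 7 * l1normOn S β ∧ ∃ i ∈ S, β i ≠ 0}) =>
      ENNReal.ofReal (l2norm (X *ᵥ β) * √(S.card : ℝ) / (colNorm X * l1normOn S β))) β ⟨hβ, hi⟩)
  have h0 := l2norm_nonneg (X *ᵥ β)
  rw [ENNReal.toReal_ofReal (by positivity), le_div_iff₀ (by positivity)] at this
  exact this

lemma unifCompat_mul_le {n p : ℕ} {X : Matrix (Fin n) (Fin p) ℝ} (hX : 0 < colNorm X)
    {s : ℝ≥0∞} {β : Fin p → ℝ} (hβ : ((supp β).card : ℝ≥0∞) ≤ s) :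
    (unifCompat X s).toReal * (colNorm X * l1normOn Finset.univ β)
      ≤ l2norm (X *ᵥ β) * √(supp β).card := by
  rcases (l1normOn_nonneg Finset.univ β).eq_or_lt with h | h
  · rw [← h]; simpa using mul_nonneg (l2norm_nonneg _) (Real.sqrt_nonneg _)
  have hi : (supp β).card ≠ 0 := by
    intro hc
    refine h.ne' (Finset.sum_eq_zero fun i _ => ?_)
    have : i ∉ supp β := by simp [Finset.card_eq_zero.1 hc]
    simpa [mem_supp] using this
  have := ENNReal.toReal_mono ENNReal.ofReal_ne_top
    (iInf₂_le (f := fun (β : Fin p → ℝ) (_ : β ∈ {β : Fin p → ℝ |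
      (supp β).card ≠ 0 ∧ ((supp β).card : ℝ≥0∞) ≤ s}) =>
      ENNReal.ofReal (l2norm (X *ᵥ β) * √((supp β).card : ℝ) /
      (colNorm X * l1normOn Finset.univ β))) β ⟨hi, hβ⟩)
  have h0 := l2norm_nonneg (X *ᵥ β)
  rw [ENNReal.toReal_ofReal (by positivity), le_div_iff₀ (by positivity)] at this
  exact this

lemma sparseSing_mul_le {n p : ℕ} {X : Matrix (Fin n) (Fin p) ℝ} (hX : 0 < colNorm X)
    {s : ℝ≥0∞} {β : Fin p → ℝ} (hβ : ((supp β).card : ℝ≥0∞) ≤ s) :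
    (sparseSing X s).toReal * (colNorm X * l2norm β) ≤ l2norm (X *ᵥ β) := by
  rcases (l2norm_nonneg β).eq_or_lt with h | h
  · rw [← h]; simpa using l2norm_nonneg _
  have hi : (supp β).card ≠ 0 := by
    intro hc
    refine h.ne' ?_
    have : β = 0 := by
      ext i
      have : i ∉ supp β := by simp [Finset.card_eq_zero.1 hc]
      simpa [mem_supp] using this
    simp [this, l2norm]
  have := ENNReal.toReal_mono ENNReal.ofReal_ne_top
    (iInf₂_le (f := fun (β : Fin p → ℝ) (_ : β ∈ {β : Fin p → ℝ |
      (supp β).card ≠ 0 ∧ ((supp β).card : ℝ≥0∞) ≤ s}) =>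
      ENNReal.ofReal (l2norm (X *ᵥ β) / (colNorm X * l2norm β))) β ⟨hi, hβ⟩)
  have h0 := l2norm_nonneg (X *ᵥ β)
  rw [ENNReal.toReal_ofReal (by positivity), le_div_iff₀ (by positivity)] at this
  exact this

/-- Cauchy–Schwarz on the support, `‖β‖₁ ≤ |S_β|^(1/2) ‖β‖₂`, compares the two quotients for each
`β`. -/
lemma sparseSing_le_unifCompat {n p : ℕ} {X : Matrix (Fin n) (Fin p) ℝ} (hX : 0 < colNorm X)
    (s : ℝ≥0∞) : sparseSing X s ≤ unifCompat X s := by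
  refine le_iInf₂ fun β hβ => (iInf₂_le β hβ).trans (ENNReal.ofReal_le_ofReal ?_)
  have hne : β ≠ 0 := by
    rintro rfl
    exact hβ.1 (by simp [supp])
  have h2 := l2norm_pos hne
  have h1 : 0 < l1normOn Finset.univ β := by
    obtain ⟨i, hi⟩ := Function.ne_iff.1 hne
    exact (abs_pos.2 hi).trans_le (abs_le_l1norm β i)
  rw [div_le_div_iff₀ (by positivity) (by positivity)]
  have := l1norm_le_sqrt_card_mul_l2norm β
  have h0 := l2norm_nonneg (X *ᵥ β)
  calc _ ≤ l2norm (X *ᵥ β) * (colNorm X * (√((supp β).card : ℝ) * l2norm β)) := by gcongr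
    _ = _ := by ring

lemma card_supp_single {p : ℕ} (i : Fin p) : (supp (Pi.single i (1 : ℝ))).card = 1 := by
  rw [Finset.card_eq_one]
  refine ⟨i, ?_⟩
  ext j
  simp [mem_supp, Pi.single_apply]

lemma unifCompat_le_one {n p : ℕ} {X : Matrix (Fin n) (Fin p) ℝ} (hX : 0 < colNorm X) (i : Fin p)
    {s : ℝ≥0∞} (hs : 1 ≤ s) : unifCompat X s ≤ 1 := by
  have h1 := card_supp_single i
  refine (iInf₂_le (Pi.single i 1) ⟨by simp [h1], by simpa [h1] using hs⟩).trans ?_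
  rw [← ENNReal.ofReal_one]
  refine ENNReal.ofReal_le_ofReal ?_
  have h2 : l1normOn Finset.univ (Pi.single i (1 : ℝ)) = 1 := by
    simp [l1normOn, Pi.single_apply, apply_ite abs]
  rw [h1, h2]
  simpa using div_le_one_of_le₀ (l2norm_col_le X i) hX.le

/-- Tested on a coordinate vector, the sparse singular value forces every column to have length
comparable to the longest one. -/
lemma sparseSing_mul_colNorm_le {n p : ℕ} {X : Matrix (Fin n) (Fin p) ℝ} (hX : 0 < colNorm X)
    (i : Fin p) {s : ℝ≥0∞} (hs : 1 ≤ s) :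
    (sparseSing X s).toReal * colNorm X ≤ l2norm (X.col i) := by
  have h := sparseSing_mul_le hX (s := s) (β := Pi.single i 1)
    (by simpa [card_supp_single] using hs)
  have h2 : l2norm (Pi.single i (1 : ℝ)) = 1 := by
    have := l2norm_sq (Pi.single i (1 : ℝ))
    simp only [dotProduct_single, Pi.single_eq_same, mul_one] at this
    nlinarith [l2norm_nonneg (Pi.single i (1 : ℝ))]
  simpa [h2] using h

lemma abs_col_dotProduct_le {n p : ℕ} (X : Matrix (Fin n) (Fin p) ℝ) {i j : Fin p} (hij : i ≠ j) :
    |X.col i ⬝ᵥ X.col j| ≤ mutualCoherence X * colNorm X ^ 2 := by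
  have h := le_ciSup (f := fun q : {q : Fin p × Fin p // q.1 ≠ q.2} =>
    |X.col q.1.1 ⬝ᵥ X.col q.1.2| / (l2norm (X.col q.1.1) * l2norm (X.col q.1.2)))
    (Set.finite_range _).bddAbove ⟨(i, j), hij⟩
  change |X.col i ⬝ᵥ X.col j| / (l2norm (X.col i) * l2norm (X.col j)) ≤ mutualCoherence X at h
  have hi := l2norm_nonneg (X.col i)
  have hj := l2norm_nonneg (X.col j)
  have hm : 0 ≤ mutualCoherence X := le_trans (by positivity) h
  have hX : 0 ≤ colNorm X := hi.trans (l2norm_col_le X i)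
  -- For a zero column the quotient is `0` by the convention on division; the inner product then
  -- vanishes by Cauchy–Schwarz.
  rcases (mul_nonneg hi hj).eq_or_lt with h0 | h0
  · have := abs_dotProduct_le (X.col i) (X.col j)
    rw [← h0] at this
    exact this.trans (by positivity)
  · rw [div_le_iff₀ h0] at h
    refine h.trans ?_
    rw [sq]
    gcongr <;> exact l2norm_col_le X _

end SparseRegression

end

noncomputable section

namespace SparseRegression

/-! ### Finite product measures -/

lemma lintegral_pi_prod_eq_prod {ι : Type*} [Fintype ι] {α : ι → Type*}
    [∀ i, MeasurableSpace (α i)] (μ : ∀ i, Measure (α i)) [∀ i, IsProbabilityMeasure (μ i)]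
    (f : ∀ i, α i → ℝ≥0∞) (hf : ∀ i, Measurable (f i)) :
    ∫⁻ x, ∏ i, f i (x i) ∂(Measure.pi μ) = ∏ i, ∫⁻ x, f i x ∂(μ i) := by
  have h := lintegral_prod_eq_prod_lintegral_of_indepFun (μ := Measure.pi μ) Finset.univ
    (fun i x => f i (x i)) (iIndepFun_pi fun i => (hf i).aemeasurable)
    (fun i => (hf i).comp (measurable_pi_apply i))
  rw [h]
  refine Finset.prod_congr rfl fun i _ => ?_
  exact (measurePreserving_eval μ i).lintegral_comp (hf i)

/-- `OuterMeasure.pi` is the largest outer measure bounded by the product on boxes, so the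
comparison need only be checked there. No finiteness of `μ` enters. -/
lemma smul_pi_le_pi {ι : Type*} [Fintype ι] {α : ι → Type*} [∀ i, MeasurableSpace (α i)]
    (μ ν : ∀ i, Measure (α i)) [∀ i, SigmaFinite (ν i)] (c : ι → ℝ≥0∞)
    (h : ∀ i, c i • ν i ≤ μ i) : (∏ i, c i) • Measure.pi ν ≤ Measure.pi μ := by
  refine Measure.le_iff.2 fun s hs => ?_
  have h1 : ((∏ i, c i) • Measure.pi ν).toOuterMeasure
      ≤ OuterMeasure.pi fun i => (μ i).toOuterMeasure := by
    refine OuterMeasure.le_pi.2 fun t _ => ?_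
    change ((∏ i, c i) • Measure.pi ν) (Set.univ.pi t) ≤ ∏ i, μ i (t i)
    rw [Measure.smul_apply, Measure.pi_pi, smul_eq_mul, ← Finset.prod_mul_distrib]
    exact Finset.prod_le_prod' fun i _ => h i (t i)
  refine (h1 s).trans_eq ?_
  rw [Measure.pi, toMeasure_apply _ _ hs]

/-! ### The Laplace distribution -/

lemma lintegral_exp_neg_mul_abs {c : ℝ} (hc : 0 < c) :
    ∫⁻ x : ℝ, ENNReal.ofReal (Real.exp (-c * |x|)) = ENNReal.ofReal (2 / c) := by
  have h : ∫ x : ℝ, Real.exp (-c * |x|) = 2 / c := by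
    rw [integral_comp_abs (f := fun x => Real.exp (-c * x)),
      integral_exp_mul_Ioi (by linarith)]
    simp
    ring
  rw [← h, ofReal_integral_eq_lintegral_ofReal]
  -- A non-integrable function would have Bochner integral `0`, contradicting the positive value
  -- just found.
  · by_contra hi
    rw [integral_undef hi] at h
    exact (by positivity : 2 / c ≠ 0) h.symm
  · exact ae_of_all _ fun x => (Real.exp_pos _).le

lemma lintegral_laplace (lam : ℝ) {f : ℝ → ℝ≥0∞} (hf : Measurable f) :
    ∫⁻ x, f x ∂(laplace lam)
      = ∫⁻ x, ENNReal.ofReal (lam / 2 * Real.exp (-lam * |x|)) * f x := by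
  rw [laplace, lintegral_withDensity_eq_lintegral_mul _ (by fun_prop) hf]
  rfl

lemma isProbabilityMeasure_laplace {lam : ℝ} (h : 0 < lam) :
    IsProbabilityMeasure (laplace lam) := by
  constructor
  rw [← lintegral_one, lintegral_laplace lam measurable_const]
  simp_rw [mul_one, ENNReal.ofReal_mul (show 0 ≤ lam / 2 by positivity)]
  rw [lintegral_const_mul _ (by fun_prop), lintegral_exp_neg_mul_abs h,
    ← ENNReal.ofReal_mul (by positivity)]
  rw [show lam / 2 * (2 / lam) = 1 by field_simp, ENNReal.ofReal_one]

lemma laplace_singleton (lam x : ℝ) : laplace lam {x} = 0 :=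
  withDensity_absolutelyContinuous _ _ (by simp)

lemma measurePreserving_neg_laplace (lam : ℝ) :
    MeasurePreserving (fun x : ℝ => -x) (laplace lam) (laplace lam) := by
  refine ⟨measurable_neg, ?_⟩
  ext s hs
  rw [Measure.map_apply measurable_neg hs, laplace, withDensity_apply _ hs,
    withDensity_apply _ (measurable_neg hs), ← lintegral_indicator hs,
    ← lintegral_indicator (measurable_neg hs),
    ← lintegral_neg_eq_self (fun x => s.indicator _ x)]
  refine lintegral_congr fun x => ?_
  have hx : x ∈ (fun x : ℝ => -x) ⁻¹' s ↔ -x ∈ s := Iff.rfl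
  by_cases h : -x ∈ s
  · rw [Set.indicator_of_mem (hx.2 h), Set.indicator_of_mem h, abs_neg]
  · rw [Set.indicator_of_notMem (mt hx.1 h), Set.indicator_of_notMem h]

/-- After a change of variables this is `|x + a| ≤ |x| + |a|` in the exponent. -/
lemma smul_map_add_laplace_le {lam : ℝ} (h : 0 < lam) (a : ℝ) :
    ENNReal.ofReal (Real.exp (-lam * |a|)) • (laplace lam).map (fun x => x + a)
      ≤ laplace lam := by
  refine Measure.le_iff.2 fun s hs => ?_
  have hm : Measurable fun x : ℝ => x + a := by fun_prop
  rw [Measure.smul_apply, Measure.map_apply hm hs, laplace, withDensity_apply _ hs,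
    withDensity_apply _ (hm hs), ← lintegral_indicator hs, ← lintegral_indicator (hm hs),
    ← lintegral_add_right_eq_self (fun x => s.indicator _ x) a, smul_eq_mul,
    ← lintegral_const_mul _ (Measurable.indicator (by fun_prop) (hm hs))]
  refine lintegral_mono fun x => ?_
  by_cases hx : x + a ∈ s
  · simp only [Set.indicator, Set.mem_preimage, hx, if_true]
    rw [← ENNReal.ofReal_mul (Real.exp_pos _).le]
    refine ENNReal.ofReal_le_ofReal ?_
    rw [mul_left_comm, ← Real.exp_add]
    refine mul_le_mul_of_nonneg_left (Real.exp_le_exp.2 ?_) (by positivity)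
    nlinarith [abs_add_le x a]
  · simp [Set.indicator, hx]

lemma ofReal_le_laplace_Icc {lam t : ℝ} (h : 0 < lam) :
    ENNReal.ofReal (lam * t * Real.exp (-(lam * t))) ≤ laplace lam (Set.Icc (-t) t) := by
  rw [laplace, withDensity_apply _ measurableSet_Icc]
  calc ENNReal.ofReal (lam * t * Real.exp (-(lam * t)))
      = ∫⁻ _ in Set.Icc (-t) t, ENNReal.ofReal (lam / 2 * Real.exp (-(lam * t))) := by
        rw [lintegral_const, Measure.restrict_apply_univ, Real.volume_Icc,
          ← ENNReal.ofReal_mul (by positivity)]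
        congr 1
        ring
    _ ≤ _ := by
        refine setLIntegral_mono (by fun_prop) fun x hx => ENNReal.ofReal_le_ofReal ?_
        refine mul_le_mul_of_nonneg_left (Real.exp_le_exp.2 ?_) (by positivity)
        nlinarith [abs_le.2 hx]

/-! ### The prior given a model -/

instance slab_factor_prob (p : ℕ) (lam : ℝ) [IsProbabilityMeasure (laplace lam)]
    (S : Finset (Fin p)) (i : Fin p) :
    IsProbabilityMeasure (if i ∈ S then laplace lam else Measure.dirac 0) := by
  split_ifs <;> infer_instance

instance slab_isProbabilityMeasure (p : ℕ) (lam : ℝ) [IsProbabilityMeasure (laplace lam)]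
    (S : Finset (Fin p)) : IsProbabilityMeasure (slab p lam S) := by
  unfold slab; infer_instance

section
variable {p : ℕ} {lam : ℝ} [IsProbabilityMeasure (laplace lam)] (S : Finset (Fin p))

lemma measurePreserving_eval_slab (i : Fin p) :
    MeasurePreserving (fun β : Fin p → ℝ => β i) (slab p lam S)
      (if i ∈ S then laplace lam else Measure.dirac 0) :=
  measurePreserving_eval _ i

lemma ae_slab_eq_zero {i : Fin p} (hi : i ∉ S) : ∀ᵐ β ∂(slab p lam S), β i = 0 := by
  have h := measurePreserving_eval_slab (lam := lam) S i
  rw [if_neg hi] at h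
  exact h.quasiMeasurePreserving.ae (p := fun x => x = 0) (by simp [ae_dirac_eq])

lemma ae_slab_ne_zero {i : Fin p} (hi : i ∈ S) : ∀ᵐ β ∂(slab p lam S), β i ≠ 0 := by
  have h := measurePreserving_eval_slab (lam := lam) S i
  rw [if_pos hi] at h
  refine h.quasiMeasurePreserving.ae (p := fun x => x ≠ 0) ?_
  rw [ae_iff]
  simpa using laplace_singleton lam 0

lemma ae_slab_supp_subset : ∀ᵐ β ∂(slab p lam S), supp β ⊆ S := by
  have h : ∀ᵐ β ∂(slab p lam S), ∀ i, i ∉ S → β i = 0 := by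
    rw [ae_all_iff]
    intro i
    by_cases hi : i ∈ S
    · simp [hi]
    · filter_upwards [ae_slab_eq_zero (lam := lam) S hi] with β hβ _ using hβ
  filter_upwards [h] with β hβ i hi
  by_contra hc
  exact mem_supp.1 hi (hβ i hc)

lemma measurePreserving_neg_slab :
    MeasurePreserving (fun β : Fin p → ℝ => -β) (slab p lam S) (slab p lam S) := by
  refine measurePreserving_pi (f := fun _ x => -x) _ _ fun i => ?_
  split_ifs
  · exact measurePreserving_neg_laplace lam
  · exact ⟨measurable_neg, by simp [Measure.map_dirac' measurable_neg]⟩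

/-- The shift moves only coordinates in the support of `a`, so the Dirac factors stay in place and
the Laplace losses multiply. -/
lemma smul_map_add_slab_le (h : 0 < lam) (a : Fin p → ℝ) :
    ENNReal.ofReal (Real.exp (-lam * l1normOn Finset.univ a)) •
      (slab p lam (supp a)).map (fun β => β + a) ≤ slab p lam (supp a) := by
  have h1 : (slab p lam (supp a)).map (fun β => β + a) = Measure.pi fun i =>
      (if i ∈ supp a then laplace lam else Measure.dirac 0).map (fun x => x + a i) := by
    have : ∀ i, IsProbabilityMeasure
        ((if i ∈ supp a then laplace lam else Measure.dirac 0).map (fun x => x + a i)) :=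
      fun i => Measure.isProbabilityMeasure_map (by fun_prop)
    exact Measure.pi_map_pi (f := fun i x => x + a i) (fun i => by fun_prop)
  have : ∀ i, IsProbabilityMeasure
      ((if i ∈ supp a then laplace lam else Measure.dirac 0).map (fun x => x + a i)) :=
    fun i => Measure.isProbabilityMeasure_map (by fun_prop)
  rw [h1, l1normOn, Finset.mul_sum, Real.exp_sum,
    ENNReal.ofReal_prod_of_nonneg (fun i _ => (Real.exp_pos _).le)]
  refine smul_pi_le_pi _ _ _ fun i => ?_
  by_cases hi : i ∈ supp a
  · simp only [hi, if_true]
    exact smul_map_add_laplace_le h (a i)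
  · have : a i = 0 := by simpa [mem_supp] using hi
    simp [hi, this]

/-- The term `λ|x|` cancels the Laplace exponent, and each active coordinate integrates `(λ/2)
exp(-(λ/4)|x - a|)`, whose total is `4` whatever `a` is. Inactive coordinates contribute at most
`1`. -/
lemma lintegral_exp_slab_le (h : 0 < lam) (a : Fin p → ℝ) :
    ∫⁻ β, ENNReal.ofReal (Real.exp (lam * l1normOn Finset.univ β
      - lam / 4 * l1normOn Finset.univ (β - a))) ∂(slab p lam S) ≤ 4 ^ S.card := by
  have h1 : ∀ β : Fin p → ℝ, ENNReal.ofReal (Real.exp (lam * l1normOn Finset.univ β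
      - lam / 4 * l1normOn Finset.univ (β - a)))
      = ∏ i, ENNReal.ofReal (Real.exp (lam * |β i| - lam / 4 * |β i - a i|)) := by
    intro β
    rw [← ENNReal.ofReal_prod_of_nonneg (fun i _ => (Real.exp_pos _).le), ← Real.exp_sum,
      Finset.sum_sub_distrib, ← Finset.mul_sum, ← Finset.mul_sum]
    rfl
  simp_rw [h1]
  rw [slab, lintegral_pi_prod_eq_prod _
    (fun i x => ENNReal.ofReal (Real.exp (lam * |x| - lam / 4 * |x - a i|)))
    (fun i => by fun_prop)]
  calc _ ≤ ∏ i, (if i ∈ S then 4 else 1 : ℝ≥0∞) := ?_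
    _ = 4 ^ S.card := by simp
  refine Finset.prod_le_prod' fun i _ => ?_
  split_ifs with hi
  · rw [lintegral_laplace lam (by fun_prop)]
    have h2 : ∀ x : ℝ, ENNReal.ofReal (lam / 2 * Real.exp (-lam * |x|)) *
        ENNReal.ofReal (Real.exp (lam * |x| - lam / 4 * |x - a i|))
        = ENNReal.ofReal (lam / 2) * ENNReal.ofReal (Real.exp (-(lam / 4) * |x + (- a i)|)) := by
      intro x
      rw [← ENNReal.ofReal_mul (by positivity), ← ENNReal.ofReal_mul (by positivity), mul_assoc,
        ← Real.exp_add]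
      congr 3
      rw [← sub_eq_add_neg]
      ring
    simp_rw [h2]
    rw [lintegral_const_mul _ (by fun_prop),
      lintegral_add_right_eq_self (fun x => ENNReal.ofReal (Real.exp (-(lam / 4) * |x|))),
      lintegral_exp_neg_mul_abs (by positivity), ← ENNReal.ofReal_mul (by positivity)]
    rw [show lam / 2 * (2 / (lam / 4)) = 4 by field_simp]
    simp
  · rw [lintegral_dirac]
    simp only [abs_zero, mul_zero, zero_sub]
    rw [← ENNReal.ofReal_one]
    refine ENNReal.ofReal_le_ofReal (Real.exp_le_one_iff.2 ?_)
    have := abs_nonneg (-a i)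
    nlinarith

/-! ### Enlarging a model by one coordinate. -/

/-- Overwriting coordinate `i` discards its old value, so the preimage of a box is a box with `univ`
in place `i`, times the constraint on the new value. -/
lemma slab_insert {i : Fin p} (hi : i ∉ S) :
    slab p lam (insert i S) = ((slab p lam S).prod (laplace lam)).map
      (fun q => Function.update q.1 i q.2) := by
  refine Measure.pi_eq fun s hs => ?_
  have hm : Measurable fun q : (Fin p → ℝ) × ℝ => Function.update q.1 i q.2 := by
    refine measurable_pi_iff.2 fun j => ?_
    by_cases hj : j = i
    · subst hj; simpa using measurable_snd
    · simp only [Function.update_of_ne hj]; fun_prop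
  rw [Measure.map_apply hm (MeasurableSet.univ_pi hs)]
  have h1 : (fun q : (Fin p → ℝ) × ℝ => Function.update q.1 i q.2) ⁻¹' Set.univ.pi s
      = (Set.univ.pi (Function.update s i Set.univ)) ×ˢ s i := by
    ext ⟨β, b⟩
    simp only [Set.mem_preimage, Set.mem_univ_pi, Set.mem_prod]
    constructor
    · intro h
      refine ⟨fun j => ?_, by simpa using h i⟩
      by_cases hj : j = i
      · subst hj; simp
      · simpa [hj] using h j
    · rintro ⟨h, hb⟩ j
      by_cases hj : j = i
      · subst hj; simpa using hb
      · simpa [hj] using h j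
  rw [h1, Measure.prod_prod, slab, Measure.pi_pi, ← Finset.mul_prod_erase _ _ (Finset.mem_univ i),
    ← Finset.mul_prod_erase _ (fun j => (if j ∈ insert i S then laplace lam
      else Measure.dirac 0) (s j)) (Finset.mem_univ i)]
  simp only [Function.update_self, measure_univ, one_mul, Finset.mem_insert_self, if_true]
  rw [mul_comm]
  congr 1
  refine Finset.prod_congr rfl fun j hj => ?_
  have : j ≠ i := Finset.ne_of_mem_erase hj
  simp [this]

lemma lintegral_slab_insert {i : Fin p} (hi : i ∉ S) {f : (Fin p → ℝ) → ℝ≥0∞}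
    (hf : Measurable f) :
    ∫⁻ β, f β ∂(slab p lam (insert i S))
      = ∫⁻ β, ∫⁻ b, f (Function.update β i b) ∂(laplace lam) ∂(slab p lam S) := by
  have hm : Measurable fun q : (Fin p → ℝ) × ℝ => Function.update q.1 i q.2 := by
    refine measurable_pi_iff.2 fun j => ?_
    by_cases hj : j = i
    · subst hj; simpa using measurable_snd
    · simp only [Function.update_of_ne hj]; fun_prop
  rw [slab_insert S hi, lintegral_map hf hm]
  exact lintegral_prod _ (hf.comp hm).aemeasurable

end

end SparseRegression

end

noncomputable section

namespace SparseRegression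

/-! ### The Gaussian data -/

instance dataLaw_isProbabilityMeasure {n p : ℕ} (X : Matrix (Fin n) (Fin p) ℝ) (β₀ : Fin p → ℝ) :
    IsProbabilityMeasure (dataLaw X β₀) := by
  unfold dataLaw; infer_instance

lemma lintegral_exp_gaussianReal (μ v : ℝ) :
    ∫⁻ x, ENNReal.ofReal (Real.exp ((x - μ) * v)) ∂(gaussianReal μ 1)
      = ENNReal.ofReal (Real.exp (v ^ 2 / 2)) := by
  have h1 := congrFun (mgf_id_gaussianReal (μ := μ) (v := 1)) v
  simp only [mgf, id, NNReal.coe_one, one_mul] at h1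
  have h2 : ∀ x : ℝ, Real.exp ((x - μ) * v) = Real.exp (-(μ * v)) * Real.exp (v * x) := by
    intro x
    rw [← Real.exp_add]
    ring_nf
  rw [← ofReal_integral_eq_lintegral_ofReal]
  · simp_rw [h2]
    rw [integral_const_mul, h1, ← Real.exp_add]
    ring_nf
  · simp_rw [h2]
    exact (integrable_exp_mul_gaussianReal v).const_mul _
  · exact ae_of_all _ fun x => (Real.exp_pos _).le

lemma lintegral_exp_dataLaw {n p : ℕ} (X : Matrix (Fin n) (Fin p) ℝ) (β₀ : Fin p → ℝ)
    (v : Fin n → ℝ) :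
    ∫⁻ y, ENNReal.ofReal (Real.exp ((y - X *ᵥ β₀) ⬝ᵥ v)) ∂(dataLaw X β₀)
      = ENNReal.ofReal (Real.exp (l2norm v ^ 2 / 2)) := by
  have h1 : ∀ y : Fin n → ℝ, ENNReal.ofReal (Real.exp ((y - X *ᵥ β₀) ⬝ᵥ v))
      = ∏ j, ENNReal.ofReal (Real.exp ((y j - (X *ᵥ β₀) j) * v j)) := by
    intro y
    rw [← ENNReal.ofReal_prod_of_nonneg (fun i _ => (Real.exp_pos _).le), ← Real.exp_sum]
    rfl
  simp_rw [h1]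
  rw [dataLaw, lintegral_pi_prod_eq_prod _
    (fun j x => ENNReal.ofReal (Real.exp ((x - (X *ᵥ β₀) j) * v j))) (fun j => by fun_prop)]
  simp_rw [lintegral_exp_gaussianReal]
  rw [← ENNReal.ofReal_prod_of_nonneg (fun i _ => (Real.exp_pos _).le), ← Real.exp_sum, l2norm_sq,
    dotProduct, Finset.sum_div]
  simp_rw [sq]

lemma measurable_dotProduct_sub {n p : ℕ} (X : Matrix (Fin n) (Fin p) ℝ) (β₀ : Fin p → ℝ)
    (v : Fin n → ℝ) : Measurable fun y : Fin n → ℝ => (y - X *ᵥ β₀) ⬝ᵥ v := by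
  unfold dotProduct
  fun_prop

lemma dataLaw_dotProduct_gt_le {n p : ℕ} (X : Matrix (Fin n) (Fin p) ℝ) (β₀ : Fin p → ℝ)
    {v : Fin n → ℝ} {c t : ℝ} (hc : 0 < c) (ht : 0 < t) (hv : l2norm v ≤ c) :
    dataLaw X β₀ {y | t < (y - X *ᵥ β₀) ⬝ᵥ v}
      ≤ ENNReal.ofReal (Real.exp (-(t ^ 2 / (2 * c ^ 2)))) := by
  -- The Chernoff exponent that minimises `-at + a²c²/2`.
  set a := t / c ^ 2 with ha
  have ha0 : 0 < a := by positivity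
  have h1 := lintegral_exp_dataLaw X β₀ (a • v)
  simp only [dotProduct_smul, smul_eq_mul] at h1
  calc dataLaw X β₀ {y | t < (y - X *ᵥ β₀) ⬝ᵥ v}
      = ∫⁻ _ in {y | t < (y - X *ᵥ β₀) ⬝ᵥ v}, 1 ∂(dataLaw X β₀) := by simp
    _ ≤ ∫⁻ y in {y | t < (y - X *ᵥ β₀) ⬝ᵥ v}, ENNReal.ofReal (Real.exp (-(a * t))) *
          ENNReal.ofReal (Real.exp (a * ((y - X *ᵥ β₀) ⬝ᵥ v))) ∂(dataLaw X β₀) := by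
        have hm := measurable_dotProduct_sub X β₀ v
        refine setLIntegral_mono (by fun_prop) fun y hy => ?_
        rw [← ENNReal.ofReal_mul (Real.exp_pos _).le, ← Real.exp_add, ← ENNReal.ofReal_one]
        refine ENNReal.ofReal_le_ofReal (Real.one_le_exp_iff.2 ?_)
        have := mul_le_mul_of_nonneg_left (le_of_lt hy) ha0.le
        linarith
    _ ≤ ∫⁻ y, ENNReal.ofReal (Real.exp (-(a * t))) *
          ENNReal.ofReal (Real.exp (a * ((y - X *ᵥ β₀) ⬝ᵥ v))) ∂(dataLaw X β₀) :=
        setLIntegral_le_lintegral _ _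
    _ = ENNReal.ofReal (Real.exp (-(a * t) + l2norm (a • v) ^ 2 / 2)) := by
        have hm := measurable_dotProduct_sub X β₀ v
        rw [lintegral_const_mul _ (by fun_prop), h1, ← ENNReal.ofReal_mul (Real.exp_pos _).le,
          ← Real.exp_add]
    _ ≤ _ := by
        refine ENNReal.ofReal_le_ofReal (Real.exp_le_exp.2 ?_)
        rw [l2norm_smul, mul_pow, sq_abs]
        have h2 : l2norm v ^ 2 ≤ c ^ 2 := pow_le_pow_left₀ (l2norm_nonneg v) hv 2
        have h3 : a ^ 2 * l2norm v ^ 2 ≤ a ^ 2 * c ^ 2 := by gcongr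
        have h4 : a ^ 2 * c ^ 2 = a * t := by rw [ha]; field_simp
        have h5 : t ^ 2 / (2 * c ^ 2) = a * t / 2 := by rw [ha]; field_simp
        rw [h5]
        linarith

/-- The event that the noise is bounded by `lamBar X` in every column direction. -/
def noiseEvent {n p : ℕ} (X : Matrix (Fin n) (Fin p) ℝ) (β₀ : Fin p → ℝ) : Set (Fin n → ℝ) :=
  {y | ∀ i, |X.col i ⬝ᵥ (y - X *ᵥ β₀)| ≤ lamBar X}

lemma measurableSet_noiseEvent {n p : ℕ} (X : Matrix (Fin n) (Fin p) ℝ) (β₀ : Fin p → ℝ) :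
    MeasurableSet (noiseEvent X β₀) := by
  simp only [noiseEvent, Set.ofPred_forall]
  refine MeasurableSet.iInter fun i => ?_
  have h := measurable_dotProduct_sub X β₀ (X.col i)
  simp_rw [dotProduct_comm (X.col i)]
  exact measurableSet_le (by fun_prop) measurable_const

/-- Union bound over the `2p` directions `±X_i`, each with Gaussian tail `p⁻²` because `λ̄²/(2‖X‖²)
= 2 log p`. -/
lemma dataLaw_compl_noiseEvent_le {n p : ℕ} {X : Matrix (Fin n) (Fin p) ℝ} (hX : 0 < colNorm X)
    (hp : 2 ≤ p) (β₀ : Fin p → ℝ) :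
    dataLaw X β₀ (noiseEvent X β₀)ᶜ ≤ ENNReal.ofReal (2 / p) := by
  have hp0 : (0 : ℝ) < p := by positivity
  have hlog : 0 < Real.log p := Real.log_pos (by exact_mod_cast (by omega : 1 < p))
  have hl : 0 < lamBar X := by unfold lamBar; positivity
  have hexp : Real.exp (-(lamBar X ^ 2 / (2 * colNorm X ^ 2))) = 1 / (p : ℝ) ^ 2 := by
    have : lamBar X ^ 2 / (2 * colNorm X ^ 2) = 2 * Real.log p := by
      rw [lamBar, mul_pow, mul_pow, Real.sq_sqrt hlog.le]
      field_simp
    rw [this, Real.exp_neg, two_mul, Real.exp_add, Real.exp_log hp0, sq, one_div]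
  have hsub : (noiseEvent X β₀)ᶜ ⊆ ⋃ i : Fin p,
      ({y | lamBar X < (y - X *ᵥ β₀) ⬝ᵥ X.col i} ∪
        {y | lamBar X < (y - X *ᵥ β₀) ⬝ᵥ (-X.col i)}) := by
    intro y hy
    simp only [noiseEvent, Set.mem_compl_iff, Set.mem_ofPred_eq, not_forall, not_le] at hy
    obtain ⟨i, hi⟩ := hy
    refine Set.mem_iUnion.2 ⟨i, ?_⟩
    rw [dotProduct_comm] at hi
    rcases lt_abs.1 hi with h | h
    · exact Or.inl h
    · exact Or.inr (by rwa [Set.mem_ofPred_eq, dotProduct_neg])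
  refine (measure_mono hsub).trans ((measure_iUnion_fintype_le _ _).trans ?_)
  calc _ ≤ ∑ _i : Fin p, (ENNReal.ofReal (1 / (p : ℝ) ^ 2) + ENNReal.ofReal (1 / (p : ℝ) ^ 2)) := by
        refine Finset.sum_le_sum fun i _ => (measure_union_le _ _).trans (add_le_add ?_ ?_)
        · rw [← hexp]
          exact dataLaw_dotProduct_gt_le X β₀ hX hl (l2norm_col_le X i)
        · rw [← hexp]
          exact dataLaw_dotProduct_gt_le X β₀ hX hl (by rw [l2norm_neg]; exact l2norm_col_le X i)
    _ = _ := by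
        rw [← ENNReal.ofReal_add (by positivity) (by positivity), Finset.sum_const,
          Finset.card_univ, Fintype.card_fin, nsmul_eq_mul, ← ENNReal.ofReal_natCast,
          ← ENNReal.ofReal_mul (by positivity)]
        congr 1
        field_simp
        norm_num

/-! ### The likelihood and the posterior -/

lemma likelihood_eq_mul {n p : ℕ} (X : Matrix (Fin n) (Fin p) ℝ) (y : Fin n → ℝ)
    (β₀ β : Fin p → ℝ) :
    likelihood X y β = likelihood X y β₀ * ENNReal.ofReal (Real.exp
      (-(l2norm (X *ᵥ (β - β₀)) ^ 2 / 2) + (y - X *ᵥ β₀) ⬝ᵥ X *ᵥ (β - β₀))) := by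
  rw [likelihood, likelihood, ← ENNReal.ofReal_mul (Real.exp_pos _).le, ← Real.exp_add]
  congr 2
  have h : y - X *ᵥ β = (y - X *ᵥ β₀) - X *ᵥ (β - β₀) := by
    rw [Matrix.mulVec_sub]; abel
  simp only [l2norm_sq]
  rw [h]
  generalize y - X *ᵥ β₀ = u
  generalize X *ᵥ (β - β₀) = v
  simp only [sub_dotProduct, dotProduct_sub, dotProduct_comm v u]
  ring

lemma continuous_l2norm {m : ℕ} : Continuous (l2norm (m := m)) :=
  (PiLp.continuous_toLp 2 _).norm

lemma continuous_residual {n p : ℕ} (X : Matrix (Fin n) (Fin p) ℝ) :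
    Continuous fun q : (Fin n → ℝ) × (Fin p → ℝ) => q.1 - X *ᵥ q.2 :=
  continuous_fst.sub (continuous_const.matrix_mulVec continuous_snd)

lemma measurable_likelihood_uncurry {n p : ℕ} (X : Matrix (Fin n) (Fin p) ℝ) :
    Measurable fun q : (Fin n → ℝ) × (Fin p → ℝ) => likelihood X q.1 q.2 := by
  have h : Measurable fun q : (Fin n → ℝ) × (Fin p → ℝ) => l2norm (q.1 - X *ᵥ q.2) :=
    (continuous_l2norm.comp (continuous_residual X)).measurable
  exact ENNReal.measurable_ofReal.comp
    (Real.measurable_exp.comp ((h.pow_const 2).neg.div_const 2))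

lemma measurable_likelihood {n p : ℕ} (X : Matrix (Fin n) (Fin p) ℝ) (y : Fin n → ℝ) :
    Measurable (likelihood X y) :=
  (measurable_likelihood_uncurry X).of_uncurry_left (f := fun y β => likelihood X y β)

lemma likelihood_pos {n p : ℕ} (X : Matrix (Fin n) (Fin p) ℝ) (y : Fin n → ℝ) (β : Fin p → ℝ) :
    0 < likelihood X y β := ENNReal.ofReal_pos.2 (Real.exp_pos _)

lemma likelihood_ne_top {n p : ℕ} (X : Matrix (Fin n) (Fin p) ℝ) (y : Fin n → ℝ)
    (β : Fin p → ℝ) : likelihood X y β ≠ ∞ := ENNReal.ofReal_ne_top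

lemma likelihood_le_one {n p : ℕ} (X : Matrix (Fin n) (Fin p) ℝ) (y : Fin n → ℝ)
    (β : Fin p → ℝ) : likelihood X y β ≤ 1 := by
  rw [likelihood, ← ENNReal.ofReal_one]
  refine ENNReal.ofReal_le_ofReal (Real.exp_le_one_iff.2 ?_)
  have := sq_nonneg (l2norm (y - X *ᵥ β))
  linarith

/-! ### The prior as a mixture over models, and elementary properties of the posterior. -/

/-- The prior weight of the model `S`. -/
def modelWeight (p : ℕ) (π : ℕ → ℝ) (S : Finset (Fin p)) : ℝ≥0∞ :=
  ENNReal.ofReal (π S.card * (1 / (p.choose S.card : ℝ)))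

lemma setLIntegral_prior {p : ℕ} (lam : ℝ) (π : ℕ → ℝ) {B : Set (Fin p → ℝ)}
    (hB : MeasurableSet B) (f : (Fin p → ℝ) → ℝ≥0∞) :
    ∫⁻ β in B, f β ∂(prior p lam π)
      = ∑ S, modelWeight p π S * ∫⁻ β in B, f β ∂(slab p lam S) := by
  rw [← lintegral_indicator hB, prior, lintegral_finsetSum_measure]
  refine Finset.sum_congr rfl fun S _ => ?_
  rw [lintegral_smul_measure, lintegral_indicator hB]
  rfl

lemma lintegral_prior {p : ℕ} (lam : ℝ) (π : ℕ → ℝ) (f : (Fin p → ℝ) → ℝ≥0∞) :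
    ∫⁻ β, f β ∂(prior p lam π) = ∑ S, modelWeight p π S * ∫⁻ β, f β ∂(slab p lam S) := by
  simpa using setLIntegral_prior lam π MeasurableSet.univ f

/-- There are `p.choose s` models of dimension `s`, which cancels the uniform weight. -/
lemma sum_modelWeight_mul {p : ℕ} (π : ℕ → ℝ) (f : ℕ → ℝ≥0∞) :
    ∑ S : Finset (Fin p), modelWeight p π S * f S.card
      = ∑ s ∈ Finset.range (p + 1), ENNReal.ofReal (π s) * f s := by
  have h := Finset.sum_powerset_apply_card
    (fun s => ENNReal.ofReal (π s * (1 / (p.choose s : ℝ))) * f s)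
    (x := (Finset.univ : Finset (Fin p)))
  rw [Finset.powerset_univ, Finset.card_univ, Fintype.card_fin] at h
  refine h.trans ?_
  refine Finset.sum_congr rfl fun s hs => ?_
  have hc : (0 : ℝ) < p.choose s := by
    exact_mod_cast Nat.choose_pos (by simpa [Nat.lt_succ_iff] using hs)
  rw [nsmul_eq_mul, ← mul_assoc, ← ENNReal.ofReal_natCast, ← ENNReal.ofReal_mul hc.le]
  congr 2
  field_simp

instance prior_isFiniteMeasure (p : ℕ) (lam : ℝ) [IsProbabilityMeasure (laplace lam)]
    (π : ℕ → ℝ) : IsFiniteMeasure (prior p lam π) := by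
  constructor
  rw [← lintegral_one, lintegral_prior]
  refine ENNReal.sum_lt_top.2 fun S _ => ?_
  simp [modelWeight]

lemma measurable_setLIntegral_likelihood {n p : ℕ} (X : Matrix (Fin n) (Fin p) ℝ) (lam : ℝ)
    [IsProbabilityMeasure (laplace lam)] (π : ℕ → ℝ) (B : Set (Fin p → ℝ)) :
    Measurable fun y => ∫⁻ β in B, likelihood X y β ∂(prior p lam π) :=
  (measurable_likelihood_uncurry X).lintegral_prod_right'

lemma measurable_posterior {n p : ℕ} (X : Matrix (Fin n) (Fin p) ℝ) (lam : ℝ)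
    [IsProbabilityMeasure (laplace lam)] (π : ℕ → ℝ) (B : Set (Fin p → ℝ)) :
    Measurable fun y => posterior X lam π y B := by
  refine (measurable_setLIntegral_likelihood X lam π B).div ?_
  simpa using measurable_setLIntegral_likelihood X lam π Set.univ

lemma posterior_union_le {n p : ℕ} (X : Matrix (Fin n) (Fin p) ℝ) (lam : ℝ) (π : ℕ → ℝ)
    (y : Fin n → ℝ) (A B : Set (Fin p → ℝ)) :
    posterior X lam π y (A ∪ B) ≤ posterior X lam π y A + posterior X lam π y B := by
  unfold posterior
  rw [← ENNReal.add_div]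
  exact ENNReal.div_le_div_right (lintegral_union_le _ _ _) _

lemma posterior_mono {n p : ℕ} (X : Matrix (Fin n) (Fin p) ℝ) (lam : ℝ) (π : ℕ → ℝ)
    (y : Fin n → ℝ) {A B : Set (Fin p → ℝ)} (h : A ⊆ B) :
    posterior X lam π y A ≤ posterior X lam π y B :=
  ENNReal.div_le_div_right (lintegral_mono_set h) _

lemma posterior_le_one {n p : ℕ} (X : Matrix (Fin n) (Fin p) ℝ) (lam : ℝ) (π : ℕ → ℝ)
    (y : Fin n → ℝ) (B : Set (Fin p → ℝ)) : posterior X lam π y B ≤ 1 :=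
  (ENNReal.div_le_div_right (setLIntegral_le_lintegral _ _) _).trans ENNReal.div_self_le_one

lemma expPosterior_le_one {n p : ℕ} (X : Matrix (Fin n) (Fin p) ℝ) (lam : ℝ) (π : ℕ → ℝ)
    (β₀ : Fin p → ℝ) (B : Set (Fin p → ℝ)) : expPosterior X lam π β₀ B ≤ 1 :=
  (lintegral_mono fun y => posterior_le_one X lam π y B).trans (by simp)

end SparseRegression

end

noncomputable section

namespace SparseRegression

/-! ### The prior on the dimension -/

/-- The conditions on a single regression problem and prior. -/
structure Admissible (A₁ A₂ A₃ A₄ : ℝ) {n p : ℕ} (X : Matrix (Fin n) (Fin p) ℝ) (lam : ℝ)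
    (π : ℕ → ℝ) : Prop where
  A₁_pos : 0 < A₁
  A₂_pos : 0 < A₂
  A₃_pos : 0 < A₃
  A₄_pos : 0 < A₄
  two_le : 2 ≤ p
  colNorm_pos : 0 < colNorm X
  lam_pos : 0 < lam
  le_lam : colNorm X / p ≤ lam
  lam_le : lam ≤ 2 * lamBar X
  isDimPrior : IsDimPrior p π
  dimDecrease : DimDecrease A₁ A₂ A₃ A₄ p π

namespace Admissible

variable {A₁ A₂ A₃ A₄ : ℝ} {n p : ℕ} {X : Matrix (Fin n) (Fin p) ℝ} {lam : ℝ} {π : ℕ → ℝ}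

lemma p_pos (h : Admissible A₁ A₂ A₃ A₄ X lam π) : (0 : ℝ) < p := by
  have := h.two_le; positivity

lemma log_pos (h : Admissible A₁ A₂ A₃ A₄ X lam π) : 0 < Real.log p :=
  Real.log_pos (by exact_mod_cast h.two_le)

lemma lamBar_pos (h : Admissible A₁ A₂ A₃ A₄ X lam π) : 0 < lamBar X := by
  have := h.colNorm_pos; have := h.log_pos; unfold lamBar; positivity

lemma dim_nonneg (h : Admissible A₁ A₂ A₃ A₄ X lam π) {s : ℕ} (hs : s ≤ p) : 0 ≤ π s :=
  h.isDimPrior.nonneg s hs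

lemma dim_succ_le (h : Admissible A₁ A₂ A₃ A₄ X lam π) {s : ℕ} (hs : s + 1 ≤ p) :
    π (s + 1) ≤ A₂ * (p : ℝ) ^ (-A₄) * π s :=
  (h.dimDecrease (s + 1) (Finset.mem_Icc.2 ⟨by omega, hs⟩)).2

lemma le_dim_succ (h : Admissible A₁ A₂ A₃ A₄ X lam π) {s : ℕ} (hs : s + 1 ≤ p) :
    A₁ * (p : ℝ) ^ (-A₃) * π s ≤ π (s + 1) :=
  (h.dimDecrease (s + 1) (Finset.mem_Icc.2 ⟨by omega, hs⟩)).1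

lemma dim_add_le (h : Admissible A₁ A₂ A₃ A₄ X lam π) {s : ℕ} (j : ℕ) (hs : s + j ≤ p) :
    π (s + j) ≤ (A₂ * (p : ℝ) ^ (-A₄)) ^ j * π s := by
  have hA := h.A₂_pos
  induction j with
  | zero => simp
  | succ j ih =>
    have h1 := h.dim_succ_le (s := s + j) (by omega)
    have h2 := ih (by omega)
    have hq : 0 ≤ A₂ * (p : ℝ) ^ (-A₄) := by positivity
    calc π (s + (j + 1)) ≤ A₂ * (p : ℝ) ^ (-A₄) * π (s + j) := h1
      _ ≤ A₂ * (p : ℝ) ^ (-A₄) * ((A₂ * (p : ℝ) ^ (-A₄)) ^ j * π s) := by gcongr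
      _ = _ := by ring

lemma le_dim (h : Admissible A₁ A₂ A₃ A₄ X lam π) {s : ℕ} (hs : s ≤ p) :
    (A₁ * (p : ℝ) ^ (-A₃)) ^ s * π 0 ≤ π s := by
  have hA := h.A₁_pos
  induction s with
  | zero => simp
  | succ s ih =>
    have h1 := h.le_dim_succ hs
    have h2 := ih (by omega)
    calc (A₁ * (p : ℝ) ^ (-A₃)) ^ (s + 1) * π 0
        = A₁ * (p : ℝ) ^ (-A₃) * ((A₁ * (p : ℝ) ^ (-A₃)) ^ s * π 0) := by ring
      _ ≤ A₁ * (p : ℝ) ^ (-A₃) * π s := by gcongr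
      _ ≤ _ := h1

/-- If `π 0` vanished, the upper bounds of the decrease condition would make every `π s` vanish,
against total mass one. -/
lemma dim_zero_pos (h : Admissible A₁ A₂ A₃ A₄ X lam π) : 0 < π 0 := by
  refine (h.dim_nonneg (Nat.zero_le p)).lt_of_ne' fun h0 => ?_
  have h1 := h.isDimPrior.sum_eq_one
  rw [Finset.sum_eq_zero] at h1
  · norm_num at h1
  · intro s hs
    have hs' : s ≤ p := by simpa [Nat.lt_succ_iff] using hs
    have h2 := h.dim_add_le (s := 0) s (by omega)
    rw [h0, mul_zero, zero_add] at h2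
    exact le_antisymm h2 (h.dim_nonneg hs')

lemma dim_pos (h : Admissible A₁ A₂ A₃ A₄ X lam π) {s : ℕ} (hs : s ≤ p) : 0 < π s := by
  have h1 := h.dim_zero_pos
  have h2 := h.A₁_pos
  have h3 := h.p_pos
  exact lt_of_lt_of_le (by positivity) (h.le_dim hs)

/-- The masses are dominated by a geometric series of ratio `1/2` starting at `π 0`, so `1 ≤ 2 π 0`.
-/
lemma half_le_dim_zero (h : Admissible A₁ A₂ A₃ A₄ X lam π)
    (hq : A₂ * (p : ℝ) ^ (-A₄) ≤ 1 / 2) : 1 / 2 ≤ π 0 := by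
  have h0 := h.dim_zero_pos
  have hA := h.A₂_pos
  have h1 : ∑ s ∈ Finset.range (p + 1), π s ≤ ∑ s ∈ Finset.range (p + 1), (1 / 2 : ℝ) ^ s * π 0 := by
    refine Finset.sum_le_sum fun s hs => ?_
    have h2 := h.dim_add_le (s := 0) s (by simpa [Nat.lt_succ_iff] using hs)
    rw [zero_add] at h2
    refine h2.trans ?_
    gcongr
  rw [h.isDimPrior.sum_eq_one, ← Finset.sum_mul] at h1
  have h3 : ∑ s ∈ Finset.range (p + 1), (1 / 2 : ℝ) ^ s ≤ 2 := sum_geometric_two_le _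
  nlinarith

end Admissible

/-! ### A lower bound for the evidence -/

section
variable {n p : ℕ} {X : Matrix (Fin n) (Fin p) ℝ} {lam : ℝ} {π : ℕ → ℝ}

lemma ofReal_le_slab_l1ball [IsProbabilityMeasure (laplace lam)] (hp : 0 < p)
    (hX : 0 < colNorm X) (hlam : 0 < lam)
    (hle : colNorm X / p ≤ lam) (S : Finset (Fin p)) :
    ENNReal.ofReal ((1 / (p * S.card : ℝ)) ^ S.card * Real.exp (-1))
      ≤ slab p lam S {β | colNorm X * l1normOn Finset.univ β ≤ 1} := by
  have hp0 : (0 : ℝ) < p := by exact_mod_cast hp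
  -- The `ℓ¹`-ball contains a cube of half-side `t = r/|S|`. The bound `r ≤ 1/‖X‖` keeps the cube in
  -- the ball, `r ≤ 1/λ` keeps the Laplace density loss to `e⁻¹` in total, and `λ ≥ ‖X‖/p` gives `λr
  -- ≥ 1/p`. For empty `S` the convention `r/0 = 0` is harmless.
  set r : ℝ := min (1 / lam) (1 / colNorm X) with hr
  set t : ℝ := r / S.card with ht
  have hr0 : 0 < r := by positivity
  have ht0 : 0 ≤ t := by positivity
  have hst : S.card * t ≤ r := by
    rw [ht]
    rcases Nat.eq_zero_or_pos S.card with h | h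
    · simp [h, hr0.le]
    · have : (0 : ℝ) < S.card := by exact_mod_cast h
      rw [mul_div_cancel₀ _ this.ne']
  have hrp : 1 / p ≤ lam * r := by
    rw [hr, mul_min_of_nonneg _ _ hlam.le, le_min_iff]
    constructor
    · rw [mul_one_div_cancel hlam.ne', div_le_one hp0]
      exact_mod_cast hp
    · rw [mul_one_div, div_le_div_iff₀ hp0 hX, one_mul]
      rwa [div_le_iff₀ hp0] at hle
  have hlr : lam * r ≤ 1 := by
    calc lam * r ≤ lam * (1 / lam) := by gcongr; exact min_le_left _ _
      _ = 1 := mul_one_div_cancel hlam.ne'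
  set A : Fin p → Set ℝ := fun i => if i ∈ S then Set.Icc (-t) t else {0} with hA
  have hsub : Set.univ.pi A ⊆ {β | colNorm X * l1normOn Finset.univ β ≤ 1} := by
    intro β hβ
    have h1 : l1normOn Finset.univ β ≤ S.card * t := by
      rw [l1norm_split S, l1normOn, l1normOn]
      have h2 : ∑ i ∈ Sᶜ, |β i| = 0 := by
        refine Finset.sum_eq_zero fun i hi => ?_
        have := hβ i trivial
        simp only [hA, Finset.mem_compl.1 hi, if_false, Set.mem_singleton_iff] at this
        simp [this]
      rw [h2, add_zero, ← nsmul_eq_mul]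
      refine Finset.sum_le_card_nsmul _ _ _ fun i hi => ?_
      have := hβ i trivial
      simp only [hA, hi, if_true] at this
      exact abs_le.2 this
    have h3 : l1normOn Finset.univ β ≤ 1 / colNorm X := (h1.trans hst).trans (min_le_right _ _)
    rw [le_div_iff₀ hX] at h3
    rw [Set.mem_ofPred_eq]
    linarith
  refine le_trans ?_ (measure_mono hsub)
  rw [slab, Measure.pi_pi]
  calc ENNReal.ofReal ((1 / (p * S.card : ℝ)) ^ S.card * Real.exp (-1))
      ≤ ENNReal.ofReal ((lam * t * Real.exp (-(lam * t))) ^ S.card) := by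
        refine ENNReal.ofReal_le_ofReal ?_
        rw [mul_pow, ← Real.exp_nat_mul]
        have h1 : 1 / (p * S.card : ℝ) ≤ lam * t := by
          rw [ht, ← mul_div_assoc, ← div_div]
          gcongr
        have h2 : (-1 : ℝ) ≤ S.card * -(lam * t) := by nlinarith
        gcongr
    _ = ∏ i, (if i ∈ S then ENNReal.ofReal (lam * t * Real.exp (-(lam * t))) else 1) := by
        rw [ENNReal.ofReal_pow (by positivity)]; simp
    _ ≤ _ := by
        refine Finset.prod_le_prod' fun i _ => ?_
        by_cases hi : i ∈ S
        · simp only [hA, hi, if_true]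
          exact ofReal_le_laplace_Icc hlam
        · simp [hA, hi]

/-- The slab is invariant under `β ↦ -β`, so the linear term may be averaged with its negative, and
`eᵘ + e⁻ᵘ ≥ 2`. On the small ball the quadratic term costs at most `1/2`. The bound holds for every
`u`, so the evidence bound needs no event for the data. -/
lemma le_lintegral_exp_symm [IsProbabilityMeasure (laplace lam)]
    (S : Finset (Fin p)) (u : Fin n → ℝ) :
    ENNReal.ofReal (Real.exp (-(1 / 2))) *
        slab p lam S {β | colNorm X * l1normOn Finset.univ β ≤ 1}
      ≤ ∫⁻ β, ENNReal.ofReal (Real.exp (-(l2norm (X *ᵥ β) ^ 2 / 2) + u ⬝ᵥ X *ᵥ β))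
          ∂(slab p lam S) := by
  set f : (Fin p → ℝ) → ℝ≥0∞ := fun β =>
    ENNReal.ofReal (Real.exp (-(l2norm (X *ᵥ β) ^ 2 / 2) + u ⬝ᵥ X *ᵥ β)) with hf
  have hcont : Continuous fun β : Fin p → ℝ => X *ᵥ β :=
    continuous_const.matrix_mulVec continuous_id
  have hc1 : Measurable fun β : Fin p → ℝ => l2norm (X *ᵥ β) :=
    (continuous_l2norm.comp hcont).measurable
  have hc2 : Measurable fun β : Fin p → ℝ => u ⬝ᵥ X *ᵥ β :=
    (Continuous.dotProduct continuous_const hcont).measurable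
  have hfm : Measurable f := ENNReal.measurable_ofReal.comp (Real.measurable_exp.comp
    (((hc1.pow_const 2).div_const 2).neg.add hc2))
  have hneg : ∫⁻ β, f (-β) ∂(slab p lam S) = ∫⁻ β, f β ∂(slab p lam S) :=
    (measurePreserving_neg_slab S).lintegral_comp hfm
  set B : Set (Fin p → ℝ) := {β | colNorm X * l1normOn Finset.univ β ≤ 1} with hB
  have hBm : MeasurableSet B := by
    refine measurableSet_le ?_ measurable_const
    unfold l1normOn
    fun_prop
  have key : ∀ β, B.indicator (fun _ => 2 * ENNReal.ofReal (Real.exp (-(1 / 2)))) β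
      ≤ f β + f (-β) := by
    intro β
    by_cases hβ : β ∈ B
    swap
    · rw [Set.indicator_of_notMem hβ]; exact zero_le
    rw [Set.indicator_of_mem hβ]
    simp only [hf, Matrix.mulVec_neg, l2norm_neg, dotProduct_neg]
    rw [← ENNReal.ofReal_add (Real.exp_pos _).le (Real.exp_pos _).le,
      show (2 : ℝ≥0∞) = ENNReal.ofReal 2 by simp, ← ENNReal.ofReal_mul (by norm_num)]
    refine ENNReal.ofReal_le_ofReal ?_
    rw [Real.exp_add, Real.exp_add, ← mul_add]
    have h1 : l2norm (X *ᵥ β) ≤ 1 := (l2norm_mulVec_le X β).trans hβ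
    have h2 : l2norm (X *ᵥ β) ^ 2 ≤ 1 := pow_le_one₀ (l2norm_nonneg _) h1
    have h3 : 2 ≤ Real.exp (u ⬝ᵥ X *ᵥ β) + Real.exp (-(u ⬝ᵥ X *ᵥ β)) := by
      have h4 := Real.add_one_le_exp (u ⬝ᵥ X *ᵥ β)
      have h5 := Real.add_one_le_exp (-(u ⬝ᵥ X *ᵥ β))
      linarith
    rw [mul_comm]
    refine mul_le_mul (Real.exp_le_exp.2 (by linarith)) h3 (by norm_num) (Real.exp_pos _).le
  have h1 := lintegral_mono (μ := slab p lam S) key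
  rw [lintegral_indicator hBm, setLIntegral_const, lintegral_add_left hfm, hneg, ← two_mul,
    mul_assoc] at h1
  exact (ENNReal.mul_le_mul_iff_right (by norm_num) (by norm_num)).1 h1

lemma Admissible.le_evidence {A₁ A₂ A₃ A₄ : ℝ} [IsProbabilityMeasure (laplace lam)]
    (h : Admissible A₁ A₂ A₃ A₄ X lam π) (y : Fin n → ℝ) (β₀ : Fin p → ℝ) :
    ENNReal.ofReal (π (supp β₀).card / (p : ℝ) ^ (2 * (supp β₀).card)
        * Real.exp (-((supp β₀).card + 2)) * Real.exp (-lam * l1normOn Finset.univ β₀))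
      * likelihood X y β₀ ≤ ∫⁻ β, likelihood X y β ∂(prior p lam π) := by
  have hp0 := h.p_pos
  have hX := h.colNorm_pos
  set S := supp β₀ with hS
  set s := S.card with hs
  have hsp : s ≤ p := by simpa using S.card_le_univ
  have hπ := h.dim_pos hsp
  have hL := measurable_likelihood X y
  have h1 : ENNReal.ofReal (Real.exp (-lam * l1normOn Finset.univ β₀)) *
      (likelihood X y β₀ * (ENNReal.ofReal (Real.exp (-(1 / 2))) *
        ENNReal.ofReal ((1 / (p * s : ℝ)) ^ s * Real.exp (-1))))
      ≤ ∫⁻ β, likelihood X y β ∂(slab p lam S) := by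
    refine le_trans ?_ (lintegral_mono' (smul_map_add_slab_le h.lam_pos β₀) le_rfl)
    rw [lintegral_smul_measure, lintegral_map hL (by fun_prop), smul_eq_mul]
    gcongr
    have h2 : ∀ β, likelihood X y (β + β₀) = likelihood X y β₀ * ENNReal.ofReal (Real.exp
      (-(l2norm (X *ᵥ β) ^ 2 / 2) + (y - X *ᵥ β₀) ⬝ᵥ X *ᵥ β)) := by
      intro β
      rw [likelihood_eq_mul X y β₀ (β + β₀), add_sub_cancel_right]
    simp_rw [h2]
    rw [lintegral_const_mul' _ _ (likelihood_ne_top X y β₀)]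
    gcongr
    refine le_trans ?_ (le_lintegral_exp_symm S (y - X *ᵥ β₀))
    gcongr
    exact ofReal_le_slab_l1ball (by have := h.two_le; omega) hX h.lam_pos h.le_lam S
  have h2 : modelWeight p π S * ∫⁻ β, likelihood X y β ∂(slab p lam S)
      ≤ ∫⁻ β, likelihood X y β ∂(prior p lam π) := by
    rw [lintegral_prior]
    exact Finset.single_le_sum (f := fun S => modelWeight p π S *
      ∫⁻ β, likelihood X y β ∂(slab p lam S)) (fun _ _ => zero_le) (Finset.mem_univ S)
  refine le_trans ?_ ((mul_le_mul_right h1 (modelWeight p π S)).trans h2)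
  have h3 : π s / (p : ℝ) ^ (2 * s) * Real.exp (-(s + 2)) ≤
      π s * (1 / (p.choose s : ℝ)) * (Real.exp (-(1 / 2)) *
        ((1 / (p * s : ℝ)) ^ s * Real.exp (-1))) := by
    have hc : (0 : ℝ) < p.choose s := by exact_mod_cast Nat.choose_pos hsp
    have hss : (0 : ℝ) < (s : ℝ) ^ s := by
      rcases Nat.eq_zero_or_pos s with h0 | h0
      · simp [h0]
      · positivity
    have hf : (0 : ℝ) < s.factorial := by positivity
    have h4 : (p.choose s : ℝ) ≤ (p : ℝ) ^ s / s.factorial := Nat.choose_le_pow_div s p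
    have h5 : (s : ℝ) ^ s / s.factorial ≤ Real.exp s :=
      Real.pow_div_factorial_le_exp _ (Nat.cast_nonneg s) s
    -- The choice of the model costs `p.choose s` and the cube costs `(ps)^s`; since `s^s/s! ≤ e^s`,
    -- together they cost only `p^(2s) e^s`.
    have h6 : (p.choose s : ℝ) * (s : ℝ) ^ s ≤ (p : ℝ) ^ s * Real.exp s := by
      calc (p.choose s : ℝ) * (s : ℝ) ^ s ≤ (p : ℝ) ^ s / s.factorial * (s : ℝ) ^ s := by gcongr
        _ = (p : ℝ) ^ s * ((s : ℝ) ^ s / s.factorial) := by ring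
        _ ≤ _ := by gcongr
    have h7 : Real.exp (-(s + 2 : ℝ)) ≤ Real.exp (-s) * (Real.exp (-(1 / 2)) * Real.exp (-1)) := by
      rw [← Real.exp_add, ← Real.exp_add]
      exact Real.exp_le_exp.2 (by linarith)
    have h8 : 1 / (p : ℝ) ^ (2 * s) * Real.exp (-s)
        ≤ 1 / (p.choose s : ℝ) * (1 / (p * s : ℝ)) ^ s := by
      rw [one_div_pow, mul_pow, Real.exp_neg, ← one_div, one_div_mul_one_div, one_div_mul_one_div]
      refine one_div_le_one_div_of_le (by positivity) ?_
      calc (p.choose s : ℝ) * ((p : ℝ) ^ s * (s : ℝ) ^ s)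
          = (p : ℝ) ^ s * ((p.choose s : ℝ) * (s : ℝ) ^ s) := by ring
        _ ≤ (p : ℝ) ^ s * ((p : ℝ) ^ s * Real.exp s) := by gcongr
        _ = _ := by ring
    calc π s / (p : ℝ) ^ (2 * s) * Real.exp (-(s + 2))
        ≤ π s / (p : ℝ) ^ (2 * s) * (Real.exp (-s) * (Real.exp (-(1 / 2)) * Real.exp (-1))) := by
          gcongr
      _ = π s * (Real.exp (-(1 / 2)) * Real.exp (-1)) *
          (1 / (p : ℝ) ^ (2 * s) * Real.exp (-s)) := by ring
      _ ≤ π s * (Real.exp (-(1 / 2)) * Real.exp (-1)) *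
          (1 / (p.choose s : ℝ) * (1 / (p * s : ℝ)) ^ s) := by gcongr
      _ = _ := by ring
  have h4 := ENNReal.ofReal_le_ofReal h3
  have hc : (0 : ℝ) < p.choose s := by exact_mod_cast Nat.choose_pos hsp
  rw [ENNReal.ofReal_mul (by positivity) (q := Real.exp (-(1 / 2)) *
        ((1 / (p * s : ℝ)) ^ s * Real.exp (-1))), ENNReal.ofReal_mul (Real.exp_pos _).le] at h4
  rw [ENNReal.ofReal_mul (by positivity)]
  calc _ ≤ (modelWeight p π S * (ENNReal.ofReal (Real.exp (-(1 / 2))) *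
        ENNReal.ofReal ((1 / (p * s : ℝ)) ^ s * Real.exp (-1)))) *
        ENNReal.ofReal (Real.exp (-lam * l1normOn Finset.univ β₀)) * likelihood X y β₀ := by
        gcongr
        exact h4
    _ = _ := by ring

end

end SparseRegression

end

noncomputable section

namespace SparseRegression

/-! ### Upper bounds for the posterior -/

section
variable {A₁ A₂ A₃ A₄ : ℝ} {n p : ℕ} {X : Matrix (Fin n) (Fin p) ℝ} {lam : ℝ} {π : ℕ → ℝ}

/-- The factor in front of the prior integral in the upper bound for the posterior. -/
def evidenceFactor (p : ℕ) (π : ℕ → ℝ) (s : ℕ) : ℝ :=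
  (p : ℝ) ^ (2 * s) * Real.exp (s + 2) / π s

/-- The logarithm of the likelihood ratio, increased by `lam * ‖β₀‖₁`. -/
def logRatio (X : Matrix (Fin n) (Fin p) ℝ) (lam : ℝ) (β₀ : Fin p → ℝ) (y : Fin n → ℝ)
    (β : Fin p → ℝ) : ℝ :=
  lam * l1normOn Finset.univ β₀ - l2norm (X *ᵥ (β - β₀)) ^ 2 / 2
    + (y - X *ᵥ β₀) ⬝ᵥ X *ᵥ (β - β₀)

/-- The logarithm of the integrable part that is split off from the likelihood ratio. -/
def logEnvelope (lam : ℝ) (β₀ β : Fin p → ℝ) : ℝ :=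
  lam * l1normOn Finset.univ β - lam / 4 * l1normOn Finset.univ (β - β₀)

lemma continuous_l1norm {m : ℕ} : Continuous (l1normOn (Finset.univ : Finset (Fin m))) := by
  unfold l1normOn
  fun_prop

lemma continuous_logRatio (X : Matrix (Fin n) (Fin p) ℝ) (lam : ℝ) (β₀ : Fin p → ℝ) :
    Continuous fun q : (Fin n → ℝ) × (Fin p → ℝ) => logRatio X lam β₀ q.1 q.2 := by
  have h1 : Continuous fun q : (Fin n → ℝ) × (Fin p → ℝ) => X *ᵥ (q.2 - β₀) :=
    continuous_const.matrix_mulVec (continuous_snd.sub continuous_const)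
  have h2 : Continuous fun q : (Fin n → ℝ) × (Fin p → ℝ) => l2norm (X *ᵥ (q.2 - β₀)) :=
    continuous_l2norm.comp h1
  have h3 : Continuous fun q : (Fin n → ℝ) × (Fin p → ℝ) =>
      (q.1 - X *ᵥ β₀) ⬝ᵥ X *ᵥ (q.2 - β₀) :=
    Continuous.dotProduct (continuous_fst.sub continuous_const) h1
  exact (continuous_const.sub ((h2.pow 2).div_const 2)).add h3

lemma measurable_exp_logRatio (X : Matrix (Fin n) (Fin p) ℝ) (lam : ℝ) (β₀ : Fin p → ℝ) :
    Measurable fun q : (Fin n → ℝ) × (Fin p → ℝ) =>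
      ENNReal.ofReal (Real.exp (logRatio X lam β₀ q.1 q.2)) :=
  (continuous_logRatio X lam β₀).measurable.exp.ennreal_ofReal

lemma measurable_exp_logEnvelope (lam : ℝ) (β₀ : Fin p → ℝ) :
    Measurable fun β => ENNReal.ofReal (Real.exp (logEnvelope lam β₀ β)) := by
  have h1 : Continuous fun β : Fin p → ℝ => l1normOn Finset.univ (β - β₀) :=
    continuous_l1norm.comp (continuous_id.sub continuous_const)
  exact ((continuous_const.mul continuous_l1norm).sub
    (continuous_const.mul h1)).measurable.exp.ennreal_ofReal

lemma Admissible.evidenceFactor_nonneg (h : Admissible A₁ A₂ A₃ A₄ X lam π) {s : ℕ}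
    (hs : s ≤ p) : 0 ≤ evidenceFactor p π s := by
  have := h.dim_pos hs
  unfold evidenceFactor
  positivity

lemma card_supp_le {p : ℕ} (β : Fin p → ℝ) : (supp β).card ≤ p := by
  simpa using (supp β).card_le_univ

lemma Admissible.posterior_le [IsProbabilityMeasure (laplace lam)]
    (h : Admissible A₁ A₂ A₃ A₄ X lam π) (β₀ : Fin p → ℝ) (y : Fin n → ℝ)
    (B : Set (Fin p → ℝ)) :
    posterior X lam π y B ≤ ENNReal.ofReal (evidenceFactor p π (supp β₀).card) *
      ∫⁻ β in B, ENNReal.ofReal (Real.exp (logRatio X lam β₀ y β)) ∂(prior p lam π) := by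
  have hZ := h.le_evidence y β₀
  set s := (supp β₀).card with hs
  have hπ := h.dim_pos (card_supp_le β₀)
  rw [← hs] at hπ
  have hp := h.p_pos
  set c : ℝ := π s / (p : ℝ) ^ (2 * s) * Real.exp (-(s + 2))
    * Real.exp (-lam * l1normOn Finset.univ β₀) with hc
  have hc0 : 0 < c := by positivity
  have hL0 := (likelihood_pos X y β₀).ne'
  have hLt := likelihood_ne_top X y β₀
  rw [posterior]
  refine (ENNReal.div_le_div_left hZ _).trans ?_
  rw [ENNReal.div_le_iff (mul_ne_zero (ENNReal.ofReal_pos.2 hc0).ne' hL0) (ENNReal.mul_ne_top ENNReal.ofReal_ne_top hLt)]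
  have h1 : ∀ β, likelihood X y β = ENNReal.ofReal (Real.exp (-lam * l1normOn Finset.univ β₀)) *
      likelihood X y β₀ * ENNReal.ofReal (Real.exp (logRatio X lam β₀ y β)) := by
    intro β
    rw [likelihood_eq_mul X y β₀ β, mul_comm (ENNReal.ofReal _) (likelihood X y β₀), mul_assoc,
      ← ENNReal.ofReal_mul (Real.exp_pos _).le, ← Real.exp_add]
    congr 3
    unfold logRatio
    ring
  rw [lintegral_congr h1, lintegral_const_mul' _ _ (ENNReal.mul_ne_top ENNReal.ofReal_ne_top hLt)]
  have h2 : evidenceFactor p π s * c = Real.exp (-lam * l1normOn Finset.univ β₀) := by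
    rw [evidenceFactor, hc, Real.exp_neg (s + 2 : ℝ)]
    field_simp
  rw [← h2, ENNReal.ofReal_mul (h.evidenceFactor_nonneg (card_supp_le β₀))]
  exact le_of_eq (by ring)

/-- Under `slab p lam S` the support is almost surely exactly `S`, since the Laplace law has no atom
at zero. Hence a constraint on the dimension removes whole models, and each remaining one
contributes `4^|S|`. -/
lemma setLIntegral_prior_exp_logEnvelope_le [IsProbabilityMeasure (laplace lam)] (hlam : 0 < lam)
    (β₀ : Fin p → ℝ) {B : Set (Fin p → ℝ)} (hB : MeasurableSet B) (P : ℕ → Prop)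
    [DecidablePred P] (hP : ∀ β ∈ B, P (supp β).card) :
    ∫⁻ β in B, ENNReal.ofReal (Real.exp (logEnvelope lam β₀ β)) ∂(prior p lam π)
      ≤ ∑ s ∈ Finset.range (p + 1), ENNReal.ofReal (π s) * (if P s then 4 ^ s else 0) := by
  rw [setLIntegral_prior lam π hB, ← sum_modelWeight_mul]
  refine Finset.sum_le_sum fun S _ => ?_
  gcongr
  split_ifs with hS
  · exact (setLIntegral_le_lintegral _ _).trans (lintegral_exp_slab_le S hlam β₀)
  · have h1 : ∀ᵐ β ∂(slab p lam S), supp β = S := by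
      have h2 : ∀ᵐ β ∂(slab p lam S), ∀ i, i ∈ S → β i ≠ 0 := by
        rw [ae_all_iff]
        intro i
        by_cases hi : i ∈ S
        · filter_upwards [ae_slab_ne_zero (lam := lam) S hi] with β hβ _ using hβ
        · simp [hi]
      filter_upwards [ae_slab_supp_subset (lam := lam) S, h2] with β h3 h4
      exact h3.antisymm fun i hi => mem_supp.2 (h4 i hi)
    have h2 : slab p lam S B = 0 := by
      refine measure_mono_null (fun β hβ => ?_) (ae_iff.1 h1)
      intro hc
      exact hS (hc ▸ hP β hβ)
    rw [Measure.restrict_eq_zero.2 h2, lintegral_zero_measure]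

/-! ### The posterior dimension -/

lemma l1norm_sub_le (β₀ β : Fin p → ℝ) :
    l1normOn Finset.univ β₀ - l1normOn Finset.univ β
      ≤ l1normOn (supp β₀) (β - β₀) - l1normOn (supp β₀)ᶜ (β - β₀) := by
  rw [l1norm_split (supp β₀) β₀, l1norm_split (supp β₀) β]
  have h1 : l1normOn (supp β₀)ᶜ β₀ = 0 :=
    Finset.sum_eq_zero fun i hi => by simpa [mem_supp] using hi
  have h2 : l1normOn (supp β₀)ᶜ (β - β₀) = l1normOn (supp β₀)ᶜ β := by
    refine Finset.sum_congr rfl fun i hi => ?_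
    have : β₀ i = 0 := by simpa [mem_supp] using hi
    simp [this]
  have h3 : l1normOn (supp β₀) β₀ ≤ l1normOn (supp β₀) β + l1normOn (supp β₀) (β - β₀) := by
    rw [l1normOn, l1normOn, l1normOn, ← Finset.sum_add_distrib]
    refine Finset.sum_le_sum fun i _ => ?_
    have := abs_sub_abs_le_abs_sub (β₀ i) (β i)
    rw [abs_sub_comm] at this
    simp only [Pi.sub_apply]
    linarith
  rw [h1, h2]
  linarith

/-- `lam / (lamBar X * φ(S)²)`. -/
def lamRatio (X : Matrix (Fin n) (Fin p) ℝ) (lam : ℝ) (S : Finset (Fin p)) : ℝ :=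
  lam / (lamBar X * (compat X S).toReal ^ 2)

lemma Admissible.lamRatio_nonneg (h : Admissible A₁ A₂ A₃ A₄ X lam π) (S : Finset (Fin p)) :
    0 ≤ lamRatio X lam S := by
  have := h.lam_pos
  have := h.lamBar_pos
  unfold lamRatio
  positivity

/-- With `a`, `b` the `ℓ¹`-norms of `β - β⁰` on and off `S₀`, the linear terms amount to `λ(a - b) +
(3/4)λ(a + b) = λ(7a/4 - b/4)`. The sign change at `b = 7a` is the origin of the cone in the
compatibility number. -/
lemma Admissible.quadratic_le (h : Admissible A₁ A₂ A₃ A₄ X lam π) (β₀ β : Fin p → ℝ)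
    (hφ : 0 < (compat X (supp β₀)).toReal) :
    lam * l1normOn Finset.univ β₀ - l2norm (X *ᵥ (β - β₀)) ^ 2 / 2
        + lam / 2 * l1normOn Finset.univ (β - β₀)
        + (1 - lam / (2 * lamBar X)) ^ 2 * l2norm (X *ᵥ (β - β₀)) ^ 2 / 2
      ≤ 16 * lamRatio X lam (supp β₀) * (supp β₀).card * Real.log p + logEnvelope lam β₀ β := by
  have hlb := h.lamBar_pos
  have hX := h.colNorm_pos
  have hl := h.lam_pos
  have hL := h.log_pos
  set S := supp β₀ with hS
  set φ := (compat X S).toReal with hφdef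
  set N := l2norm (X *ᵥ (β - β₀)) with hN
  have hN0 : 0 ≤ N := l2norm_nonneg _
  have h1 := l1norm_sub_le β₀ β
  rw [← hS] at h1
  have hsplit := l1norm_split S (β - β₀)
  set a := l1normOn S (β - β₀) with ha
  set b := l1normOn Sᶜ (β - β₀) with hb
  have ha0 : 0 ≤ a := l1normOn_nonneg _ _
  have hb0 : 0 ≤ b := l1normOn_nonneg _ _
  have hx1 : lam / (2 * lamBar X) ≤ 1 := by
    rw [div_le_one (by positivity)]; exact h.lam_le
  have hx0 : 0 ≤ lam / (2 * lamBar X) := by positivity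
  -- For `x = λ/(2λ̄)` in `[0, 1]`, `(1 - x)² ≤ 1 - x`: a fraction `x/2` of `N²` remains to absorb
  -- the linear terms.
  have hquad : (1 - lam / (2 * lamBar X)) ^ 2 * N ^ 2 / 2
      ≤ N ^ 2 / 2 - lam / (4 * lamBar X) * N ^ 2 := by
    have h2 : lam / (4 * lamBar X) = lam / (2 * lamBar X) / 2 := by
      rw [div_div]; congr 1; ring
    rw [h2]
    have h3 : 0 ≤ lam / (2 * lamBar X) * (1 - lam / (2 * lamBar X)) * N ^ 2 := by
      have : 0 ≤ 1 - lam / (2 * lamBar X) := by linarith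
      positivity
    nlinarith
  have hE : lam * l1normOn Finset.univ β₀ - lam * l1normOn Finset.univ β ≤ lam * (a - b) := by
    rw [← mul_sub]; exact mul_le_mul_of_nonneg_left h1 hl.le
  have hr := h.lamRatio_nonneg S
  have main : lam * (7 / 4 * a - b / 4) - lam / (4 * lamBar X) * N ^ 2
      ≤ 16 * lamRatio X lam S * S.card * Real.log p := by
    have hrhs : 0 ≤ 16 * lamRatio X lam S * S.card * Real.log p := by positivity
    have hN2 : 0 ≤ lam / (4 * lamBar X) * N ^ 2 := by positivity
    rcases le_total (7 * a) b with hab | hab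
    · have : lam * (7 / 4 * a - b / 4) ≤ 0 :=
        mul_nonpos_of_nonneg_of_nonpos hl.le (by linarith)
      linarith
    · have h2 := compat_mul_le hX (S := S) (β := β - β₀) hab
      rw [← hφdef, ← hN, ← ha] at h2
      set k := √S.card / (colNorm X * φ) with hk
      have hk0 : 0 ≤ k := by positivity
      have hak : a ≤ k * N := by
        rw [hk, div_mul_eq_mul_div, le_div_iff₀ (by positivity)]
        linarith
      have h3 : 4 * lam * lamBar X * k ^ 2
          = 16 * lamRatio X lam S * S.card * Real.log p := by
        have hsq : √(S.card : ℝ) ^ 2 = S.card := Real.sq_sqrt (by positivity)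
        have hlb2 : lamBar X ^ 2 = 4 * colNorm X ^ 2 * Real.log p := by
          rw [lamBar, mul_pow, mul_pow, Real.sq_sqrt hL.le]; ring
        rw [hk, div_pow, hsq, lamRatio, ← hφdef]
        field_simp
        linear_combination (4 * S.card : ℝ) * hlb2
      rw [← h3]
      -- Completing the square, with equality at `N = 4 λ̄ k`; the constant left over is the `16
      -- λ/(λ̄φ²) s log p` of the statement.
      have h4 : 2 * lam * (k * N) ≤ lam / (4 * lamBar X) * N ^ 2 + 4 * lam * lamBar X * k ^ 2 := by
        have h5 : lam / (4 * lamBar X) * N ^ 2 + 4 * lam * lamBar X * k ^ 2 - 2 * lam * (k * N)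
            = lam / (4 * lamBar X) * (N - 4 * lamBar X * k) ^ 2 := by
          field_simp
          ring
        have : 0 ≤ lam / (4 * lamBar X) * (N - 4 * lamBar X * k) ^ 2 := by positivity
        linarith
      have h6 : lam * (7 / 4 * a - b / 4) ≤ 2 * lam * (k * N) := by nlinarith
      linarith
  unfold logEnvelope
  rw [hsplit] at *
  linarith

/-- The noise term is cut in two. The fraction `λ/(2λ̄) ≤ 1` is bounded on the event by `(λ/2)‖β -
β⁰‖₁`, which the prior can absorb even for small `λ`; the rest is integrated exactly under the
Gaussian law. -/
lemma Admissible.lintegral_exp_logRatio_le (h : Admissible A₁ A₂ A₃ A₄ X lam π)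
    (β₀ β : Fin p → ℝ) (hφ : 0 < (compat X (supp β₀)).toReal) :
    ∫⁻ y in noiseEvent X β₀, ENNReal.ofReal (Real.exp (logRatio X lam β₀ y β)) ∂(dataLaw X β₀)
      ≤ ENNReal.ofReal (Real.exp
          (16 * lamRatio X lam (supp β₀) * (supp β₀).card * Real.log p)) *
        ENNReal.ofReal (Real.exp (logEnvelope lam β₀ β)) := by
  have hlb := h.lamBar_pos
  have hl := h.lam_pos
  have hx1 : lam / (2 * lamBar X) ≤ 1 := by
    rw [div_le_one (by positivity)]; exact h.lam_le
  have hx0 : 0 ≤ lam / (2 * lamBar X) := by positivity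
  set v := X *ᵥ (β - β₀) with hv
  set c : ℝ := lam * l1normOn Finset.univ β₀ - l2norm v ^ 2 / 2
        + lam / 2 * l1normOn Finset.univ (β - β₀) with hc
  have hm := measurable_dotProduct_sub X β₀ ((1 - lam / (2 * lamBar X)) • v)
  calc _ ≤ ∫⁻ y in noiseEvent X β₀, ENNReal.ofReal (Real.exp c) *
        ENNReal.ofReal (Real.exp ((y - X *ᵥ β₀) ⬝ᵥ ((1 - lam / (2 * lamBar X)) • v)))
        ∂(dataLaw X β₀) := by
        refine setLIntegral_mono (hm.exp.ennreal_ofReal.const_mul _) fun y hy => ?_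
        rw [← ENNReal.ofReal_mul (Real.exp_pos _).le, ← Real.exp_add]
        refine ENNReal.ofReal_le_ofReal (Real.exp_le_exp.2 ?_)
        have h1 := (abs_le.1 (abs_dotProduct_mulVec_le X (y - X *ᵥ β₀) (β - β₀) hy)).2
        rw [← hv] at h1
        rw [dotProduct_smul, smul_eq_mul, logRatio, ← hv, hc]
        have h2 := mul_le_mul_of_nonneg_left h1 hx0
        have h3 : lam / (2 * lamBar X) * (lamBar X * l1normOn Finset.univ (β - β₀))
            = lam / 2 * l1normOn Finset.univ (β - β₀) := by field_simp
        linarith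
    _ ≤ ∫⁻ y, ENNReal.ofReal (Real.exp c) *
        ENNReal.ofReal (Real.exp ((y - X *ᵥ β₀) ⬝ᵥ ((1 - lam / (2 * lamBar X)) • v)))
        ∂(dataLaw X β₀) := setLIntegral_le_lintegral _ _
    _ = ENNReal.ofReal (Real.exp (c + (1 - lam / (2 * lamBar X)) ^ 2 * l2norm v ^ 2 / 2)) := by
        rw [lintegral_const_mul _ hm.exp.ennreal_ofReal, lintegral_exp_dataLaw,
          ← ENNReal.ofReal_mul (Real.exp_pos _).le, ← Real.exp_add, l2norm_smul, mul_pow, sq_abs]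
    _ ≤ _ := by
        rw [← ENNReal.ofReal_mul (Real.exp_pos _).le, ← Real.exp_add]
        exact ENNReal.ofReal_le_ofReal (Real.exp_le_exp.2 (h.quadratic_le β₀ β hφ))

/-- The effective dimension as a real number. -/
def effDimReal (X : Matrix (Fin n) (Fin p) ℝ) (A₄ lam : ℝ) (S : Finset (Fin p)) : ℝ :=
  (2 + (3 + 33 * lamRatio X lam S) / A₄) * S.card

/-- The condition that `p` is large compared to the constants. -/
structure IsLarge (A₁ A₂ A₄ : ℝ) (p : ℕ) : Prop where
  log_ge : 32 ≤ Real.log p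
  A₁_ge : 2 / A₁ ≤ p
  A₂_le : 8 * A₂ ≤ Real.exp (A₄ * Real.log p / 8)

/-- An eighth of the exponent `A₄` is given up to absorb the constant `8A₂`. -/
lemma Admissible.rate_le (h : Admissible A₁ A₂ A₃ A₄ X lam π) (hp : IsLarge A₁ A₂ A₄ p) :
    8 * (A₂ * (p : ℝ) ^ (-A₄)) ≤ Real.exp (-(7 / 8 * A₄ * Real.log p)) := by
  rw [Real.rpow_def_of_pos h.p_pos, ← mul_assoc]
  calc _ ≤ Real.exp (A₄ * Real.log p / 8) * Real.exp (Real.log p * -A₄) := by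
        gcongr; exact hp.A₂_le
    _ = _ := by rw [← Real.exp_add]; ring_nf

/-- Writing `4^t = 8^t 2^(-t)` leaves the summable factor `2^(-t)`, and each of the more than `r`
extra dimensions gains a factor `p^(-7A₄/8)`. -/
lemma Admissible.dim_mul_pow_le (h : Admissible A₁ A₂ A₃ A₄ X lam π) (hp : IsLarge A₁ A₂ A₄ p)
    {s t : ℕ} {r : ℝ} (ht : t ≤ p) (hr : 0 ≤ r) (hst : s + r < t) :
    π t * 4 ^ t ≤ π s * 8 ^ s * Real.exp (-(7 / 8 * A₄ * Real.log p * r)) * (1 / 2) ^ t := by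
  have hlt : s ≤ t := by
    have : (s : ℝ) < t := by linarith
    exact_mod_cast this.le
  obtain ⟨j, rfl⟩ := Nat.exists_eq_add_of_le hlt
  have hA := h.A₂_pos
  have hA4 := h.A₄_pos
  have hL := h.log_pos
  have hq := h.rate_le hp
  set q := A₂ * (p : ℝ) ^ (-A₄) with hqdef
  have hq0 : 0 ≤ q := by have := h.p_pos; positivity
  have h1 := h.dim_add_le j ht
  rw [← hqdef] at h1
  have hπ := h.dim_nonneg (s := s) (by omega)
  have hjr : r ≤ j := by push_cast at hst; linarith
  have h2 : (8 * q) ^ j ≤ Real.exp (-(7 / 8 * A₄ * Real.log p * r)) := by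
    calc (8 * q) ^ j ≤ Real.exp (-(7 / 8 * A₄ * Real.log p)) ^ j := by gcongr
      _ = Real.exp (-(7 / 8 * A₄ * Real.log p * j)) := by rw [← Real.exp_nat_mul]; ring_nf
      _ ≤ _ := by gcongr
  calc π (s + j) * 4 ^ (s + j) ≤ q ^ j * π s * 4 ^ (s + j) := by gcongr
    _ = π s * 8 ^ s * (8 * q) ^ j * (1 / 2) ^ (s + j) := by
      have e1 : (4 : ℝ) ^ (s + j) = 8 ^ (s + j) * (1 / 2) ^ (s + j) := by
        rw [← mul_pow]; norm_num
      rw [e1, mul_pow, pow_add (8 : ℝ)]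
      ring
    _ ≤ _ := by gcongr

lemma measurableSet_card_supp {p : ℕ} (P : ℕ → Prop) :
    MeasurableSet {β : Fin p → ℝ | P (supp β).card} := by
  have h : Measurable fun β : Fin p → ℝ => (supp β).card := by
    unfold supp
    simp_rw [Finset.card_filter]
    refine Finset.measurable_sum _ fun i _ => ?_
    refine Measurable.ite ?_ measurable_const measurable_const
    exact (measurableSet_singleton (0 : ℝ)).compl.preimage (measurable_pi_apply i)
  -- Every set of natural numbers is measurable.
  exact h (t := {s | P s}) trivial

/-- Models whose dimension exceeds the effective dimension. -/
def largeModels (X : Matrix (Fin n) (Fin p) ℝ) (A₄ lam : ℝ) (β₀ : Fin p → ℝ) :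
    Set (Fin p → ℝ) :=
  {β | effDimReal X A₄ lam (supp β₀) < (supp β).card + (supp β₀).card}

lemma Admissible.lintegral_posterior_largeModels_le [IsProbabilityMeasure (laplace lam)]
    (h : Admissible A₁ A₂ A₃ A₄ X lam π) (hp : IsLarge A₁ A₂ A₄ p) (β₀ : Fin p → ℝ)
    (hβ₀ : (supp β₀).Nonempty) (hφ : 0 < (compat X (supp β₀)).toReal) :
    ∫⁻ y in noiseEvent X β₀, posterior X lam π y (largeModels X A₄ lam β₀) ∂(dataLaw X β₀)
      ≤ ENNReal.ofReal (2 * Real.exp 2 * Real.exp (-(Real.log p / 2))) := by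
  classical
  have hA4 := h.A₄_pos
  have hL := h.log_pos
  have hr := h.lamRatio_nonneg (supp β₀)
  set x := lamRatio X lam (supp β₀) with hx
  set s := (supp β₀).card with hs
  have hs1 : (1 : ℝ) ≤ s := by exact_mod_cast hβ₀.card_pos
  have hπ := h.dim_pos (card_supp_le β₀)
  rw [← hs] at hπ
  set r : ℝ := (3 + 33 * x) / A₄ * s with hrdef
  have hr0 : 0 ≤ r := by positivity
  set B := largeModels X A₄ lam β₀ with hB
  have hBm : MeasurableSet B :=
    measurableSet_card_supp fun t => effDimReal X A₄ lam (supp β₀) < t + (supp β₀).card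
  have hBP : ∀ β ∈ B, (s : ℝ) + r < (supp β).card := by
    intro β hβ
    rw [hB, largeModels, Set.mem_ofPred_eq, effDimReal, ← hx, ← hs] at hβ
    rw [hrdef]
    linarith
  set K := ENNReal.ofReal (evidenceFactor p π s) with hK
  set E := ENNReal.ofReal (Real.exp (16 * x * s * Real.log p)) with hE
  have hm := measurable_exp_logRatio X lam β₀
  calc _ ≤ ∫⁻ y in noiseEvent X β₀, K * ∫⁻ β in B,
        ENNReal.ofReal (Real.exp (logRatio X lam β₀ y β)) ∂(prior p lam π) ∂(dataLaw X β₀) :=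
        lintegral_mono fun y => h.posterior_le β₀ y B
    -- The set `B` does not depend on the data, so Tonelli allows integrating over `y` first, for
    -- fixed `β`.
    _ = K * ∫⁻ β in B, ∫⁻ y in noiseEvent X β₀,
        ENNReal.ofReal (Real.exp (logRatio X lam β₀ y β)) ∂(dataLaw X β₀) ∂(prior p lam π) := by
        rw [lintegral_const_mul' _ _ ENNReal.ofReal_ne_top,
          lintegral_lintegral_swap hm.aemeasurable]
    _ ≤ K * ∫⁻ β in B, E * ENNReal.ofReal (Real.exp (logEnvelope lam β₀ β)) ∂(prior p lam π) := by
        gcongr with β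
        exact h.lintegral_exp_logRatio_le β₀ β hφ
    _ = K * (E * ∫⁻ β in B, ENNReal.ofReal (Real.exp (logEnvelope lam β₀ β)) ∂(prior p lam π)) := by
        rw [lintegral_const_mul' _ _ ENNReal.ofReal_ne_top]
    _ ≤ K * (E * ∑ t ∈ Finset.range (p + 1),
          ENNReal.ofReal (π t) * (if (s : ℝ) + r < t then 4 ^ t else 0)) := by
        gcongr
        exact setLIntegral_prior_exp_logEnvelope_le h.lam_pos β₀ hBm _ hBP
    _ ≤ K * (E * ∑ t ∈ Finset.range (p + 1), ENNReal.ofReal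
          (π s * 8 ^ s * Real.exp (-(7 / 8 * A₄ * Real.log p * r)) * (1 / 2) ^ t)) := by
        gcongr with t ht
        split_ifs with hst
        · have ht' : t ≤ p := by simpa [Nat.lt_succ_iff] using ht
          rw [show (4 : ℝ≥0∞) ^ t = ENNReal.ofReal (4 ^ t) by
            rw [ENNReal.ofReal_pow (by norm_num)]; norm_num,
            ← ENNReal.ofReal_mul (h.dim_nonneg ht')]
          exact ENNReal.ofReal_le_ofReal (h.dim_mul_pow_le hp ht' hr0 hst)
        · simp
    _ = ENNReal.ofReal (evidenceFactor p π s * (Real.exp (16 * x * s * Real.log p) *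
          ∑ t ∈ Finset.range (p + 1),
            π s * 8 ^ s * Real.exp (-(7 / 8 * A₄ * Real.log p * r)) * (1 / 2) ^ t)) := by
        rw [ENNReal.ofReal_mul (h.evidenceFactor_nonneg (card_supp_le β₀)),
          ENNReal.ofReal_mul (Real.exp_pos _).le, ENNReal.ofReal_sum_of_nonneg]
        intros; positivity
    _ ≤ _ := by
        refine ENNReal.ofReal_le_ofReal ?_
        rw [← Finset.mul_sum]
        have h3 : ∑ t ∈ Finset.range (p + 1), (1 / 2 : ℝ) ^ t ≤ 2 := sum_geometric_two_le _
        have hpow : (p : ℝ) ^ (2 * s) = Real.exp (2 * s * Real.log p) := by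
          rw [← Real.rpow_natCast, Real.rpow_def_of_pos h.p_pos]
          push_cast
          ring_nf
        have h8 : (8 : ℝ) ^ s ≤ Real.exp (3 * s) := by
          have : (8 : ℝ) ≤ Real.exp 3 := by
            have h1 := Real.exp_one_gt_d9
            have h2 : Real.exp 3 = Real.exp 1 ^ 3 := by rw [← Real.exp_nat_mul]; norm_num
            rw [h2]
            calc (8 : ℝ) = 2 ^ 3 := by norm_num
              _ ≤ _ := by gcongr; linarith
          rw [mul_comm, Real.exp_nat_mul]
          gcongr
        have hrr : 7 / 8 * A₄ * Real.log p * r = 7 / 8 * Real.log p * (3 + 33 * x) * s := by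
          rw [hrdef]; field_simp
        calc _ = (p : ℝ) ^ (2 * s) * Real.exp (s + 2) * (Real.exp (16 * x * s * Real.log p) *
              (8 ^ s * Real.exp (-(7 / 8 * A₄ * Real.log p * r)) *
                ∑ t ∈ Finset.range (p + 1), (1 / 2 : ℝ) ^ t)) := by
              rw [evidenceFactor]; field_simp
          _ ≤ Real.exp (2 * s * Real.log p) * Real.exp (s + 2) *
              (Real.exp (16 * x * s * Real.log p) * (Real.exp (3 * s) *
                Real.exp (-(7 / 8 * Real.log p * (3 + 33 * x) * s)) * 2)) := by
              rw [hpow, hrr]; gcongr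
          _ = 2 * Real.exp (2 * s * Real.log p + (s + 2) + 16 * x * s * Real.log p + 3 * s
                - 7 / 8 * Real.log p * (3 + 33 * x) * s) := by
              simp only [sub_eq_add_neg, Real.exp_add]
              ring
          -- The constants in the effective dimension are chosen for this: `33 · 7/8 > 16` beats the
          -- compatibility term, and `3 · 7/8 = 2 + 1/2 + 1/8` pays for `p^(2s)`, for the final
          -- rate, and, as `log p ≥ 32`, for `e^(4s)`.
          _ ≤ 2 * Real.exp (2 + -(Real.log p / 2)) := by
              gcongr
              have h5 := hp.log_ge
              have h6 : 0 ≤ x * s * Real.log p := by positivity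
              have h7 : 0 ≤ (s - 1) * Real.log p := mul_nonneg (by linarith) hL.le
              have h8 : 0 ≤ s * (Real.log p - 32) := mul_nonneg (by linarith) (by linarith)
              nlinarith
          _ = _ := by rw [Real.exp_add]; ring

end

end SparseRegression

end

noncomputable section

namespace SparseRegression

section
variable {A₁ A₂ A₃ A₄ : ℝ} {n p : ℕ} {X : Matrix (Fin n) (Fin p) ℝ} {lam : ℝ} {π : ℕ → ℝ}

/-! ### Recovery -/

lemma effDim_eq_ofReal (h : Admissible A₁ A₂ A₃ A₄ X lam π) {S : Finset (Fin p)}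
    (h0 : compat X S ≠ 0) (ht : compat X S ≠ ∞) :
    effDim X A₄ lam S = ENNReal.ofReal (effDimReal X A₄ lam S) := by
  have hl := h.lam_pos
  have hlb := h.lamBar_pos
  have hA := h.A₄_pos
  obtain ⟨φ, hφ, hc, hc'⟩ : ∃ φ : ℝ, 0 < φ ∧ compat X S = ENNReal.ofReal φ ∧
      (compat X S).toReal = φ :=
    ⟨_, ENNReal.toReal_pos h0 ht, (ENNReal.ofReal_toReal ht).symm, rfl⟩
  rw [effDim, effDimReal, lamRatio, hc', hc, ← ENNReal.ofReal_pow hφ.le, ← ENNReal.ofReal_div_of_pos (by positivity),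
    ← ENNReal.ofReal_mul (by positivity), ← ENNReal.ofReal_add (by positivity) (by positivity),
    ← ENNReal.ofReal_natCast, ← ENNReal.ofReal_mul (by positivity)]
  clear hc hc'
  congr 1
  field_simp
  ring

lemma card_supp_sub_le (β β₀ : Fin p → ℝ) :
    (supp (β - β₀)).card ≤ (supp β).card + (supp β₀).card := by
  refine (Finset.card_le_card (t := supp β ∪ supp β₀) fun i hi => ?_).trans
    (Finset.card_union_le _ _)
  rw [Finset.mem_union, mem_supp, mem_supp]
  by_contra! hc
  exact mem_supp.1 hi (by simp [hc.1, hc.2])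

lemma Admissible.two_mul_card_le_effDimReal (h : Admissible A₁ A₂ A₃ A₄ X lam π)
    (S : Finset (Fin p)) : 2 * (S.card : ℝ) ≤ effDimReal X A₄ lam S := by
  have hA := h.A₄_pos
  have hr := h.lamRatio_nonneg S
  rw [effDimReal]
  gcongr
  have : 0 ≤ (3 + 33 * lamRatio X lam S) / A₄ := by positivity
  linarith

lemma Admissible.psiBar_mul_le (h : Admissible A₁ A₂ A₃ A₄ X lam π) {β₀ β : Fin p → ℝ}
    (h0 : compat X (supp β₀) ≠ 0) (ht : compat X (supp β₀) ≠ ∞)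
    (hβ : ((supp β).card + (supp β₀).card : ℝ) ≤ effDimReal X A₄ lam (supp β₀)) :
    (psiBar X A₄ lam (supp β₀)).toReal * (colNorm X * l1normOn Finset.univ (β - β₀))
      ≤ l2norm (X *ᵥ (β - β₀)) * √(effDimReal X A₄ lam (supp β₀)) := by
  have hc : ((supp (β - β₀)).card : ℝ) ≤ effDimReal X A₄ lam (supp β₀) :=
    le_trans (by exact_mod_cast card_supp_sub_le β β₀) hβ
  refine (unifCompat_mul_le h.colNorm_pos ?_).trans ?_
  · rw [effDim_eq_ofReal h h0 ht, ← ENNReal.ofReal_natCast]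
    exact ENNReal.ofReal_le_ofReal hc
  · exact mul_le_mul_of_nonneg_left (Real.sqrt_le_sqrt hc) (l2norm_nonneg _)

lemma Admissible.psiTilde_mul_le (h : Admissible A₁ A₂ A₃ A₄ X lam π) {β₀ β : Fin p → ℝ}
    (h0 : compat X (supp β₀) ≠ 0) (ht : compat X (supp β₀) ≠ ∞)
    (hβ : ((supp β).card + (supp β₀).card : ℝ) ≤ effDimReal X A₄ lam (supp β₀)) :
    (psiTilde X A₄ lam (supp β₀)).toReal * (colNorm X * l2norm (β - β₀))
      ≤ l2norm (X *ᵥ (β - β₀)) := by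
  have hc : ((supp (β - β₀)).card : ℝ) ≤ effDimReal X A₄ lam (supp β₀) :=
    le_trans (by exact_mod_cast card_supp_sub_le β β₀) hβ
  refine sparseSing_mul_le h.colNorm_pos ?_
  rw [effDim_eq_ofReal h h0 ht, ← ENNReal.ofReal_natCast]
  exact ENNReal.ofReal_le_ofReal hc

/-- On the event the `ℓ¹`-terms sum to at most `(5λ/4 + λ̄)‖β - β⁰‖₁ ≤ 4λ̄‖β - β⁰‖₁`, since `λ ≤
2λ̄`. As `β - β⁰` is sparse, `ψ̄` bounds this by a multiple of the prediction error, and half of the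
Gaussian quadratic absorbs it. -/
lemma Admissible.logRatio_le (h : Admissible A₁ A₂ A₃ A₄ X lam π) {β₀ β : Fin p → ℝ}
    {y : Fin n → ℝ} (hy : y ∈ noiseEvent X β₀)
    (h0 : compat X (supp β₀) ≠ 0) (ht : compat X (supp β₀) ≠ ∞)
    (hψ : 0 < (psiBar X A₄ lam (supp β₀)).toReal)
    (hβ : ((supp β).card + (supp β₀).card : ℝ) ≤ effDimReal X A₄ lam (supp β₀)) :
    logRatio X lam β₀ y β ≤ -(l2norm (X *ᵥ (β - β₀)) ^ 2 / 4)
      + 64 * Real.log p * effDimReal X A₄ lam (supp β₀) /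
        (psiBar X A₄ lam (supp β₀)).toReal ^ 2
      + logEnvelope lam β₀ β := by
  have hX := h.colNorm_pos
  have hL := h.log_pos
  have hlam := h.lam_pos
  have hlb := h.lamBar_pos
  have hle := h.lam_le
  have h1 := h.psiBar_mul_le h0 ht hβ
  have h2 := (abs_le.1 (abs_dotProduct_mulVec_le X (y - X *ᵥ β₀) (β - β₀) hy)).2
  set D := effDimReal X A₄ lam (supp β₀) with hD
  set ψ := (psiBar X A₄ lam (supp β₀)).toReal with hψdef
  set N := l2norm (X *ᵥ (β - β₀)) with hN
  have hD0 : 0 ≤ D := le_trans (by positivity) hβ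
  have h3 : l1normOn Finset.univ β₀ ≤ l1normOn Finset.univ β + l1normOn Finset.univ (β - β₀) := by
    have h4 := l1norm_sub_le β₀ β
    have h5 := l1norm_split (supp β₀) (β - β₀)
    have h6 := l1normOn_nonneg (supp β₀)ᶜ (β - β₀)
    linarith
  set a := l1normOn Finset.univ (β - β₀) with ha
  have ha0 : 0 ≤ a := l1normOn_nonneg _ _
  have h4 : 4 * lamBar X * a ≤ N ^ 2 / 4 + 64 * Real.log p * D / ψ ^ 2 := by
    set k := 8 * √(Real.log p) * √D / ψ with hk
    have hk2 : k ^ 2 = 64 * Real.log p * D / ψ ^ 2 := by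
      rw [hk, div_pow, mul_pow, mul_pow, Real.sq_sqrt hL.le, Real.sq_sqrt hD0]
      norm_num
    have hak : 4 * lamBar X * a ≤ k * N := by
      rw [hk, div_mul_eq_mul_div, le_div_iff₀ hψ, lamBar]
      calc 4 * (2 * colNorm X * √(Real.log p)) * a * ψ
          = 8 * √(Real.log p) * (ψ * (colNorm X * a)) := by ring
        _ ≤ 8 * √(Real.log p) * (N * √D) := by gcongr
        _ = _ := by ring
    rw [← hk2]
    nlinarith [sq_nonneg (N / 2 - k)]
  have h5 : lam * l1normOn Finset.univ β₀ ≤ lam * (l1normOn Finset.univ β + a) :=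
    mul_le_mul_of_nonneg_left h3 hlam.le
  have h6 : lam * a ≤ 2 * lamBar X * a := mul_le_mul_of_nonneg_right hle ha0
  have h7 : 0 ≤ lamBar X * a := by positivity
  unfold logRatio logEnvelope
  linarith

/-- Models of moderate dimension with a prediction error of at least `R`. -/
def farModels (X : Matrix (Fin n) (Fin p) ℝ) (A₄ lam : ℝ) (β₀ : Fin p → ℝ) (R : ℝ) :
    Set (Fin p → ℝ) :=
  {β | ((supp β).card + (supp β₀).card : ℝ) ≤ effDimReal X A₄ lam (supp β₀)} ∩
    {β | R ≤ l2norm (X *ᵥ (β - β₀))}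

/-- The rate for the prediction error. -/
def recoveryRadius (X : Matrix (Fin n) (Fin p) ℝ) (A₃ A₄ lam : ℝ) (S : Finset (Fin p)) : ℝ :=
  2 * √((70 + A₃) * effDimReal X A₄ lam S * Real.log p) / (psiBar X A₄ lam S).toReal

lemma one_le_effDim (h : Admissible A₁ A₂ A₃ A₄ X lam π) {S : Finset (Fin p)}
    (hS : S.Nonempty) : 1 ≤ effDim X A₄ lam S := by
  have hA := h.A₄_pos
  have h1 : (1 : ℝ≥0∞) ≤ ENNReal.ofReal (2 + 3 / A₄) := by
    rw [← ENNReal.ofReal_one]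
    refine ENNReal.ofReal_le_ofReal ?_
    have : 0 ≤ 3 / A₄ := by positivity
    linarith
  have h2 : (1 : ℝ≥0∞) ≤ S.card := by exact_mod_cast hS.card_pos
  calc (1 : ℝ≥0∞) = 1 * 1 := (one_mul 1).symm
    _ ≤ _ := mul_le_mul' (h1.trans le_self_add) h2

lemma psiBar_le_one (h : Admissible A₁ A₂ A₃ A₄ X lam π) {S : Finset (Fin p)}
    (hS : S.Nonempty) : psiBar X A₄ lam S ≤ 1 :=
  unifCompat_le_one h.colNorm_pos hS.choose (one_le_effDim h hS)

/-- The lower bound of the decrease condition is iterated from `π 0 ≥ 1/2`; `A₁` is absorbed into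
one extra power of `p` per dimension. -/
lemma Admissible.inv_dim_le (h : Admissible A₁ A₂ A₃ A₄ X lam π) (hp : IsLarge A₁ A₂ A₄ p)
    {s : ℕ} (hs : s ≤ p) : 1 / π s ≤ 2 * Real.exp ((1 + A₃) * s * Real.log p) := by
  have hA := h.A₁_pos
  have hA4 := h.A₄_pos
  have hL := h.log_pos
  have hp0 := h.p_pos
  have hπ := h.dim_pos hs
  have hq : A₂ * (p : ℝ) ^ (-A₄) ≤ 1 / 2 := by
    have h1 := h.rate_le hp
    have h2 : Real.exp (-(7 / 8 * A₄ * Real.log p)) ≤ 1 :=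
      Real.exp_le_one_iff.2 (by have := mul_pos hA4 hL; linarith)
    linarith
  have hπ0 := h.half_le_dim_zero hq
  have h1 := h.le_dim hs
  have h2 : Real.exp (-((1 + A₃) * Real.log p)) ≤ A₁ * (p : ℝ) ^ (-A₃) := by
    have h3 : (p : ℝ)⁻¹ ≤ A₁ := by
      have := hp.A₁_ge
      rw [div_le_iff₀ hA] at this
      rw [inv_le_iff_one_le_mul₀ hp0]
      linarith
    calc Real.exp (-((1 + A₃) * Real.log p)) = (p : ℝ)⁻¹ * (p : ℝ) ^ (-A₃) := by
          rw [Real.rpow_def_of_pos hp0, ← Real.exp_log (inv_pos.2 hp0), ← Real.exp_add,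
            Real.log_inv]
          ring_nf
      _ ≤ _ := by gcongr
  rw [div_le_iff₀ hπ]
  have h3 : Real.exp (-((1 + A₃) * s * Real.log p)) * (1 / 2) ≤ π s := by
    refine le_trans ?_ h1
    have : Real.exp (-((1 + A₃) * s * Real.log p)) = Real.exp (-((1 + A₃) * Real.log p)) ^ s := by
      rw [← Real.exp_nat_mul]; ring_nf
    rw [this]
    gcongr
  calc (1 : ℝ) = 2 * Real.exp ((1 + A₃) * s * Real.log p) *
        (Real.exp (-((1 + A₃) * s * Real.log p)) * (1 / 2)) := by
        rw [Real.exp_neg]; field_simp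
    _ ≤ _ := by gcongr

lemma Admissible.posterior_farModels_le [IsProbabilityMeasure (laplace lam)]
    (h : Admissible A₁ A₂ A₃ A₄ X lam π) (hp : IsLarge A₁ A₂ A₄ p) {β₀ : Fin p → ℝ}
    (hβ₀ : (supp β₀).Nonempty) (h0 : compat X (supp β₀) ≠ 0)
    (hψ : 0 < (psiBar X A₄ lam (supp β₀)).toReal)
    {y : Fin n → ℝ} (hy : y ∈ noiseEvent X β₀) :
    posterior X lam π y (farModels X A₄ lam β₀ (recoveryRadius X A₃ A₄ lam (supp β₀)))
      ≤ ENNReal.ofReal (2 * Real.exp 2 * Real.exp (-Real.log p)) := by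
  classical
  have ht : compat X (supp β₀) ≠ ∞ :=
    ((compat_le_one h.colNorm_pos hβ₀).trans_lt ENNReal.one_lt_top).ne
  have hL := h.log_pos
  have hA3 := h.A₃_pos
  have hD2 := h.two_mul_card_le_effDimReal (supp β₀)
  have hψ1 : (psiBar X A₄ lam (supp β₀)).toReal ≤ 1 := by
    simpa using ENNReal.toReal_mono ENNReal.one_ne_top (psiBar_le_one h hβ₀)
  set s := (supp β₀).card with hs
  have hs1 : (1 : ℝ) ≤ s := by exact_mod_cast hβ₀.card_pos
  set R := recoveryRadius X A₃ A₄ lam (supp β₀) with hR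
  set B := farModels X A₄ lam β₀ R with hB
  set D := effDimReal X A₄ lam (supp β₀) with hD
  set ψ := (psiBar X A₄ lam (supp β₀)).toReal with hψdef
  have hD0 : 0 < D := by linarith
  have hR0 : 0 ≤ R := by rw [hR, recoveryRadius]; positivity
  have hR2 : R ^ 2 = 4 * ((70 + A₃) * D * Real.log p) / ψ ^ 2 := by
    rw [hR, recoveryRadius, ← hD, ← hψdef, div_pow, mul_pow, Real.sq_sqrt (by positivity)]
    norm_num
  set E := D / ψ ^ 2 with hE
  have hDE : D ≤ E := by
    rw [hE, le_div_iff₀ (by positivity)]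
    have : ψ ^ 2 ≤ 1 := pow_le_one₀ hψ.le hψ1
    nlinarith
  have hBm : MeasurableSet B := by
    refine (measurableSet_card_supp fun t => ((t : ℝ) + s ≤ D)).inter ?_
    have h1 : Continuous fun β : Fin p → ℝ => l2norm (X *ᵥ (β - β₀)) :=
      continuous_l2norm.comp (continuous_const.matrix_mulVec (continuous_id.sub continuous_const))
    exact measurableSet_le measurable_const h1.measurable
  -- The radius gives `R²/4 = (70 + A₃) E log p`, of which `64 E log p` is used up by the bound on
  -- the likelihood ratio.
  set c : ℝ := -((6 + A₃) * E * Real.log p) with hc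
  calc _ ≤ ENNReal.ofReal (evidenceFactor p π s) *
      ∫⁻ β in B, ENNReal.ofReal (Real.exp (logRatio X lam β₀ y β)) ∂(prior p lam π) :=
        h.posterior_le β₀ y B
    _ ≤ ENNReal.ofReal (evidenceFactor p π s) *
      ∫⁻ β in B, ENNReal.ofReal (Real.exp c) *
        ENNReal.ofReal (Real.exp (logEnvelope lam β₀ β)) ∂(prior p lam π) := by
        refine mul_le_mul_right (setLIntegral_mono
          ((measurable_exp_logEnvelope lam β₀).const_mul _) fun β hβ => ?_) _
        rw [← ENNReal.ofReal_mul (Real.exp_pos _).le, ← Real.exp_add]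
        refine ENNReal.ofReal_le_ofReal (Real.exp_le_exp.2 ?_)
        refine (h.logRatio_le hy h0 ht hψ hβ.1).trans ?_
        rw [← hD, ← hψdef]
        have h1 : R ^ 2 ≤ l2norm (X *ᵥ (β - β₀)) ^ 2 := pow_le_pow_left₀ hR0 hβ.2 2
        have h2 : R ^ 2 = 4 * (70 + A₃) * Real.log p * E := by rw [hR2, hE]; ring
        have h3 : 64 * Real.log p * D / ψ ^ 2 = 64 * Real.log p * E := by rw [hE]; ring
        rw [h3, hc]
        linarith
    _ = ENNReal.ofReal (evidenceFactor p π s) * (ENNReal.ofReal (Real.exp c) *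
        ∫⁻ β in B, ENNReal.ofReal (Real.exp (logEnvelope lam β₀ β)) ∂(prior p lam π)) := by
        rw [lintegral_const_mul' _ _ ENNReal.ofReal_ne_top]
    _ ≤ ENNReal.ofReal (evidenceFactor p π s) * (ENNReal.ofReal (Real.exp c) *
        ∑ t ∈ Finset.range (p + 1),
          ENNReal.ofReal (π t) * (if (t : ℝ) + s ≤ D then 4 ^ t else 0)) := by
        gcongr
        exact setLIntegral_prior_exp_logEnvelope_le h.lam_pos β₀ hBm _ fun β hβ => hβ.1
    _ ≤ ENNReal.ofReal (evidenceFactor p π s) * (ENNReal.ofReal (Real.exp c) *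
        ∑ t ∈ Finset.range (p + 1), ENNReal.ofReal (π t) * ENNReal.ofReal (Real.exp (2 * D))) := by
        gcongr with t _
        split_ifs with htD
        · rw [show (4 : ℝ≥0∞) ^ t = ENNReal.ofReal (4 ^ t) by
            rw [ENNReal.ofReal_pow (by norm_num)]; norm_num]
          refine ENNReal.ofReal_le_ofReal ?_
          have h4 : (4 : ℝ) ≤ Real.exp 2 := by
            have h1 := Real.exp_one_gt_d9
            have h2 : Real.exp 2 = Real.exp 1 ^ 2 := by rw [← Real.exp_nat_mul]; norm_num
            rw [h2]
            nlinarith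
          calc (4 : ℝ) ^ t ≤ Real.exp 2 ^ t := by gcongr
            _ = Real.exp (2 * t) := by rw [← Real.exp_nat_mul]; ring_nf
            _ ≤ _ := by gcongr; linarith
        · exact zero_le
    _ = ENNReal.ofReal (evidenceFactor p π s * (Real.exp c * Real.exp (2 * D))) := by
        rw [← Finset.sum_mul, ← ENNReal.ofReal_sum_of_nonneg, h.isDimPrior.sum_eq_one,
          ENNReal.ofReal_one, one_mul, ← ENNReal.ofReal_mul (Real.exp_pos _).le,
          ← ENNReal.ofReal_mul (h.evidenceFactor_nonneg (card_supp_le β₀))]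
        intro t ht
        exact h.dim_nonneg (by simpa [Nat.lt_succ_iff] using ht)
    _ ≤ _ := by
        refine ENNReal.ofReal_le_ofReal ?_
        have hpow : (p : ℝ) ^ (2 * s) = Real.exp (2 * s * Real.log p) := by
          rw [← Real.rpow_natCast, Real.rpow_def_of_pos h.p_pos]
          push_cast
          ring_nf
        have hπ := h.inv_dim_le hp (card_supp_le β₀)
        rw [← hs] at hπ
        calc _ = Real.exp (2 * s * Real.log p) * Real.exp (s + 2) * (1 / π s) *
              (Real.exp c * Real.exp (2 * D)) := by
              rw [evidenceFactor, hpow]; ring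
          _ ≤ Real.exp (2 * s * Real.log p) * Real.exp (s + 2) *
              (2 * Real.exp ((1 + A₃) * s * Real.log p)) * (Real.exp c * Real.exp (2 * D)) := by
              gcongr
          _ = 2 * Real.exp (2 * s * Real.log p + (s + 2) + (1 + A₃) * s * Real.log p + c
                + 2 * D) := by
              simp only [Real.exp_add]
              ring
          -- The evidence factor takes `(3 + A₃) s log p ≤ (3 + A₃) E log p`. Of the remaining `3E
          -- log p`, a small part covers `s + 2D ≤ 3E` because `log p ≥ 32`, and `E ≥ 1` leaves `log
          -- p`.
          _ ≤ 2 * Real.exp (2 + -Real.log p) := by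
              refine mul_le_mul_of_nonneg_left (Real.exp_le_exp.2 ?_) zero_le_two
              have h5 := hp.log_ge
              have h6 : (s : ℝ) ≤ E := by linarith
              have h7 : 0 ≤ (3 + A₃) * Real.log p * (E - s) :=
                mul_nonneg (by positivity) (by linarith)
              have h8 : 0 ≤ E * (Real.log p - 32) := mul_nonneg (by linarith) (by linarith)
              have h9 : 0 ≤ (E - 1) * Real.log p := mul_nonneg (by linarith) hL.le
              rw [hc]
              nlinarith
          _ = _ := by rw [Real.exp_add]; ring

/-! ### Comparison of nested models -/

lemma likelihood_update (X : Matrix (Fin n) (Fin p) ℝ) (y : Fin n → ℝ) {β : Fin p → ℝ}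
    {i : Fin p} (hi : β i = 0) (b : ℝ) :
    likelihood X y (Function.update β i b) = likelihood X y β * ENNReal.ofReal (Real.exp
      (b * ((y - X *ᵥ β) ⬝ᵥ X.col i) - b ^ 2 * l2norm (X.col i) ^ 2 / 2)) := by
  have h1 : Function.update β i b - β = Pi.single i b := by
    ext j
    by_cases hj : j = i
    · subst hj; simp [hi]
    · simp [hj]
  have h2 : X *ᵥ (Pi.single i b) = b • X.col i := by
    ext j
    simp [mul_comm]
  rw [likelihood_eq_mul X y β, h1, h2, l2norm_smul, dotProduct_smul, mul_pow, sq_abs, smul_eq_mul]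
  congr 3
  ring

lemma measurable_update_coord {p : ℕ} (β : Fin p → ℝ) (i : Fin p) :
    Measurable fun b : ℝ => Function.update β i b :=
  measurable_update β

/-- Entering `b` in coordinate `i` gains `br - b²‖X_i‖²/2`. For `b` of the sign of the correlation
`r` and size between `t` and `2t`, where `t = √(log p)/‖X‖`, the gain is at least `K log p`; the
quadratic costs `2 log p`, the Laplace exponent `8 log p`, and the prior mass `λt/2 ≥ 1/p` one more
`log p`. Hence `K - 11`. -/
lemma Admissible.le_lintegral_likelihood_update (h : Admissible A₁ A₂ A₃ A₄ X lam π)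
    (hp : IsLarge A₁ A₂ A₄ p) {y : Fin n → ℝ} {β : Fin p → ℝ} {i : Fin p} (hi : β i = 0) {K : ℝ}
    (hr : K * colNorm X * √(Real.log p) ≤ |(y - X *ᵥ β) ⬝ᵥ X.col i|) :
    ENNReal.ofReal (Real.exp ((K - 11) * Real.log p)) * likelihood X y β
      ≤ ∫⁻ b, likelihood X y (Function.update β i b) ∂(laplace lam) := by
  have hX := h.colNorm_pos
  have hL := h.log_pos
  have hlam := h.lam_pos
  have hp0 := h.p_pos
  have hm : Measurable fun b : ℝ => likelihood X y (Function.update β i b) :=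
    (measurable_likelihood X y).comp (measurable_update_coord β i)
  set r := (y - X *ᵥ β) ⬝ᵥ X.col i with hrdef
  set q := √(Real.log p) with hq
  have hq2 : q ^ 2 = Real.log p := Real.sq_sqrt hL.le
  have hq0 : 0 < q := Real.sqrt_pos.2 hL
  set t := q / colNorm X with ht
  have ht0 : 0 < t := by positivity
  obtain ⟨A, hAm, hAvol, hA⟩ : ∃ A : Set ℝ, MeasurableSet A ∧ volume A = ENNReal.ofReal t ∧
      ∀ b ∈ A, t * |r| ≤ b * r ∧ |b| ≤ 2 * t := by
    rcases le_total 0 r with hr0 | hr0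
    · refine ⟨Set.Icc t (2 * t), measurableSet_Icc, by rw [Real.volume_Icc]; ring_nf, ?_⟩
      intro b hb
      rw [abs_of_nonneg hr0, abs_of_nonneg (ht0.le.trans hb.1)]
      exact ⟨mul_le_mul_of_nonneg_right hb.1 hr0, hb.2⟩
    · refine ⟨Set.Icc (-(2 * t)) (-t), measurableSet_Icc, by rw [Real.volume_Icc]; ring_nf, ?_⟩
      intro b hb
      rw [abs_of_nonpos hr0, abs_of_nonpos (by linarith [hb.2])]
      exact ⟨by nlinarith [hb.2], by linarith [hb.1]⟩
  rw [lintegral_laplace lam hm]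
  calc _ ≤ ENNReal.ofReal (lam / 2 * t * Real.exp ((K - 10) * Real.log p)) * likelihood X y β := by
        gcongr
        have h1 : Real.exp (-Real.log p) ≤ lam / 2 * t := by
          rw [Real.exp_neg, Real.exp_log hp0]
          have h2 := h.le_lam
          have h3 : 2 ≤ q := by
            refine Real.le_sqrt_of_sq_le ?_
            linarith [hp.log_ge]
          calc (p : ℝ)⁻¹ = colNorm X / p / 2 * (2 / colNorm X) := by field_simp
            _ ≤ lam / 2 * (q / colNorm X) := by gcongr
        calc Real.exp ((K - 11) * Real.log p)
            = Real.exp (-Real.log p) * Real.exp ((K - 10) * Real.log p) := by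
              rw [← Real.exp_add]; ring_nf
          _ ≤ _ := by gcongr
    _ = ∫⁻ _ in A, ENNReal.ofReal (lam / 2 * Real.exp ((K - 10) * Real.log p)) *
          likelihood X y β := by
        rw [lintegral_const, Measure.restrict_apply_univ, hAvol, mul_right_comm (ENNReal.ofReal _),
          ← ENNReal.ofReal_mul (by positivity)]
        congr 2
        ring
    _ ≤ ∫⁻ b in A, ENNReal.ofReal (lam / 2 * Real.exp (-lam * |b|)) *
          likelihood X y (Function.update β i b) := by
        refine setLIntegral_mono (by fun_prop) fun b hb => ?_
        rw [likelihood_update X y hi, mul_left_comm, mul_comm (likelihood X y β),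
          ← ENNReal.ofReal_mul (by positivity)]
        refine mul_le_mul_left (ENNReal.ofReal_le_ofReal ?_) _
        rw [mul_assoc, ← Real.exp_add]
        refine mul_le_mul_of_nonneg_left (Real.exp_le_exp.2 ?_) (by positivity)
        obtain ⟨h1, h2⟩ := hA b hb
        have h3 : K * Real.log p ≤ t * |r| := by
          calc K * Real.log p = t * (K * colNorm X * q) := by
                rw [← hq2, ht]; field_simp
            _ ≤ _ := by gcongr
        have h4 : b ^ 2 * l2norm (X.col i) ^ 2 ≤ 4 * Real.log p := by
          calc b ^ 2 * l2norm (X.col i) ^ 2 ≤ (2 * t) ^ 2 * colNorm X ^ 2 := by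
                rw [← sq_abs b]
                gcongr
                · exact l2norm_nonneg _
                · exact l2norm_col_le X i
            _ = 4 * Real.log p := by rw [← hq2, ht]; field_simp; norm_num
        have h5 : lam * |b| ≤ 8 * Real.log p := by
          calc lam * |b| ≤ (2 * (2 * colNorm X * q)) * (2 * t) := by
                gcongr
                exact h.lam_le
            _ = 8 * Real.log p := by rw [← hq2, ht]; field_simp; norm_num
        linarith
    _ ≤ _ := setLIntegral_le_lintegral _ _

/-- One more coordinate costs `A₁p^(-A₃)` in the dimension prior and at most a factor `p` in the
number of models; the last power of `p` absorbs `A₁`. -/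
lemma Admissible.mul_modelWeight_le (h : Admissible A₁ A₂ A₃ A₄ X lam π)
    (hp : IsLarge A₁ A₂ A₄ p) {S : Finset (Fin p)} {i : Fin p} (hi : i ∉ S) :
    ENNReal.ofReal (Real.exp (-((A₃ + 2) * Real.log p))) * modelWeight p π S
      ≤ modelWeight p π (insert i S) := by
  have hA := h.A₁_pos
  have hp0 := h.p_pos
  have hcard := Finset.card_insert_of_notMem hi
  have hle : S.card + 1 ≤ p := by
    rw [← hcard]; simpa using (insert i S).card_le_univ
  have hπ := h.dim_pos (s := S.card) (by omega)
  rw [modelWeight, modelWeight, hcard, ← ENNReal.ofReal_mul (Real.exp_pos _).le]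
  refine ENNReal.ofReal_le_ofReal ?_
  set s := S.card with hs
  have hc0 : (0 : ℝ) < p.choose s := by exact_mod_cast Nat.choose_pos (by omega)
  have hc1 : (0 : ℝ) < p.choose (s + 1) := by exact_mod_cast Nat.choose_pos hle
  have hch : (p.choose (s + 1) : ℝ) ≤ p * p.choose s := by
    have h1 := Nat.choose_succ_right_eq p s
    have h2 : p.choose (s + 1) ≤ p * p.choose s := by
      calc p.choose (s + 1) ≤ p.choose (s + 1) * (s + 1) := Nat.le_mul_of_pos_right _ (by omega)
        _ = p.choose s * (p - s) := h1
        _ ≤ p.choose s * p := Nat.mul_le_mul_left _ (Nat.sub_le _ _)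
        _ = _ := mul_comm _ _
    exact_mod_cast h2
  have h2 : Real.exp (-((A₃ + 2) * Real.log p)) ≤ A₁ * (p : ℝ) ^ (-A₃) * (1 / p) := by
    have h3 : (p : ℝ)⁻¹ ≤ A₁ := by
      have := hp.A₁_ge
      rw [div_le_iff₀ hA] at this
      rw [inv_le_iff_one_le_mul₀ hp0]
      linarith
    calc Real.exp (-((A₃ + 2) * Real.log p)) = (p : ℝ)⁻¹ * (p : ℝ) ^ (-A₃) * (p : ℝ)⁻¹ := by
          rw [Real.rpow_def_of_pos hp0, ← Real.exp_log (inv_pos.2 hp0), ← Real.exp_add,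
            ← Real.exp_add, Real.log_inv]
          ring_nf
      _ ≤ _ := by rw [one_div]; gcongr
  have h3 : 1 / (p : ℝ) * (1 / (p.choose s : ℝ)) ≤ 1 / (p.choose (s + 1) : ℝ) := by
    rw [one_div_mul_one_div]
    exact one_div_le_one_div_of_le hc1 hch
  calc _ ≤ A₁ * (p : ℝ) ^ (-A₃) * (1 / p) * (π s * (1 / (p.choose s : ℝ))) := by gcongr
    _ = A₁ * (p : ℝ) ^ (-A₃) * π s * (1 / p * (1 / (p.choose s : ℝ))) := by ring
    _ ≤ π (s + 1) * (1 / (p.choose (s + 1) : ℝ)) := by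
      have := h.dim_nonneg hle
      gcongr
      exact h.le_dim_succ hle

/-- Each model `S` without `i` is compared with `S ∪ {i}`: the likelihood integral grows by
`p^(A₃+4)`, the weight drops by at most `p^(A₃+2)`, for a net gain of `p²`. Models containing `i`
give `B` no mass. The sum over enlarged models is part of the evidence. -/
lemma Admissible.posterior_le_of_gain [IsProbabilityMeasure (laplace lam)]
    (h : Admissible A₁ A₂ A₃ A₄ X lam π) (hp : IsLarge A₁ A₂ A₄ p) {y : Fin n → ℝ} {i : Fin p}
    {B : Set (Fin p → ℝ)} (hB : MeasurableSet B) (hB0 : ∀ β ∈ B, β i = 0)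
    (hgain : ∀ β ∈ B, (A₃ + 15) * colNorm X * √(Real.log p) ≤ |(y - X *ᵥ β) ⬝ᵥ X.col i|) :
    posterior X lam π y B ≤ ENNReal.ofReal (Real.exp (-(2 * Real.log p))) := by
  classical
  have hLm := measurable_likelihood X y
  set g := ENNReal.ofReal (Real.exp ((A₃ + 4) * Real.log p)) with hg
  set w := ENNReal.ofReal (Real.exp (-((A₃ + 2) * Real.log p))) with hw
  set F : Finset (Fin p) → ℝ≥0∞ := fun S =>
    modelWeight p π S * ∫⁻ β, likelihood X y β ∂(slab p lam S) with hF
  have h1 : ∀ S : Finset (Fin p), w * g * (modelWeight p π S *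
      ∫⁻ β in B, likelihood X y β ∂(slab p lam S)) ≤ if i ∉ S then F (insert i S) else 0 := by
    intro S
    split_ifs with hi
    · have h2 : slab p lam S B = 0 :=
        measure_mono_null (fun β hβ => by simpa using hB0 β hβ)
          (ae_iff.1 (ae_slab_ne_zero (lam := lam) S hi))
      rw [Measure.restrict_eq_zero.2 h2, lintegral_zero_measure]
      simp
    · have h2 : g * ∫⁻ β in B, likelihood X y β ∂(slab p lam S)
          ≤ ∫⁻ β, likelihood X y β ∂(slab p lam (insert i S)) := by
        rw [lintegral_slab_insert S hi hLm, ← lintegral_const_mul' _ _ ENNReal.ofReal_ne_top]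
        refine le_trans (setLIntegral_mono' hB fun β hβ => ?_) (setLIntegral_le_lintegral B _)
        have := h.le_lintegral_likelihood_update hp (hB0 β hβ) (hgain β hβ)
        rwa [show A₃ + 15 - 11 = A₃ + 4 by ring] at this
      calc _ = (w * modelWeight p π S) * (g * ∫⁻ β in B, likelihood X y β ∂(slab p lam S)) := by
            ring
        _ ≤ _ := mul_le_mul' (h.mul_modelWeight_le hp hi) h2
  have h2 : w * g * ∫⁻ β in B, likelihood X y β ∂(prior p lam π)
      ≤ ∫⁻ β, likelihood X y β ∂(prior p lam π) := by
    rw [setLIntegral_prior lam π hB, lintegral_prior, Finset.mul_sum]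
    refine (Finset.sum_le_sum fun S _ => h1 S).trans ?_
    rw [← Finset.sum_filter]
    -- Injectivity of `S ↦ S ∪ {i}` ensures that no part of the evidence is counted twice.
    have hinj : Set.InjOn (fun S : Finset (Fin p) => insert i S)
        (Finset.univ.filter fun S : Finset (Fin p) => i ∉ S) := by
      intro S hS T hT hST
      have hS' : i ∉ S := by simpa using hS
      have hT' : i ∉ T := by simpa using hT
      rw [← Finset.erase_insert hS', ← Finset.erase_insert hT']
      exact congrArg (fun U => U.erase i) hST
    rw [← Finset.sum_image (f := F) hinj]
    exact Finset.sum_le_sum_of_subset (Finset.subset_univ _)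
  have hwg : w * g = ENNReal.ofReal (Real.exp (2 * Real.log p)) := by
    rw [hw, hg, ← ENNReal.ofReal_mul (Real.exp_pos _).le, ← Real.exp_add]
    ring_nf
  rw [hwg] at h2
  have hu : ENNReal.ofReal (Real.exp (-(2 * Real.log p))) *
      ENNReal.ofReal (Real.exp (2 * Real.log p)) = 1 := by
    rw [← ENNReal.ofReal_mul (Real.exp_pos _).le, ← Real.exp_add]
    simp
  rw [posterior]
  refine ENNReal.div_le_of_le_mul ?_
  calc _ = ENNReal.ofReal (Real.exp (-(2 * Real.log p))) *
      (ENNReal.ofReal (Real.exp (2 * Real.log p)) *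
        ∫⁻ β in B, likelihood X y β ∂(prior p lam π)) := by rw [← mul_assoc, hu, one_mul]
    _ ≤ _ := by gcongr

end

end SparseRegression

end

noncomputable section

namespace SparseRegression

section
variable {A₁ A₂ A₃ A₄ : ℝ} {n p : ℕ} {X : Matrix (Fin n) (Fin p) ℝ} {lam : ℝ} {π : ℕ → ℝ}

/-! ### Selection for a single regression problem -/

/-- The bound for the expected posterior probability of a selection error. -/
def selectionError (p : ℕ) : ℝ :=
  2 / p + 2 * Real.exp 2 * Real.exp (-(Real.log p / 2)) + 2 * Real.exp 2 * Real.exp (-Real.log p)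
    + Real.exp (-Real.log p)

/-- Models of moderate dimension with a small prediction error. -/
def goodModels (X : Matrix (Fin n) (Fin p) ℝ) (A₃ A₄ lam : ℝ) (β₀ : Fin p → ℝ) :
    Set (Fin p → ℝ) :=
  {β | ((supp β).card + (supp β₀).card : ℝ) ≤ effDimReal X A₄ lam (supp β₀)} ∩
    {β | l2norm (X *ᵥ (β - β₀)) < recoveryRadius X A₃ A₄ lam (supp β₀)}

lemma measurableSet_goodModels (X : Matrix (Fin n) (Fin p) ℝ) (A₃ A₄ lam : ℝ)
    (β₀ : Fin p → ℝ) : MeasurableSet (goodModels X A₃ A₄ lam β₀) := by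
  refine (measurableSet_card_supp fun t =>
    ((t : ℝ) + (supp β₀).card ≤ effDimReal X A₄ lam (supp β₀))).inter ?_
  have h1 : Continuous fun β : Fin p → ℝ => l2norm (X *ᵥ (β - β₀)) :=
    continuous_l2norm.comp (continuous_const.matrix_mulVec (continuous_id.sub continuous_const))
  exact measurableSet_lt h1.measurable measurable_const

lemma Admissible.posterior_add_compl [IsProbabilityMeasure (laplace lam)]
    (h : Admissible A₁ A₂ A₃ A₄ X lam π) (y : Fin n → ℝ) {B : Set (Fin p → ℝ)}
    (hB : MeasurableSet B) : posterior X lam π y B + posterior X lam π y Bᶜ = 1 := by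
  have hZ0 : ∫⁻ β, likelihood X y β ∂(prior p lam π) ≠ 0 := by
    have h1 := h.le_evidence y 0
    have h2 := h.dim_pos (card_supp_le (0 : Fin p → ℝ))
    have hp := h.p_pos
    refine (lt_of_lt_of_le ?_ h1).ne'
    exact ENNReal.mul_pos (ENNReal.ofReal_pos.2 (by positivity)).ne' (likelihood_pos X y 0).ne'
  have hZt : ∫⁻ β, likelihood X y β ∂(prior p lam π) ≠ ∞ := by
    refine ((lintegral_mono (likelihood_le_one X y)).trans_lt ?_).ne
    simp
  rw [posterior, posterior, ← ENNReal.add_div, lintegral_add_compl _ hB,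
    ENNReal.div_self hZ0 hZt]

lemma Admissible.expPosterior_add_compl [IsProbabilityMeasure (laplace lam)]
    (h : Admissible A₁ A₂ A₃ A₄ X lam π) (β₀ : Fin p → ℝ) {B : Set (Fin p → ℝ)}
    (hB : MeasurableSet B) :
    expPosterior X lam π β₀ B + expPosterior X lam π β₀ Bᶜ = 1 := by
  rw [expPosterior, expPosterior, ← lintegral_add_left (measurable_posterior X lam π B)]
  simp [h.posterior_add_compl _ hB]

lemma Admissible.one_le_expPosterior_univ [IsProbabilityMeasure (laplace lam)]
    (h : Admissible A₁ A₂ A₃ A₄ X lam π) (β₀ : Fin p → ℝ) :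
    1 ≤ expPosterior X lam π β₀ Set.univ := by
  rw [← h.expPosterior_add_compl β₀ MeasurableSet.univ]
  simp [expPosterior, posterior]

/-- Outside `B`, a parameter has large dimension, or large prediction error, or is good. The first
case is controlled only after integration over the event; the other two hold for each `y` in it. -/
lemma Admissible.one_le_expPosterior_add [IsProbabilityMeasure (laplace lam)]
    (h : Admissible A₁ A₂ A₃ A₄ X lam π) (hp : IsLarge A₁ A₂ A₄ p) {β₀ : Fin p → ℝ}
    (hβ₀ : (supp β₀).Nonempty) (h0 : compat X (supp β₀) ≠ 0)
    (hψ : 0 < (psiBar X A₄ lam (supp β₀)).toReal) {B : Set (Fin p → ℝ)} (hB : MeasurableSet B)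
    (hgood : ∀ y ∈ noiseEvent X β₀, posterior X lam π y (Bᶜ ∩ goodModels X A₃ A₄ lam β₀)
      ≤ ENNReal.ofReal (Real.exp (-Real.log p))) :
    1 ≤ expPosterior X lam π β₀ B + ENNReal.ofReal (selectionError p) := by
  have ht : compat X (supp β₀) ≠ ∞ :=
    ((compat_le_one h.colNorm_pos hβ₀).trans_lt ENNReal.one_lt_top).ne
  have hφ := ENNReal.toReal_pos h0 ht
  rw [← h.expPosterior_add_compl β₀ hB]
  gcongr
  have hcover : Bᶜ ⊆ (largeModels X A₄ lam β₀ ∪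
      farModels X A₄ lam β₀ (recoveryRadius X A₃ A₄ lam (supp β₀))) ∪
      (Bᶜ ∩ goodModels X A₃ A₄ lam β₀) := by
    intro β hβ
    rcases lt_or_ge (effDimReal X A₄ lam (supp β₀)) ((supp β).card + (supp β₀).card : ℝ)
      with h1 | h1
    · exact Or.inl (Or.inl h1)
    · rcases lt_or_ge (l2norm (X *ᵥ (β - β₀))) (recoveryRadius X A₃ A₄ lam (supp β₀))
        with h2 | h2
      · exact Or.inr ⟨hβ, h1, h2⟩
      · exact Or.inl (Or.inr ⟨h1, h2⟩)
  rw [expPosterior, ← lintegral_add_compl _ (measurableSet_noiseEvent X β₀)]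
  have h1 : ∫⁻ y in (noiseEvent X β₀)ᶜ, posterior X lam π y Bᶜ ∂(dataLaw X β₀)
      ≤ ENNReal.ofReal (2 / p) := by
    refine le_trans ?_ (dataLaw_compl_noiseEvent_le h.colNorm_pos h.two_le β₀)
    calc _ ≤ ∫⁻ _ in (noiseEvent X β₀)ᶜ, 1 ∂(dataLaw X β₀) :=
          lintegral_mono fun y => posterior_le_one X lam π y _
      _ = _ := by simp
  have h2 : ∫⁻ y in noiseEvent X β₀, posterior X lam π y Bᶜ ∂(dataLaw X β₀)
      ≤ ENNReal.ofReal (2 * Real.exp 2 * Real.exp (-(Real.log p / 2))) +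
        (ENNReal.ofReal (2 * Real.exp 2 * Real.exp (-Real.log p))
          + ENNReal.ofReal (Real.exp (-Real.log p))) := by
    set δ := ENNReal.ofReal (2 * Real.exp 2 * Real.exp (-Real.log p))
          + ENNReal.ofReal (Real.exp (-Real.log p)) with hδ
    calc _ ≤ ∫⁻ y in noiseEvent X β₀, (posterior X lam π y (largeModels X A₄ lam β₀) + δ)
            ∂(dataLaw X β₀) := by
          refine setLIntegral_mono ((measurable_posterior X lam π _).add_const _) fun y hy => ?_
          refine (posterior_mono X lam π y hcover).trans ((posterior_union_le X lam π y _ _).trans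
            ((add_le_add_left (posterior_union_le X lam π y _ _) _).trans ?_))
          rw [add_assoc]
          exact add_le_add_right (add_le_add (h.posterior_farModels_le hp hβ₀ h0 hψ hy)
            (hgood y hy)) _
      _ = ∫⁻ y in noiseEvent X β₀, posterior X lam π y (largeModels X A₄ lam β₀)
            ∂(dataLaw X β₀) + δ * dataLaw X β₀ (noiseEvent X β₀) := by
          rw [lintegral_add_left (measurable_posterior X lam π _)]
          simp
      _ ≤ _ := by
          refine add_le_add (h.lintegral_posterior_largeModels_le hp β₀ hβ₀ hφ) ?_
          exact mul_le_of_le_one_right zero_le prob_le_one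
  refine (add_le_add h2 h1).trans (le_of_eq ?_)
  rw [← ENNReal.ofReal_add (by positivity) (by positivity),
    ← ENNReal.ofReal_add (by positivity) (by positivity),
    ← ENNReal.ofReal_add (by positivity) (by positivity), selectionError]
  congr 1
  ring

/-- The multiplier of the detection thresholds above which selection is consistent. -/
def thresholdConst (A₃ A₄ : ℝ) : ℝ := 2 * √(70 + A₃) * (2 + 69 / A₄)

/-! ### From prediction error to estimation error, and the first two selection statements. -/

/-- With `λ/λ̄ ≤ 2` and `1 ≤ 1/φ²`, every term is at most a multiple of `1/φ²`; `69 = 3 + 2 · 33`.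
-/
lemma Admissible.effDimReal_le (h : Admissible A₁ A₂ A₃ A₄ X lam π) {S : Finset (Fin p)}
    (hφ : 0 < (compat X S).toReal) (hφ1 : (compat X S).toReal ≤ 1) :
    effDimReal X A₄ lam S ≤ (2 + 69 / A₄) * (S.card / (compat X S).toReal ^ 2) := by
  have hA := h.A₄_pos
  have hlb := h.lamBar_pos
  rw [effDimReal, lamRatio]
  set φ := (compat X S).toReal with hφdef
  have h1 : 1 ≤ 1 / φ ^ 2 := by
    rw [le_div_iff₀ (by positivity), one_mul]
    exact pow_le_one₀ hφ.le hφ1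
  have h2 : lam / (lamBar X * φ ^ 2) ≤ 2 * (1 / φ ^ 2) := by
    rw [← div_div, div_eq_mul_one_div]
    gcongr
    rw [div_le_iff₀ hlb]
    exact h.lam_le
  have h3 : (3 + 33 * (lam / (lamBar X * φ ^ 2))) / A₄ ≤ 69 / A₄ * (1 / φ ^ 2) := by
    rw [div_mul_eq_mul_div]
    gcongr
    linarith
  calc _ ≤ (2 * (1 / φ ^ 2) + 69 / A₄ * (1 / φ ^ 2)) * (S.card : ℝ) := by
        gcongr
        linarith
    _ = _ := by ring

/-- Both the radius and the passage to the `ℓ¹`-norm carry `√D/ψ̄`, which explains the full power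
`D`, hence `s/φ²`, and the square of `ψ̄`. -/
lemma Admissible.l1norm_lt_of_mem_goodModels (h : Admissible A₁ A₂ A₃ A₄ X lam π)
    {β₀ β : Fin p → ℝ} (hβ₀ : (supp β₀).Nonempty) (h0 : compat X (supp β₀) ≠ 0)
    (hψ : 0 < (psiBar X A₄ lam (supp β₀)).toReal) (hβ : β ∈ goodModels X A₃ A₄ lam β₀) :
    l1normOn Finset.univ (β - β₀) < thresholdConst A₃ A₄ /
      (psiBar X A₄ lam (supp β₀)).toReal ^ 2 * ((supp β₀).card * √(Real.log p) /
        (colNorm X * (compat X (supp β₀)).toReal ^ 2)) := by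
  have ht : compat X (supp β₀) ≠ ∞ :=
    ((compat_le_one h.colNorm_pos hβ₀).trans_lt ENNReal.one_lt_top).ne
  have hφ := ENNReal.toReal_pos h0 ht
  have hφ1 : (compat X (supp β₀)).toReal ≤ 1 := by
    simpa using ENNReal.toReal_mono ENNReal.one_ne_top (compat_le_one h.colNorm_pos hβ₀)
  have h1 := h.psiBar_mul_le h0 ht hβ.1
  have h2 : l2norm (X *ᵥ (β - β₀)) < recoveryRadius X A₃ A₄ lam (supp β₀) := hβ.2
  have hDle := h.effDimReal_le hφ hφ1
  have hD2 := h.two_mul_card_le_effDimReal (supp β₀)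
  have hs1 : (1 : ℝ) ≤ (supp β₀).card := by exact_mod_cast hβ₀.card_pos
  have hX := h.colNorm_pos
  have hL := h.log_pos
  have hA3 := h.A₃_pos
  rw [recoveryRadius] at h2
  set D := effDimReal X A₄ lam (supp β₀) with hD
  set ψ := (psiBar X A₄ lam (supp β₀)).toReal with hψdef
  set φ := (compat X (supp β₀)).toReal with hφdef
  have hD0 : 0 < D := by linarith
  have h3 : ψ * (colNorm X * l1normOn Finset.univ (β - β₀))
      < 2 * √((70 + A₃) * D * Real.log p) / ψ * √D :=
    h1.trans_lt (mul_lt_mul_of_pos_right h2 (Real.sqrt_pos.2 hD0))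
  have h4 : 2 * √((70 + A₃) * D * Real.log p) / ψ * √D
      = 2 * √(70 + A₃) * √(Real.log p) * D / ψ := by
    rw [Real.sqrt_mul (by positivity), Real.sqrt_mul (by positivity)]
    calc _ = 2 * √(70 + A₃) * √(Real.log p) * (√D * √D) / ψ := by ring
      _ = _ := by rw [Real.mul_self_sqrt hD0.le]
  rw [h4] at h3
  have h5 : l1normOn Finset.univ (β - β₀)
      < 2 * √(70 + A₃) * √(Real.log p) * D / ψ ^ 2 / colNorm X := by
    rw [lt_div_iff₀ hX, lt_div_iff₀ (by positivity)]
    rw [lt_div_iff₀ hψ] at h3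
    calc _ = ψ * (colNorm X * l1normOn Finset.univ (β - β₀)) * ψ := by ring
      _ < _ := h3
  refine h5.trans_le ?_
  calc _ ≤ 2 * √(70 + A₃) * √(Real.log p) * ((2 + 69 / A₄) * ((supp β₀).card / φ ^ 2)) / ψ ^ 2
        / colNorm X := by gcongr
    _ = _ := by rw [thresholdConst]; field_simp

lemma Admissible.l2norm_lt_of_mem_goodModels (h : Admissible A₁ A₂ A₃ A₄ X lam π)
    {β₀ β : Fin p → ℝ} (hβ₀ : (supp β₀).Nonempty) (h0 : compat X (supp β₀) ≠ 0)
    (hψt : 0 < (psiTilde X A₄ lam (supp β₀)).toReal)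
    (hle : (psiTilde X A₄ lam (supp β₀)).toReal ≤ (psiBar X A₄ lam (supp β₀)).toReal)
    (hβ : β ∈ goodModels X A₃ A₄ lam β₀) :
    l2norm (β - β₀) < thresholdConst A₃ A₄ /
      (psiTilde X A₄ lam (supp β₀)).toReal ^ 2 * (√((supp β₀).card * Real.log p) /
        (colNorm X * (compat X (supp β₀)).toReal)) := by
  have ht : compat X (supp β₀) ≠ ∞ :=
    ((compat_le_one h.colNorm_pos hβ₀).trans_lt ENNReal.one_lt_top).ne
  have hφ := ENNReal.toReal_pos h0 ht
  have hφ1 : (compat X (supp β₀)).toReal ≤ 1 := by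
    simpa using ENNReal.toReal_mono ENNReal.one_ne_top (compat_le_one h.colNorm_pos hβ₀)
  have h1 := h.psiTilde_mul_le h0 ht hβ.1
  have h2 : l2norm (X *ᵥ (β - β₀)) < recoveryRadius X A₃ A₄ lam (supp β₀) := hβ.2
  have hDle := h.effDimReal_le hφ hφ1
  have hD2 := h.two_mul_card_le_effDimReal (supp β₀)
  have hs1 : (1 : ℝ) ≤ (supp β₀).card := by exact_mod_cast hβ₀.card_pos
  have hX := h.colNorm_pos
  have hL := h.log_pos
  have hA3 := h.A₃_pos
  have hA4 := h.A₄_pos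
  rw [recoveryRadius] at h2
  set D := effDimReal X A₄ lam (supp β₀) with hD
  set ψ := (psiBar X A₄ lam (supp β₀)).toReal with hψdef
  set ψ' := (psiTilde X A₄ lam (supp β₀)).toReal with hψ'def
  set φ := (compat X (supp β₀)).toReal with hφdef
  have hD0 : 0 < D := by linarith
  set C : ℝ := 2 + 69 / A₄ with hC
  have hC1 : 1 ≤ C := by
    have : 0 ≤ 69 / A₄ := by positivity
    linarith
  -- Here only one `√D` occurs. Since `C ≥ 1`, `√C` may be replaced by `C`, which lets both
  -- thresholds share one constant.
  have h3 : √((70 + A₃) * D * Real.log p) ≤ √(70 + A₃) * (C * √((supp β₀).card * Real.log p) / φ) := by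
    rw [mul_assoc, Real.sqrt_mul (by positivity)]
    gcongr
    refine Real.sqrt_le_iff.2 ⟨by positivity, ?_⟩
    rw [div_pow, mul_pow, Real.sq_sqrt (by positivity)]
    calc D * Real.log p ≤ C * ((supp β₀).card / φ ^ 2) * Real.log p := by gcongr
      _ ≤ C ^ 2 * ((supp β₀).card / φ ^ 2) * Real.log p := by
          gcongr
          nlinarith
      _ = _ := by ring
  have h4 : l2norm (β - β₀) < 2 * √((70 + A₃) * D * Real.log p) / ψ' / (ψ' * colNorm X) := by
    rw [lt_div_iff₀ (by positivity)]
    calc l2norm (β - β₀) * (ψ' * colNorm X) = ψ' * (colNorm X * l2norm (β - β₀)) := by ring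
      _ ≤ _ := h1
      _ < _ := h2
      _ ≤ _ := by gcongr
  refine h4.trans_le ?_
  calc _ ≤ 2 * (√(70 + A₃) * (C * √((supp β₀).card * Real.log p) / φ)) / ψ' / (ψ' * colNorm X) := by
        gcongr
    _ = _ := by rw [thresholdConst, ← hC]; field_simp

lemma measurableSet_selection {p : ℕ} (P : Fin p → Prop) :
    MeasurableSet {β : Fin p → ℝ | ∀ i, P i → i ∈ supp β} := by
  simp only [Set.ofPred_forall, mem_supp]
  refine MeasurableSet.iInter fun i => MeasurableSet.iInter fun _ => ?_
  exact (measurableSet_singleton (0 : ℝ)).compl.preimage (measurable_pi_apply i)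

lemma Admissible.one_le_of_eq_univ [IsProbabilityMeasure (laplace lam)]
    (h : Admissible A₁ A₂ A₃ A₄ X lam π) (β₀ : Fin p → ℝ) {B : Set (Fin p → ℝ)}
    (hB : ∀ β, β ∈ B) : 1 ≤ expPosterior X lam π β₀ B + ENNReal.ofReal (selectionError p) := by
  rw [Set.eq_univ_of_forall hB]
  exact (h.one_le_expPosterior_univ β₀).trans le_self_add

lemma measurableSet_selection_threshold {p : ℕ} (β₀ : Fin p → ℝ) (T : ℝ≥0∞) :
    MeasurableSet {β : Fin p → ℝ | ∀ i ∈ supp β₀, T ≤ ENNReal.ofReal |β₀ i| → i ∈ supp β} := by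
  have := measurableSet_selection fun i : Fin p => i ∈ supp β₀ ∧ T ≤ ENNReal.ofReal |β₀ i|
  simpa only [and_imp] using this

lemma Admissible.one_le_expPosterior_thresholdL1 [IsProbabilityMeasure (laplace lam)]
    (h : Admissible A₁ A₂ A₃ A₄ X lam π) (hp : IsLarge A₁ A₂ A₄ p) {M : ℝ} (hM0 : 0 < M)
    (hM : thresholdConst A₃ A₄ ≤ M) (β₀ : Fin p → ℝ) :
    1 ≤ expPosterior X lam π β₀ {β | ∀ i ∈ supp β₀,
      thresholdL1 X A₄ lam M (supp β₀) ≤ ENNReal.ofReal |β₀ i| → i ∈ supp β}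
      + ENNReal.ofReal (selectionError p) := by
  have hX := h.colNorm_pos
  have hL := h.log_pos
  rcases (supp β₀).eq_empty_or_nonempty with hS | hS
  · refine h.one_le_of_eq_univ β₀ fun β i hi => ?_
    rw [hS] at hi
    simp at hi
  have hs1 : (0 : ℝ) < (supp β₀).card := by exact_mod_cast hS.card_pos
  have hφt : compat X (supp β₀) ≠ ∞ :=
    ((compat_le_one h.colNorm_pos hS).trans_lt ENNReal.one_lt_top).ne
  have hψt : psiBar X A₄ lam (supp β₀) ≠ ∞ :=
    ((psiBar_le_one h hS).trans_lt ENNReal.one_lt_top).ne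
  have hM' : ENNReal.ofReal M ≠ 0 := (ENNReal.ofReal_pos.2 hM0).ne'
  have hnum : ENNReal.ofReal ((supp β₀).card * √(Real.log p)) ≠ 0 :=
    (ENNReal.ofReal_pos.2 (by positivity)).ne'
  -- A vanishing design number makes the threshold infinite, so no coordinate has to be detected.
  -- The other factor is checked to be nonzero because `0 · ∞ = 0`.
  by_cases hφ0 : compat X (supp β₀) = 0
  · refine h.one_le_of_eq_univ β₀ fun β i _ hT => ?_
    rw [thresholdL1, hφ0, zero_pow two_ne_zero, mul_zero, ENNReal.div_zero hnum,
      ENNReal.mul_top (ENNReal.div_ne_zero.2 ⟨hM', ENNReal.pow_ne_top hψt⟩)] at hT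
    simp at hT
  by_cases hψ0 : psiBar X A₄ lam (supp β₀) = 0
  · refine h.one_le_of_eq_univ β₀ fun β i _ hT => ?_
    rw [thresholdL1, hψ0, zero_pow two_ne_zero, ENNReal.div_zero hM', ENNReal.top_mul
      (ENNReal.div_ne_zero.2 ⟨hnum, ENNReal.mul_ne_top ENNReal.ofReal_ne_top
        (ENNReal.pow_ne_top hφt)⟩)] at hT
    simp at hT
  have hψ := ENNReal.toReal_pos hψ0 hψt
  have hφ := ENNReal.toReal_pos hφ0 hφt
  refine h.one_le_expPosterior_add hp hS hφ0 hψ (measurableSet_selection_threshold β₀ _)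
    fun y _ => ?_
  have hT : thresholdL1 X A₄ lam M (supp β₀) = ENNReal.ofReal (M /
      (psiBar X A₄ lam (supp β₀)).toReal ^ 2 * ((supp β₀).card * √(Real.log p) /
        (colNorm X * (compat X (supp β₀)).toReal ^ 2))) := by
    rw [ENNReal.ofReal_mul (by positivity), ENNReal.ofReal_div_of_pos (by positivity),
      ENNReal.ofReal_div_of_pos (by positivity), ENNReal.ofReal_mul hX.le,
      ENNReal.ofReal_pow hψ.le, ENNReal.ofReal_pow hφ.le, ENNReal.ofReal_toReal hψt,
      ENNReal.ofReal_toReal hφt, thresholdL1]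
  -- No good `β` misses a coordinate above the threshold: the exceptional set is empty.
  refine (posterior_mono X lam π y (B := ∅) ?_).trans (by simp [posterior])
  rintro β ⟨hβ, hg⟩
  refine hβ fun i _ hi => mem_supp.2 fun hi0 => ?_
  rw [hT, ENNReal.ofReal_le_ofReal_iff (abs_nonneg _)] at hi
  have h1 := h.l1norm_lt_of_mem_goodModels hS hφ0 hψ hg
  have h2 := abs_le_l1norm (β - β₀) i
  rw [Pi.sub_apply, hi0, zero_sub, abs_neg] at h2
  refine absurd (hi.trans h2) (not_le.2 (h1.trans_le ?_))
  gcongr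

lemma Admissible.one_le_expPosterior_thresholdL2 [IsProbabilityMeasure (laplace lam)]
    (h : Admissible A₁ A₂ A₃ A₄ X lam π) (hp : IsLarge A₁ A₂ A₄ p) {M : ℝ} (hM0 : 0 < M)
    (hM : thresholdConst A₃ A₄ ≤ M) (β₀ : Fin p → ℝ) :
    1 ≤ expPosterior X lam π β₀ {β | ∀ i ∈ supp β₀,
      thresholdL2 X A₄ lam M (supp β₀) ≤ ENNReal.ofReal |β₀ i| → i ∈ supp β}
      + ENNReal.ofReal (selectionError p) := by
  have hX := h.colNorm_pos
  have hL := h.log_pos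
  rcases (supp β₀).eq_empty_or_nonempty with hS | hS
  · refine h.one_le_of_eq_univ β₀ fun β i hi => ?_
    rw [hS] at hi
    simp at hi
  have hs1 : (0 : ℝ) < (supp β₀).card := by exact_mod_cast hS.card_pos
  have hφt : compat X (supp β₀) ≠ ∞ :=
    ((compat_le_one h.colNorm_pos hS).trans_lt ENNReal.one_lt_top).ne
  have hle : psiTilde X A₄ lam (supp β₀) ≤ psiBar X A₄ lam (supp β₀) :=
    sparseSing_le_unifCompat hX _
  have hψBt : psiBar X A₄ lam (supp β₀) ≠ ∞ :=
    ((psiBar_le_one h hS).trans_lt ENNReal.one_lt_top).ne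
  have hψt : psiTilde X A₄ lam (supp β₀) ≠ ∞ := (hle.trans_lt hψBt.lt_top).ne
  have hM' : ENNReal.ofReal M ≠ 0 := (ENNReal.ofReal_pos.2 hM0).ne'
  have hnum : ENNReal.ofReal √((supp β₀).card * Real.log p) ≠ 0 :=
    (ENNReal.ofReal_pos.2 (by positivity)).ne'
  by_cases hφ0 : compat X (supp β₀) = 0
  · refine h.one_le_of_eq_univ β₀ fun β i _ hT => ?_
    rw [thresholdL2, hφ0, mul_zero, ENNReal.div_zero hnum,
      ENNReal.mul_top (ENNReal.div_ne_zero.2 ⟨hM', ENNReal.pow_ne_top hψt⟩)] at hT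
    simp at hT
  by_cases hψ0 : psiTilde X A₄ lam (supp β₀) = 0
  · refine h.one_le_of_eq_univ β₀ fun β i _ hT => ?_
    rw [thresholdL2, hψ0, zero_pow two_ne_zero, ENNReal.div_zero hM', ENNReal.top_mul
      (ENNReal.div_ne_zero.2 ⟨hnum, ENNReal.mul_ne_top ENNReal.ofReal_ne_top hφt⟩)] at hT
    simp at hT
  have hψ := ENNReal.toReal_pos hψ0 hψt
  have hφ := ENNReal.toReal_pos hφ0 hφt
  have hle' := ENNReal.toReal_mono hψBt hle
  refine h.one_le_expPosterior_add hp hS hφ0 (hψ.trans_le hle')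
    (measurableSet_selection_threshold β₀ _) fun y _ => ?_
  have hT : thresholdL2 X A₄ lam M (supp β₀) = ENNReal.ofReal (M /
      (psiTilde X A₄ lam (supp β₀)).toReal ^ 2 * (√((supp β₀).card * Real.log p) /
        (colNorm X * (compat X (supp β₀)).toReal))) := by
    rw [ENNReal.ofReal_mul (by positivity), ENNReal.ofReal_div_of_pos (by positivity),
      ENNReal.ofReal_div_of_pos (by positivity), ENNReal.ofReal_mul hX.le,
      ENNReal.ofReal_pow hψ.le, ENNReal.ofReal_toReal hψt, ENNReal.ofReal_toReal hφt, thresholdL2]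
  refine (posterior_mono X lam π y (B := ∅) ?_).trans (by simp [posterior])
  rintro β ⟨hβ, hg⟩
  refine hβ fun i _ hi => mem_supp.2 fun hi0 => ?_
  rw [hT, ENNReal.ofReal_le_ofReal_iff (abs_nonneg _)] at hi
  have h1 := h.l2norm_lt_of_mem_goodModels hS hφ0 hψ hle' hg
  have h2 := abs_le_l2norm (β - β₀) i
  rw [Pi.sub_apply, hi0, zero_sub, abs_neg] at h2
  refine absurd (hi.trans h2) (not_le.2 (h1.trans_le ?_))
  gcongr

/-! ### Selection under mutual coherence -/

lemma mutualCoherence_nonneg (X : Matrix (Fin n) (Fin p) ℝ) : 0 ≤ mutualCoherence X :=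
  Real.iSup_nonneg fun _ => div_nonneg (abs_nonneg _) (mul_nonneg (l2norm_nonneg _) (l2norm_nonneg _))

/-- When `β i = 0`, the residual contains the full signal `β⁰_i X_i`. Its correlation with `X_i` is
perturbed by the noise, at most `λ̄`, and by the other columns, each contributing at most the
coherence times `‖X‖²`. -/
lemma le_abs_residual_dotProduct_col {β₀ β : Fin p → ℝ} {y : Fin n → ℝ}
    (hy : y ∈ noiseEvent X β₀) {i : Fin p} (hi : β i = 0) :
    l2norm (X.col i) ^ 2 * |β₀ i| - lamBar X
      - mutualCoherence X * colNorm X ^ 2 * l1normOn Finset.univ (β - β₀)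
      ≤ |(y - X *ᵥ β) ⬝ᵥ X.col i| := by
  have h1 : (y - X *ᵥ β) ⬝ᵥ X.col i
      = X.col i ⬝ᵥ (y - X *ᵥ β₀) - X.col i ⬝ᵥ X *ᵥ (β - β₀) := by
    rw [Matrix.mulVec_sub, ← dotProduct_sub, dotProduct_comm]
    congr 1
    abel
  have h2 : X.col i ⬝ᵥ X *ᵥ (β - β₀) = -β₀ i * l2norm (X.col i) ^ 2
      + ∑ j ∈ Finset.univ.erase i, (β - β₀) j * (X.col j ⬝ᵥ X.col i) := by
    rw [dotProduct_mulVec_eq_sum, ← Finset.add_sum_erase _ _ (Finset.mem_univ i), l2norm_sq,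
      Pi.sub_apply, hi, zero_sub]
  have h3 : |∑ j ∈ Finset.univ.erase i, (β - β₀) j * (X.col j ⬝ᵥ X.col i)|
      ≤ mutualCoherence X * colNorm X ^ 2 * l1normOn Finset.univ (β - β₀) := by
    have hm := mutualCoherence_nonneg X
    rw [l1normOn, Finset.mul_sum]
    refine (Finset.abs_sum_le_sum_abs _ _).trans ?_
    refine (Finset.sum_le_sum fun j hj => ?_).trans
      (Finset.sum_le_sum_of_subset_of_nonneg (Finset.erase_subset i Finset.univ)
        fun j _ _ => by positivity)
    rw [abs_mul, mul_comm]
    exact mul_le_mul_of_nonneg_right (abs_col_dotProduct_le X (Finset.ne_of_mem_erase hj))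
      (abs_nonneg _)
  set e := ∑ j ∈ Finset.univ.erase i, (β - β₀) j * (X.col j ⬝ᵥ X.col i) with he
  have h4 := hy i
  rw [h1, h2]
  have h5 : l2norm (X.col i) ^ 2 * |β₀ i| = |β₀ i * l2norm (X.col i) ^ 2| := by
    rw [abs_mul, abs_of_nonneg (sq_nonneg (l2norm (X.col i))), mul_comm]
  rw [h5]
  set u := X.col i ⬝ᵥ (y - X *ᵥ β₀) with hu
  set b := β₀ i * l2norm (X.col i) ^ 2 with hb
  have h6 : b = (u - (-β₀ i * l2norm (X.col i) ^ 2 + e)) - u + e := by rw [hb]; ring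
  have h7 := abs_add_le ((u - (-β₀ i * l2norm (X.col i) ^ 2 + e)) - u) e
  have h8 := abs_sub (u - (-β₀ i * l2norm (X.col i) ^ 2 + e)) u
  rw [← h6] at h7
  linarith

/-- The multiplier of the detection threshold under mutual coherence. -/
def coherenceConst (A₃ A₄ c₀ : ℝ) : ℝ :=
  (A₃ + 17 + thresholdConst A₃ A₄ / c₀ ^ 2) / c₀ ^ 2

lemma Admissible.one_le_expPosterior_coherence [IsProbabilityMeasure (laplace lam)]
    (h : Admissible A₁ A₂ A₃ A₄ X lam π) (hp : IsLarge A₁ A₂ A₄ p) {M c₀ : ℝ} (hc₀ : 0 < c₀)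
    (hM0 : 0 < M) (hM : coherenceConst A₃ A₄ c₀ ≤ M) {β₀ : Fin p → ℝ}
    (hφ : ENNReal.ofReal c₀ ≤ compat X (supp β₀))
    (hψ : ENNReal.ofReal c₀ ≤ psiTilde X A₄ lam (supp β₀))
    (hmc : mutualCoherence X * (supp β₀).card ≤ c₀ ^ 2) :
    1 ≤ expPosterior X lam π β₀
      {β | ∀ i : Fin p, M * √(Real.log p) / colNorm X ≤ |β₀ i| → i ∈ supp β}
      + ENNReal.ofReal (selectionError p) := by
  have hX := h.colNorm_pos
  have hL := h.log_pos
  have hp0 := h.p_pos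
  have hA3 := h.A₃_pos
  have hA4 := h.A₄_pos
  rcases (supp β₀).eq_empty_or_nonempty with hS | hS
  · refine h.one_le_of_eq_univ β₀ fun β i hi => ?_
    have : β₀ i = 0 := by
      by_contra hc
      have := mem_supp.2 hc
      simp [hS] at this
    rw [this, abs_zero] at hi
    have : 0 < M * √(Real.log p) / colNorm X := by positivity
    linarith
  have hφt : compat X (supp β₀) ≠ ∞ :=
    ((compat_le_one h.colNorm_pos hS).trans_lt ENNReal.one_lt_top).ne
  have hle : psiTilde X A₄ lam (supp β₀) ≤ psiBar X A₄ lam (supp β₀) :=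
    sparseSing_le_unifCompat hX _
  have hψBt : psiBar X A₄ lam (supp β₀) ≠ ∞ :=
    ((psiBar_le_one h hS).trans_lt ENNReal.one_lt_top).ne
  have hψt : psiTilde X A₄ lam (supp β₀) ≠ ∞ := (hle.trans_lt hψBt.lt_top).ne
  have hφ' : c₀ ≤ (compat X (supp β₀)).toReal := (ENNReal.ofReal_le_iff_le_toReal hφt).1 hφ
  have hψ' : c₀ ≤ (psiTilde X A₄ lam (supp β₀)).toReal :=
    (ENNReal.ofReal_le_iff_le_toReal hψt).1 hψ
  have hψB : c₀ ≤ (psiBar X A₄ lam (supp β₀)).toReal :=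
    hψ'.trans (ENNReal.toReal_mono hψBt hle)
  have hφ0 : compat X (supp β₀) ≠ 0 := by
    rintro h0
    rw [h0] at hφ'
    simp at hφ'
    linarith
  have hC0 : 0 ≤ thresholdConst A₃ A₄ := by unfold thresholdConst; positivity
  have hmc0 := mutualCoherence_nonneg X
  -- The coherence bound is relative to the longest column, so signal strength needs every column to
  -- have length at least `c₀‖X‖`.
  have hcol : ∀ i, c₀ * colNorm X ≤ l2norm (X.col i) := fun i =>
    (mul_le_mul_of_nonneg_right hψ' hX.le).trans
      (sparseSing_mul_colNorm_le hX i (one_le_effDim h hS))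
  refine h.one_le_expPosterior_add hp hS hφ0 (hc₀.trans_le hψB)
    (measurableSet_selection fun i => M * √(Real.log p) / colNorm X ≤ |β₀ i|) fun y hy => ?_
  set q := √(Real.log p) with hq
  set G := goodModels X A₃ A₄ lam β₀ with hG
  set B : Fin p → Set (Fin p → ℝ) := fun i =>
    {β | M * q / colNorm X ≤ |β₀ i| ∧ β i = 0} ∩ G with hBdef
  have hBi : ∀ i, posterior X lam π y (B i) ≤ ENNReal.ofReal (Real.exp (-(2 * Real.log p))) := by
    intro i
    refine h.posterior_le_of_gain hp (i := i) ?_ (fun β hβ => hβ.1.2) fun β hβ => ?_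
    · refine MeasurableSet.inter ?_ (measurableSet_goodModels X A₃ A₄ lam β₀)
      by_cases hi : M * q / colNorm X ≤ |β₀ i|
      · simp only [hi, true_and]
        exact (measurableSet_singleton (0 : ℝ)).preimage (measurable_pi_apply i)
      · simp [hi]
    · have h1 := le_abs_residual_dotProduct_col hy hβ.1.2
      have h2 := (h.l1norm_lt_of_mem_goodModels hS hφ0 (hc₀.trans_le hψB) hβ.2).le
      refine le_trans ?_ h1
      have h3 : l1normOn Finset.univ (β - β₀) ≤ thresholdConst A₃ A₄ / c₀ ^ 2 *
          ((supp β₀).card * q / (colNorm X * c₀ ^ 2)) := by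
        refine h2.trans ?_
        gcongr
      have h4 : mutualCoherence X * colNorm X ^ 2 * l1normOn Finset.univ (β - β₀)
          ≤ thresholdConst A₃ A₄ / c₀ ^ 2 * (colNorm X * q) := by
        -- The `ℓ¹`-error carries a factor `s`, which the coherence cancels: their product is at
        -- most `c₀²`.
        calc _ ≤ mutualCoherence X * colNorm X ^ 2 * (thresholdConst A₃ A₄ / c₀ ^ 2 *
              ((supp β₀).card * q / (colNorm X * c₀ ^ 2))) := by gcongr
          _ = (mutualCoherence X * (supp β₀).card) *
              (thresholdConst A₃ A₄ / c₀ ^ 2 * (colNorm X * q) / c₀ ^ 2) := by field_simp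
          _ ≤ c₀ ^ 2 * (thresholdConst A₃ A₄ / c₀ ^ 2 * (colNorm X * q) / c₀ ^ 2) := by gcongr
          _ = _ := by field_simp
      have h5 : c₀ ^ 2 * M * (colNorm X * q) ≤ l2norm (X.col i) ^ 2 * |β₀ i| := by
        calc c₀ ^ 2 * M * (colNorm X * q) = (c₀ * colNorm X) ^ 2 * (M * q / colNorm X) := by
              field_simp
          _ ≤ _ := by
              gcongr
              · exact hcol i
              · exact hβ.1.1
      -- Of the signal, `2` goes to `λ̄ = 2‖X‖√(log p)` and the last summand to the coherence term;
      -- `A₃ + 15` remains, as required for the model comparison.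
      have h6 : A₃ + 17 + thresholdConst A₃ A₄ / c₀ ^ 2 ≤ c₀ ^ 2 * M := by
        rw [coherenceConst, div_le_iff₀ (by positivity)] at hM
        linarith
      have h7 : (A₃ + 17 + thresholdConst A₃ A₄ / c₀ ^ 2) * (colNorm X * q)
          ≤ c₀ ^ 2 * M * (colNorm X * q) := by gcongr
      have h8 : lamBar X = 2 * (colNorm X * q) := by rw [lamBar]; ring
      rw [h8]
      linarith
  have hsub : {β : Fin p → ℝ | ∀ i : Fin p, M * q / colNorm X ≤ |β₀ i| → i ∈ supp β}ᶜ ∩ G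
      ⊆ ⋃ i ∈ Finset.univ, B i := by
    rintro β ⟨hβ, hg⟩
    simp only [Set.mem_compl_iff, Set.mem_ofPred_eq, not_forall, mem_supp, not_not] at hβ
    obtain ⟨i, hi, hi0⟩ := hβ
    exact Set.mem_biUnion (Finset.mem_coe.2 (Finset.mem_univ i)) ⟨⟨hi, hi0⟩, hg⟩
  have hunion : ∀ s : Finset (Fin p), posterior X lam π y (⋃ i ∈ s, B i)
      ≤ ∑ i ∈ s, posterior X lam π y (B i) := by
    intro s
    classical
    induction s using Finset.induction_on with
    | empty => simp [posterior]
    | insert a s ha ih =>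
      rw [Finset.set_biUnion_insert, Finset.sum_insert ha]
      exact (posterior_union_le X lam π y _ _).trans (by gcongr)
  calc _ ≤ ∑ i, posterior X lam π y (B i) :=
        (posterior_mono X lam π y hsub).trans (hunion Finset.univ)
    _ ≤ ∑ _i : Fin p, ENNReal.ofReal (Real.exp (-(2 * Real.log p))) :=
        Finset.sum_le_sum fun i _ => hBi i
    _ = ENNReal.ofReal (Real.exp (-Real.log p)) := by
        rw [Finset.sum_const, Finset.card_univ, Fintype.card_fin, nsmul_eq_mul,
          ← ENNReal.ofReal_natCast, ← ENNReal.ofReal_mul (by positivity)]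
        congr 1
        nth_rewrite 1 [← Real.exp_log hp0]
        rw [← Real.exp_add]
        ring_nf

/-! ### Limits along sequences of regression problems -/

lemma tendsto_selectionError : Tendsto selectionError atTop (𝓝 0) := by
  have hlog : Tendsto (fun p : ℕ => Real.log p) atTop atTop :=
    Real.tendsto_log_atTop.comp tendsto_natCast_atTop_atTop
  have h1 : Tendsto (fun p : ℕ => Real.exp (-Real.log p)) atTop (𝓝 0) :=
    Real.tendsto_exp_neg_atTop_nhds_zero.comp hlog
  have h2 : Tendsto (fun p : ℕ => Real.exp (-(Real.log p / 2))) atTop (𝓝 0) :=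
    Real.tendsto_exp_neg_atTop_nhds_zero.comp (hlog.atTop_div_const two_pos)
  have h3 : Tendsto (fun p : ℕ => (2 : ℝ) / p) atTop (𝓝 0) :=
    tendsto_const_nhds.div_atTop tendsto_natCast_atTop_atTop
  have := ((h3.add (h2.const_mul (2 * Real.exp 2))).add (h1.const_mul (2 * Real.exp 2))).add h1
  simp only [mul_zero, add_zero] at this
  exact this

lemma eventually_isLarge (A₁ A₂ : ℝ) {A₄ : ℝ} (hA₄ : 0 < A₄) :
    ∀ᶠ p : ℕ in atTop, IsLarge A₁ A₂ A₄ p := by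
  have hlog : Tendsto (fun p : ℕ => Real.log p) atTop atTop :=
    Real.tendsto_log_atTop.comp tendsto_natCast_atTop_atTop
  have h1 : Tendsto (fun p : ℕ => Real.exp (A₄ * Real.log p / 8)) atTop atTop :=
    Real.tendsto_exp_atTop.comp ((hlog.const_mul_atTop hA₄).atTop_div_const (by norm_num))
  filter_upwards [hlog.eventually_ge_atTop 32, h1.eventually_ge_atTop (8 * A₂),
    (tendsto_natCast_atTop_atTop (R := ℝ)).eventually_ge_atTop (2 / A₁)] with p h2 h3 h4
  exact ⟨h2, h4, h3⟩

end

/-- Nondegeneracy comes from `0 < λ ≤ 2λ̄`: it forces `λ̄ > 0`, so `X ≠ 0`, and `log p > 0`, which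
excludes `p = 0` and `p = 1`. -/
lemma Regime.admissible {A₁ A₂ A₃ A₄ : ℝ} {n p : ℕ → ℕ}
    {X : ∀ k, Matrix (Fin (n k)) (Fin (p k)) ℝ} {lam : ℕ → ℝ} {π : ℕ → ℕ → ℝ}
    (h : Regime A₁ A₂ A₃ A₄ n p X lam π) (hA₁ : 0 < A₁) (hA₂ : 0 < A₂) (hA₃ : 0 < A₃)
    (hA₄ : 0 < A₄) (k : ℕ) : Admissible A₁ A₂ A₃ A₄ (X k) (lam k) (π k) := by
  have h1 : 0 < lamBar (X k) := by
    have := h.lam_pos k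
    have := h.lam_le k
    linarith
  have hX0 : 0 ≤ colNorm (X k) := Real.iSup_nonneg fun i => l2norm_nonneg _
  have hX : 0 < colNorm (X k) := by
    refine hX0.lt_of_ne' fun h0 => ?_
    simp [lamBar, h0] at h1
  have hp : 2 ≤ p k := by
    by_contra hc
    have : p k = 0 ∨ p k = 1 := by omega
    rcases this with h0 | h0 <;> simp [lamBar, h0] at h1
  exact ⟨hA₁, hA₂, hA₃, hA₄, hp, hX, h.lam_pos k, h.le_lam k, h.lam_le k, h.isDimPrior k,
    h.dimDecrease k⟩

lemma tendsto_one_of_one_le_add {p : ℕ → ℕ} (hp : Tendsto p atTop atTop) {f : ℕ → ℝ≥0∞}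
    (hf : ∀ k, f k ≤ 1) (h : ∀ᶠ k in atTop, 1 ≤ f k + ENNReal.ofReal (selectionError (p k))) :
    Tendsto f atTop (𝓝 1) := by
  have h1 : Tendsto (fun k => 1 - ENNReal.ofReal (selectionError (p k))) atTop (𝓝 1) := by
    have h2 := ENNReal.tendsto_ofReal (tendsto_selectionError.comp hp)
    rw [ENNReal.ofReal_zero] at h2
    simpa using ENNReal.Tendsto.sub (tendsto_const_nhds (x := (1 : ℝ≥0∞))) h2
      (Or.inl ENNReal.one_ne_top)
  refine tendsto_of_tendsto_of_tendsto_of_le_of_le' h1 tendsto_const_nhds ?_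
    (Eventually.of_forall hf)
  filter_upwards [h] with k hk
  exact tsub_le_iff_right.2 hk

lemma mutualCoherence_mul_card_le {n p : ℕ} {X : Matrix (Fin n) (Fin p) ℝ} {s : ℕ} {d : ℝ}
    (hd : 0 ≤ d)
    (h : (s : ℝ≥0∞) ≤ ENNReal.ofReal d * (ENNReal.ofReal (mutualCoherence X))⁻¹) :
    mutualCoherence X * s ≤ d := by
  -- With coherence zero the inverse is `∞` and the cardinality is unrestricted, but the product is
  -- still `0`.
  rcases (mutualCoherence_nonneg X).eq_or_lt with h0 | h0
  · rw [← h0, zero_mul]; exact hd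
  rw [← div_eq_mul_inv, ← ENNReal.ofReal_div_of_pos h0, ← ENNReal.ofReal_natCast,
    ENNReal.ofReal_le_ofReal_iff (by positivity), le_div_iff₀ h0] at h
  linarith

end SparseRegression

end

/-! ### The three limits. -/

open SparseRegression in
theorem theorem5 (A₁ A₂ A₃ A₄ : ℝ) (hA₁ : 0 < A₁) (hA₂ : 0 < A₂) (hA₃ : 0 < A₃) (hA₄ : 0 < A₄) :
    (∃ M₀ : ℝ, 0 < M₀ ∧ ∀ M : ℝ, M₀ ≤ M →
      ∀ (n p : ℕ → ℕ) (X : ∀ k, Matrix (Fin (n k)) (Fin (p k)) ℝ) (lam : ℕ → ℝ) (π : ℕ → ℕ → ℝ),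
        Regime A₁ A₂ A₃ A₄ n p X lam π →
        Tendsto (fun k => ⨅ β₀ : Fin (p k) → ℝ,
            expPosterior (X k) (lam k) (π k) β₀
              {β | ∀ i ∈ supp β₀,
                thresholdL1 (X k) A₄ (lam k) M (supp β₀) ≤ ENNReal.ofReal |β₀ i| → i ∈ supp β})
          atTop (𝓝 1) ∧
        Tendsto (fun k => ⨅ β₀ : Fin (p k) → ℝ,
            expPosterior (X k) (lam k) (π k) β₀
              {β | ∀ i ∈ supp β₀,
                thresholdL2 (X k) A₄ (lam k) M (supp β₀) ≤ ENNReal.ofReal |β₀ i| → i ∈ supp β})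
          atTop (𝓝 1)) ∧
    (∀ c₀ : ℝ, 0 < c₀ → ∃ M₀ : ℝ, 0 < M₀ ∧ ∀ M : ℝ, M₀ ≤ M →
      ∀ d₀ : ℝ, 0 < d₀ → d₀ ≤ c₀ ^ 2 * (1 + 2 / A₄)⁻¹ / 8 →
      ∀ (n p : ℕ → ℕ) (X : ∀ k, Matrix (Fin (n k)) (Fin (p k)) ℝ) (lam : ℕ → ℝ) (π : ℕ → ℕ → ℝ),
        Regime A₁ A₂ A₃ A₄ n p X lam π →
        ∀ s : ℕ → ℝ, (∀ k, 0 ≤ s k) →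
        Tendsto (fun k => lam k * s k * √(Real.log (p k)) / colNorm (X k)) atTop (𝓝 0) →
        Tendsto (fun k => ⨅ β₀ ∈ {β₀ : Fin (p k) → ℝ |
              ENNReal.ofReal c₀ ≤ compat (X k) (supp β₀) ∧
              ENNReal.ofReal c₀ ≤ psiTilde (X k) A₄ (lam k) (supp β₀) ∧
              ((supp β₀).card : ℝ) ≤ s k ∧
              ((supp β₀).card : ℝ≥0∞) ≤
                ENNReal.ofReal d₀ * (ENNReal.ofReal (mutualCoherence (X k)))⁻¹},
            expPosterior (X k) (lam k) (π k) β₀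
              {β | ∀ i : Fin (p k), M * √(Real.log (p k)) / colNorm (X k) ≤ |β₀ i| → i ∈ supp β})
          atTop (𝓝 1)) := by
  refine ⟨⟨max 1 (thresholdConst A₃ A₄), by positivity, ?_⟩, fun c₀ hc₀ =>
    ⟨max 1 (coherenceConst A₃ A₄ c₀), by positivity, ?_⟩⟩
  · intro M hM n p X lam π hreg
    have hM0 : 0 < M := zero_lt_one.trans_le ((le_max_left _ _).trans hM)
    have hM1 : thresholdConst A₃ A₄ ≤ M := (le_max_right _ _).trans hM
    have hlarge := hreg.tendsto_p.eventually (eventually_isLarge A₁ A₂ hA₄)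
    constructor
    · refine tendsto_one_of_one_le_add hreg.tendsto_p
        (fun k => (iInf_le _ 0).trans (expPosterior_le_one _ _ _ _ _)) ?_
      filter_upwards [hlarge] with k hk
      have := isProbabilityMeasure_laplace (hreg.lam_pos k)
      rw [ENNReal.iInf_add]
      exact le_iInf fun β₀ => (hreg.admissible hA₁ hA₂ hA₃ hA₄ k).one_le_expPosterior_thresholdL1
        hk hM0 hM1 β₀
    · refine tendsto_one_of_one_le_add hreg.tendsto_p
        (fun k => (iInf_le _ 0).trans (expPosterior_le_one _ _ _ _ _)) ?_
      filter_upwards [hlarge] with k hk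
      have := isProbabilityMeasure_laplace (hreg.lam_pos k)
      rw [ENNReal.iInf_add]
      exact le_iInf fun β₀ => (hreg.admissible hA₁ hA₂ hA₃ hA₄ k).one_le_expPosterior_thresholdL2
        hk hM0 hM1 β₀
  · intro M hM d₀ hd₀ hd₀le n p X lam π hreg s hs _
    have hM0 : 0 < M := zero_lt_one.trans_le ((le_max_left _ _).trans hM)
    have hM1 : coherenceConst A₃ A₄ c₀ ≤ M := (le_max_right _ _).trans hM
    -- The factor `(1 + 2/A₄)⁻¹/8` is at most one.
    have hd₀c : d₀ ≤ c₀ ^ 2 := by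
      refine hd₀le.trans ?_
      have h1 : (1 + 2 / A₄)⁻¹ ≤ 1 := inv_le_one_of_one_le₀ (by
        have : 0 ≤ 2 / A₄ := by positivity
        linarith)
      have h2 : c₀ ^ 2 * (1 + 2 / A₄)⁻¹ ≤ c₀ ^ 2 * 1 := by gcongr
      have h3 : 0 ≤ c₀ ^ 2 := by positivity
      linarith
    have hsupp : ∀ k, supp (0 : Fin (p k) → ℝ) = ∅ := fun k => by simp [supp]
    -- The zero vector satisfies all constraints, so the infimum is not the `∞` of an empty family
    -- and is at most one.
    refine tendsto_one_of_one_le_add hreg.tendsto_p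
      (fun k => (iInf₂_le 0 ⟨?_, ?_, ?_, ?_⟩).trans (expPosterior_le_one _ _ _ _ _)) ?_
    rotate_left
    · rw [hsupp, compat]
      simp
    -- For the empty model the effective dimension is `0`, no vector competes, and `ψ̃ = ∞`.
    · rw [hsupp, psiTilde, effDim, sparseSing]
      simp only [Finset.card_empty, Nat.cast_zero, mul_zero]
      refine le_iInf₂ fun β hβ => absurd hβ.2 ?_
      rw [not_le]
      exact_mod_cast Nat.pos_of_ne_zero hβ.1
    · rw [hsupp]
      simpa using hs k
    · rw [hsupp]
      simp
    filter_upwards [hreg.tendsto_p.eventually (eventually_isLarge A₁ A₂ hA₄)] with k hk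
    have := isProbabilityMeasure_laplace (hreg.lam_pos k)
    rw [ENNReal.iInf_add]
    refine le_iInf fun β₀ => ?_
    rw [ENNReal.iInf_add]
    refine le_iInf fun hβ₀ => ?_
    obtain ⟨h1, h2, _, h4⟩ := hβ₀
    exact (hreg.admissible hA₁ hA₂ hA₃ hA₄ k).one_le_expPosterior_coherence hk hc₀ hM0 hM1 h1 h2
      ((mutualCoherence_mul_card_le hd₀.le h4).trans hd₀c)
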